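/- Let $\mathbb T=\mathbb R/2\pi\mathbb Z$ with the normalized measure $dx/2\pi$, so that $\int_{\mathbb T}f\,dx=\frac1{2\pi}\int_0^{2\pi}f(x)\,dx$, and let $L^p(\mathbb T)$ be taken with respect to it. Write $\langle n\rangle=\sqrt{1+n^2}$, $\hat u(n)$ for the Fourier coefficients of $u$, $\|u\|_{H^\sigma}^2=\sum_n\langle n\rangle^{2\sigma}|\hat u(n)|^2$ and $P_{\le N}u=\sum_{|n|\le N}\hat u(n)e^{inx}$. Let $(g_n)_{n\in\mathbb Z}$ be independent complex Gaussians whose real and imaginary parts are independent and $N(0,\frac12)$-distributed, and let $\mu$ be the law of the random series $u=\sum_{n\in\mathbb Z}\frac{g_n}{\langle n\rangle}e^{inx}$, which is a probability measure on $L^2(\mathbb T)$ concentrated on $\bigcap_{s<1/2}H^s(\mathbb T)$. For $m,\epsilon>0$ let $$\mu_m^\epsilon(E)=\frac{\mu(E\cap B_{m,\epsilon})}{\mu(B_{m,\epsilon})},\qquad B_{m,\epsilon}=\{u:\ m-\epsilon<\|u\|_{L^2(\mathbb T)}^2<m+\epsilon\},$$ and let $\mu_m$ be the measure with $\mu_m(E)=\lim_{\epsilon\to0+}\mu_m^\epsilon(E)$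 for all measurable $E\subset L^2(\mathbb T)$ that depend on finitely many Fourier coefficients only. Let $$f_N(u)=-\frac{3i}{4}\int_{\mathbb T}\overline{P_{\le N}u}^{\,2}\,\partial_x\big((P_{\le N}u)^2\big)\,dx ,$$ and let $f$ be the limit of $f_N$ as $N\to\infty$; it is given by $f(u)=\lim_{j\to\infty}f_{2^j}(u)$ wherever this limit exists. Finally let $$d\rho_m^\epsilon=\beta_{m,\epsilon}\,e^{f(u)-\frac12\int_{\mathbb T}|u|^6dx}\,d\mu_m^\epsilon,\qquad d\rho_m=\beta_m\,e^{f(u)-\frac12\int_{\mathbb T}|u|^6dx}\,d\mu_m,$$ where $\beta_{m,\epsilon}$ and $\beta_m$ are the normalizing constants. **Theorem.** There is a constant $m'>0$ such that for every $m$ with $0<m<m'$ the following holds. The measure $\mu_m$ exists, and $f_N\to f$ both in $L^2(\mu)$ and in $L^2(\mu_m)$. For every $\sigma<\frac12$, $\rho_m$ and, for all sufficiently small $\epsilon>0$, $\rho_m^\epsilon$ are well-defined probability measures on $H^\sigma(\mathbb T)$, and $\rho_m^\epsilon$ converges weakly to $\rho_m$ in $H^\sigma(\mathbb T)$ as $\epsilon\to0+$,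 that is, $$\lim_{\epsilon\to0+}\int F\,d\rho_m^\epsilon=\int F\,d\rho_m\qquad\text{for every bounded continuous }F:H^\sigma(\mathbb T)\to\mathbb R .$$ -/

import Mathlib

open MeasureTheory ProbabilityTheory Filter Topology
open scoped ENNReal NNReal Real BoundedContinuousFunction ComplexConjugate

noncomputable section

namespace DNLS

instance factTwoPiPos : Fact (0 < 2 * π) := ⟨Real.two_pi_pos⟩

/-- The torus `ℝ / 2πℤ`. -/
abbrev Torus : Type := AddCircle (2 * π)

/-- `L²(𝕋)`, with respect to the normalized measure `dx / 2π`. -/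
abbrev L2 : Type := Lp ℂ 2 (AddCircle.haarAddCircle : Measure Torus)

instance measurableSpaceL2 : MeasurableSpace L2 := borel L2

instance borelSpaceL2 : BorelSpace L2 := ⟨rfl⟩

/-- The Japanese bracket `⟨n⟩ = √(1 + n²)`. -/
def bracket (n : ℤ) : ℝ := √(1 + (n : ℝ) ^ 2)

/-- The sequence of Fourier coefficients `û(n) = (2π)⁻¹ ∫ u(x) e^{-inx} dx`. -/
def coeffs (u : L2) : ℤ → ℂ := fun n => fourierCoeff (u : Torus → ℂ) n

/-! ### Sobolev spaces -/

/-- The elements of `H^σ(𝕋)`, as a subspace of the space of all sequences of Fourier coefficients: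
those `a` for which `∑ ⟨n⟩^{2σ} |a n|² < ∞`. -/
def sobolevSubmodule (σ : ℝ) : Submodule ℂ (ℤ → ℂ) where
  carrier := {a | Memℓp (fun n => ((bracket n ^ σ : ℝ) : ℂ) * a n) 2}
  zero_mem' := by
    have h : (fun n : ℤ => ((bracket n ^ σ : ℝ) : ℂ) * (0 : ℤ → ℂ) n) = 0 := by
      ext n; simp
    simp only [Set.mem_ofPred_eq, h]
    exact zero_memℓp
  add_mem' := by
    intro a b ha hb
    have h : (fun n : ℤ => ((bracket n ^ σ : ℝ) : ℂ) * (a + b) n) =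
        (fun n : ℤ => ((bracket n ^ σ : ℝ) : ℂ) * a n) +
          (fun n : ℤ => ((bracket n ^ σ : ℝ) : ℂ) * b n) := by
      ext n; simp [mul_add]
    simp only [Set.mem_ofPred_eq, h]
    exact Memℓp.add ha hb
  smul_mem' := by
    intro c a ha
    have h : (fun n : ℤ => ((bracket n ^ σ : ℝ) : ℂ) * (c • a) n) =
        c • (fun n : ℤ => ((bracket n ^ σ : ℝ) : ℂ) * a n) := by
      ext n; simp only [Pi.smul_apply, smul_eq_mul]; ring
    simp only [Set.mem_ofPred_eq, h]
    exact Memℓp.const_smul ha c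

/-- The Sobolev space `H^σ(𝕋)` of periodic distributions, for every real `σ`. An element is given by
its Fourier coefficients. -/
def Sobolev (σ : ℝ) : Type := sobolevSubmodule σ

instance addCommGroupSobolev (σ : ℝ) : AddCommGroup (Sobolev σ) :=
  inferInstanceAs (AddCommGroup (sobolevSubmodule σ))

instance moduleSobolev (σ : ℝ) : Module ℂ (Sobolev σ) :=
  inferInstanceAs (Module ℂ (sobolevSubmodule σ))

/-- The Fourier coefficients of an element of `H^σ(𝕋)`. -/
def Sobolev.coeffs {σ : ℝ} (u : Sobolev σ) : ℤ → ℂ := u.1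

/-- The map `u ↦ (⟨n⟩^σ û(n))ₙ` from `H^σ(𝕋)` to `ℓ²(ℤ)`. -/
def Sobolev.toEll2 (σ : ℝ) : Sobolev σ →ₗ[ℂ] lp (fun _ : ℤ => ℂ) 2 where
  toFun u := ⟨fun n => ((bracket n ^ σ : ℝ) : ℂ) * u.coeffs n, u.2⟩
  map_add' u v := by
    ext n
    exact mul_add _ (u.coeffs n) (v.coeffs n)
  map_smul' c u := by
    ext n
    exact mul_left_comm _ c (u.coeffs n)

theorem bracket_pos (n : ℤ) : 0 < bracket n := Real.sqrt_pos.mpr (by positivity)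

theorem Sobolev.toEll2_injective (σ : ℝ) : Function.Injective (Sobolev.toEll2 σ) := by
  intro u v h
  apply Subtype.ext
  funext n
  have h' : ((bracket n ^ σ : ℝ) : ℂ) * u.coeffs n = ((bracket n ^ σ : ℝ) : ℂ) * v.coeffs n :=
    congrArg (fun w : lp (fun _ : ℤ => ℂ) 2 => w n) h
  have hne : ((bracket n ^ σ : ℝ) : ℂ) ≠ 0 :=
    Complex.ofReal_ne_zero.mpr (Real.rpow_pos_of_pos (bracket_pos n) σ).ne'
  exact mul_left_cancel₀ hne h'

/-- The norm `‖u‖_{H^σ} = (∑ ⟨n⟩^{2σ} |û(n)|²)^{1/2}`. -/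
instance normedAddCommGroupSobolev (σ : ℝ) : NormedAddCommGroup (Sobolev σ) :=
  NormedAddCommGroup.induced (Sobolev σ) (lp (fun _ : ℤ => ℂ) 2) (Sobolev.toEll2 σ)
    (Sobolev.toEll2_injective σ)

instance measurableSpaceSobolev (σ : ℝ) : MeasurableSpace (Sobolev σ) := borel (Sobolev σ)

instance borelSpaceSobolev (σ : ℝ) : BorelSpace (Sobolev σ) := ⟨rfl⟩

/-- A measure `ν` on `L²(𝕋)`, viewed as a measure on `H^σ(𝕋)`: a Borel set `E ⊆ H^σ(𝕋)` gets the
`ν`-measure of the set of those `u ∈ L²(𝕋)` that belong to `E`. -/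
def onSobolev (σ : ℝ) (ν : Measure L2) : Measure (Sobolev σ) :=
  (ν.map coeffs).comap Sobolev.coeffs

/-! ### The Gaussian measure and its conditionings on the mass -/

/-- The law of `a + ib` with `a`, `b` independent and `N(0, 1/2)`-distributed. -/
def complexGaussian : Measure ℂ :=
  ((gaussianReal 0 (1 / 2)).prod (gaussianReal 0 (1 / 2))).map
    (fun p : ℝ × ℝ => (p.1 : ℂ) + Complex.I * (p.2 : ℂ))

instance isProbabilityMeasureComplexGaussian : IsProbabilityMeasure complexGaussian :=
  Measure.isProbabilityMeasure_map (by fun_prop)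

/-- The law of a family `(gₙ)`, `n ∈ ℤ`, of independent standard complex Gaussians. -/
def gaussianFamily : Measure (ℤ → ℂ) := Measure.infinitePi fun _ : ℤ => complexGaussian

/-- The random Fourier series `∑ gₙ ⟨n⟩⁻¹ e^{inx}`; it converges in `L²(𝕋)` almost surely. -/
def randomSeries (g : ℤ → ℂ) : L2 := ∑' n : ℤ, (g n / (bracket n : ℂ)) • fourierLp 2 n

/-- The Gaussian measure `μ`, the law of the random Fourier series. -/
def gaussianMeasure : Measure L2 := gaussianFamily.map randomSeries

/-- The set of functions with mass in `(m - ε, m + ε)`. -/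
def massShell (m ε : ℝ) : Set L2 := {u | ‖u‖ ^ 2 ∈ Set.Ioo (m - ε) (m + ε)}

/-- `μ_m^ε`, the measure `μ` conditioned on the mass being in `(m - ε, m + ε)`. -/
def shellMeasure (m ε : ℝ) : Measure L2 := ProbabilityTheory.cond gaussianMeasure (massShell m ε)

/-- The set of those `u` whose Fourier coefficients `û(n)`, `|n| ≤ N`, form an element of `A`. -/
def cylinder (N : ℕ) (A : Set (Finset.Icc (-(N : ℤ)) N → ℂ)) : Set L2 :=
  {u | (fun n : Finset.Icc (-(N : ℤ)) N => coeffs u n) ∈ A}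

/-- `ν` is the limit of the `μ_m^ε` on all measurable sets that depend on finitely many
frequencies only. As these sets generate the Borel sets, there is at most one such `ν`. -/
def IsFixedMassLimit (m : ℝ) (ν : Measure L2) : Prop :=
  ∀ (N : ℕ) (A : Set (Finset.Icc (-(N : ℤ)) N → ℂ)), MeasurableSet A →
    Tendsto (fun ε : ℝ => shellMeasure m ε (cylinder N A)) (𝓝[>] 0) (𝓝 (ν (cylinder N A)))

open Classical in
/-- The fixed mass measure `μ_m`. -/
def fixedMassMeasure (m : ℝ) : Measure L2 :=
  if h : ∃ ν : Measure L2, IsFixedMassLimit m ν then h.choose else 0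

/-! ### The energy -/

/-- The truncation `P_{≤N} u = ∑_{|n| ≤ N} û(n) e^{inx}`, as a function of `x ∈ ℝ`. -/
def truncation (N : ℕ) (u : L2) (x : ℝ) : ℂ :=
  ∑ n ∈ Finset.Icc (-(N : ℤ)) N, coeffs u n * Complex.exp (Complex.I * n * x)

/-- `f_N(u) = -(3i/4) ∫ conj(P_{≤N} u)² ∂ₓ((P_{≤N} u)²) dx`, with respect to `dx / 2π`
(this number is real). -/
def energyTerm (N : ℕ) (u : L2) : ℝ :=
  (-(3 * Complex.I / 4) * ((2 * π : ℝ) : ℂ)⁻¹ * ∫ x in (0 : ℝ)..(2 * π),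
    conj (truncation N u x) ^ 2 * deriv (fun y : ℝ => truncation N u y ^ 2) x).re

/-- `f(u)`, the limit of the `f_N(u)`. To have one function for all the measures, it is taken as a
pointwise limit along the powers of two; `EnergyConverges` says that it is the limit in `L²` of the
whole sequence. -/
def energyLimit (u : L2) : ℝ := limUnder atTop fun j : ℕ => energyTerm (2 ^ j) u

/-- `f_N` converges to `f` in `L²(ν)`. -/
def EnergyConverges (ν : Measure L2) : Prop :=
  MemLp energyLimit 2 ν ∧
    Tendsto (fun N : ℕ => eLpNorm (fun u => energyTerm N u - energyLimit u) 2 ν) atTop (𝓝 0)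

/-- `∫ |u|⁶ dx`, possibly infinite, with respect to `dx / 2π`. -/
def sixthPower (u : L2) : ℝ≥0∞ := ∫⁻ x, ‖u x‖ₑ ^ 6 ∂(AddCircle.haarAddCircle : Measure Torus)

open Classical in
/-- The weight `exp (f(u) - ½ ∫ |u|⁶ dx)`; it is `0` where the integral is infinite. -/
def weight (u : L2) : ℝ≥0∞ :=
  if sixthPower u = ∞ then 0
  else ENNReal.ofReal (Real.exp (energyLimit u - (sixthPower u).toReal / 2))

/-- The measure with the density `β exp (f(u) - ½ ∫ |u|⁶ dx)` with respect to `ν`, where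
`β⁻¹ = ∫ exp (f(u) - ½ ∫ |u|⁶ dx) dν`. -/
def reweight (ν : Measure L2) : Measure L2 := (∫⁻ u, weight u ∂ν)⁻¹ • ν.withDensity weight

/-- `ρ_m^ε`. -/
def rhoShell (m ε : ℝ) : Measure L2 := reweight (shellMeasure m ε)

/-- `ρ_m`. -/
def rho (m : ℝ) : Measure L2 := reweight (fixedMassMeasure m)

end DNLS

end

/-! By Parseval, f_N = (3/4) ∑ k |b_k|², where b_k are the Fourier coefficients of (P_{≤N} u)².
Adding the pairs of frequencies ±(N+1) one after the other splits f_N (`quarticForm_eq`) into the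
resonant terms 3 · mass · momentum - (3/2) ∑ n |û(n)|⁴ and a non-resonant part. The increments of
the latter are real linear in the two new Gaussians, with coefficients cubic in the lower modes, so
it is a martingale. Its conditional variances, summed from N₀ on, are at most C (N₀+1)^{2-3r} ‖u‖⁶
in the norm of H^{r/2}, for 2/3 ≤ r < 1 (`sum_incrementSize_le`). With r = 5/6 this gives
convergence in L² with a rate. The quartic sum converges absolutely; the momentum converges because
the means of the terms n and -n cancel.

For the integrability of exp f one takes r = 2/3. The exponential martingale
(`lintegral_exp_nonResonant`) reduces the matter to exp(C ‖u‖⁶) with the H^{1/3} norm on small mass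
(`exists_lintegral_exp_lowSobolev_le`). If the squared norm is about 2m J^{2/3}, then the
frequencies up to J account for at most half of it, and the Gaussian cost of the rest is about
exp(-m J²/2), up to lower order. It beats the growth exp(8 C m³ J²) when m is small.

The sphere of mass m is a null set of μ, so almost sure statements about μ say nothing about μ_m.
The remedy is to single out one mode k. Given the other modes, the shell only restricts |g_k|²,
which is exponentially distributed, and a change of variables turns the shell integral divided by 2ε
into an integral over a fixed probability space (`lintegral_shell`). As ε → 0 it converges by
dominated convergence, provided that the integrand is continuous in the mode k and dominated
(`tendsto_lintegral_shell`). The limit, `sphereMeasure k m`, induces the same law on L² for every k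
(`map_randomSeries_sphereMeasure`).

For cylinder sets k is chosen outside the cylinder, which identifies μ_m. For the weight k = 0 is
chosen: f is a polynomial in the zero mode with five coefficients that depend on the other modes
only and converge off one null set, hence f converges for all values of the zero mode
simultaneously. The non-resonant part is real affine in the zero mode, so on a disc it is bounded by
its values at the four corners of a square. This gives the dominating function
(`exp_quarticForm_le_envelope`). The sextic term is continuous in the zero mode and has the
favourable sign. The same limit theorem, applied to the weight and to the weight times a test
function, gives the weak convergence (`tendsto_integral_onSobolev`). -/

noncomputable section

namespace DNLS

/-! ### Complex Gaussians -/

/-- The point with squared modulus `t` and argument `θ`. -/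
def polarPoint (t θ : ℝ) : ℂ := (√t : ℂ) * Complex.exp (θ * Complex.I)

theorem measurable_polarPoint : Measurable fun p : ℝ × ℝ => polarPoint p.1 p.2 := by
  unfold polarPoint
  fun_prop

theorem norm_polarPoint (t θ : ℝ) : ‖polarPoint t θ‖ = √t := by
  rw [polarPoint, norm_mul, Complex.norm_exp_ofReal_mul_I, mul_one, Complex.norm_real,
    Real.norm_of_nonneg (Real.sqrt_nonneg t)]

theorem lintegral_complexGaussian_eq_prod (F : ℂ → ℝ≥0∞) (hF : Measurable F) :
    ∫⁻ z, F z ∂complexGaussian =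
      ∫⁻ x, ∫⁻ y, F ((x : ℂ) + Complex.I * (y : ℂ)) ∂(gaussianReal 0 (1 / 2))
        ∂(gaussianReal 0 (1 / 2)) := by
  rw [complexGaussian, lintegral_map hF (by fun_prop), lintegral_prod _ (by fun_prop)]

theorem gaussianPDF_mul_gaussianPDF (x y : ℝ) :
    gaussianPDF 0 (1 / 2) x * gaussianPDF 0 (1 / 2) y =
      ENNReal.ofReal (π⁻¹ * Real.exp (-(x ^ 2 + y ^ 2))) := by
  rw [gaussianPDF, gaussianPDF, ← ENNReal.ofReal_mul (gaussianPDFReal_nonneg _ _ _)]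
  congr 1
  simp only [gaussianPDFReal]
  have h : (((1 / 2 : ℝ≥0) : ℝ≥0) : ℝ) = 1 / 2 := by simp
  rw [h]
  have h2 : (2 * π * (1 / 2) : ℝ) = π := by ring
  rw [h2]
  have h3 : (√π)⁻¹ * (√π)⁻¹ = π⁻¹ := by
    rw [← mul_inv, Real.mul_self_sqrt Real.pi_pos.le]
  calc _ = ((√π)⁻¹ * (√π)⁻¹) *
      (Real.exp (-(x - 0) ^ 2 / (2 * (1 / 2))) * Real.exp (-(y - 0) ^ 2 / (2 * (1 / 2)))) := by ring
    _ = _ := by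
      rw [h3, ← Real.exp_add]
      congr 2
      ring

theorem lintegral_complexGaussian_eq_volume (F : ℂ → ℝ≥0∞) (hF : Measurable F) :
    ∫⁻ z, F z ∂complexGaussian =
      ∫⁻ p : ℝ × ℝ, ENNReal.ofReal (π⁻¹ * Real.exp (-(p.1 ^ 2 + p.2 ^ 2))) *
        F ((p.1 : ℂ) + Complex.I * (p.2 : ℂ)) := by
  have hv : (1 / 2 : ℝ≥0) ≠ 0 := by norm_num
  rw [lintegral_complexGaussian_eq_prod F hF]
  simp_rw [gaussianReal_of_var_ne_zero 0 hv]
  rw [lintegral_withDensity_eq_lintegral_mul _ (measurable_gaussianPDF _ _)]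
  · rw [Measure.volume_eq_prod, lintegral_prod _ (by fun_prop)]
    refine lintegral_congr fun x => ?_
    rw [Pi.mul_apply, lintegral_withDensity_eq_lintegral_mul _ (measurable_gaussianPDF _ _)
      (by fun_prop), ← lintegral_const_mul _ (by fun_prop)]
    refine lintegral_congr fun y => ?_
    rw [Pi.mul_apply, ← mul_assoc, gaussianPDF_mul_gaussianPDF]
  · exact Measurable.lintegral_prod_right (by fun_prop)

/-- Integration against the complex Gaussian in the coordinates `t = |z|²`, `θ = arg z`. -/
theorem lintegral_complexGaussian_polar (F : ℂ → ℝ≥0∞) (hF : Measurable F) :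
    ∫⁻ z, F z ∂complexGaussian =
      ∫⁻ t in Set.Ioi (0 : ℝ), ENNReal.ofReal (Real.exp (-t)) *
        ∫⁻ θ in Set.Ioo (-π) π, ENNReal.ofReal (2 * π)⁻¹ * F (polarPoint t θ) := by
  have hpp := measurable_polarPoint
  have him : (fun r : ℝ => r ^ 2) '' Set.Ioi 0 = Set.Ioi 0 := by
    ext t
    constructor
    · rintro ⟨r, hr, rfl⟩
      exact pow_pos (show (0 : ℝ) < r from hr) 2
    · intro ht
      exact ⟨√t, Real.sqrt_pos.mpr ht, Real.sq_sqrt (le_of_lt ht)⟩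
  -- The substitution t = r² absorbs the Jacobian of polar coordinates: as 2r dr = dt, the density
  -- π⁻¹ e^{-r²} r dr dθ becomes (2π)⁻¹ e^{-t} dt dθ.
  have hsub := lintegral_image_eq_lintegral_abs_deriv_mul (f := fun r : ℝ => r ^ 2)
    (f' := fun r => 2 * r) (s := Set.Ioi (0 : ℝ)) measurableSet_Ioi
    (fun r _ => by simpa using (hasDerivAt_pow 2 r).hasDerivWithinAt)
    (fun a ha b hb hab => by
      simpa using (sq_eq_sq₀ (le_of_lt ha) (le_of_lt hb)).mp hab)
    (fun t => ENNReal.ofReal (Real.exp (-t)) *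
        ∫⁻ θ in Set.Ioo (-π) π, ENNReal.ofReal (2 * π)⁻¹ * F (polarPoint t θ))
  rw [him] at hsub
  rw [hsub, lintegral_complexGaussian_eq_volume F hF, ← lintegral_comp_polarCoord_symm]
  rw [polarCoord_target, Measure.volume_eq_prod, ← Measure.prod_restrict]
  rw [lintegral_prod _ (by
    simp only [polarCoord_symm_apply, smul_eq_mul]
    fun_prop)]
  refine setLIntegral_congr_fun measurableSet_Ioi fun r hr => ?_
  have hr' : (0 : ℝ) < r := hr
  have hm : Measurable fun θ : ℝ => ENNReal.ofReal (2 * π)⁻¹ * F (polarPoint (r ^ 2) θ) := by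
    have : Measurable fun θ : ℝ => polarPoint (r ^ 2) θ := by unfold polarPoint; fun_prop
    fun_prop
  simp only
  rw [← lintegral_const_mul _ hm, ← lintegral_const_mul _ (hm.const_mul _)]
  refine lintegral_congr fun θ => ?_
  have h1 : ((r * Real.cos θ : ℝ) : ℂ) + Complex.I * ((r * Real.sin θ : ℝ) : ℂ) =
      polarPoint (r ^ 2) θ := by
    rw [polarPoint, Real.sqrt_sq hr'.le, Complex.exp_mul_I]
    push_cast
    ring
  have h2 : (r * Real.cos θ) ^ 2 + (r * Real.sin θ) ^ 2 = r ^ 2 := by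
    have := Real.sin_sq_add_cos_sq θ
    linear_combination r ^ 2 * this
  simp only [polarCoord_symm_apply, smul_eq_mul, h1, h2]
  rw [← mul_assoc, ← mul_assoc, ← mul_assoc, ← ENNReal.ofReal_mul hr'.le,
    ← ENNReal.ofReal_mul (abs_nonneg _), ← ENNReal.ofReal_mul (by positivity)]
  congr 2
  rw [abs_of_pos (by positivity)]
  field_simp

/-- The squared modulus of a complex Gaussian is exponentially distributed. -/
theorem lintegral_complexGaussian_radial (h : ℝ → ℝ≥0∞) (hh : Measurable h) :
    ∫⁻ z, h (‖z‖ ^ 2) ∂complexGaussian =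
      ∫⁻ t in Set.Ioi (0 : ℝ), ENNReal.ofReal (Real.exp (-t)) * h t := by
  rw [lintegral_complexGaussian_polar (fun z => h (‖z‖ ^ 2)) (by fun_prop)]
  refine setLIntegral_congr_fun measurableSet_Ioi fun t ht => ?_
  simp only [norm_polarPoint, Real.sq_sqrt (le_of_lt ht), lintegral_const]
  congr 1
  rw [Measure.restrict_apply_univ, Real.volume_Ioo, mul_right_comm,
    ← ENNReal.ofReal_mul (by positivity)]
  have : (2 * π)⁻¹ * (π - -π) = 1 := by field_simp; ring
  rw [this, ENNReal.ofReal_one, one_mul]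

theorem lintegral_exp_neg_mul_Ioi {c : ℝ} (hc : 0 < c) :
    ∫⁻ t in Set.Ioi (0 : ℝ), ENNReal.ofReal (Real.exp (-c * t)) = ENNReal.ofReal c⁻¹ := by
  rw [← ofReal_integral_eq_lintegral_ofReal]
  · rw [integral_exp_mul_Ioi (by linarith) 0]
    congr 1
    simp
  · exact integrableOn_exp_mul_Ioi (by linarith) 0
  · exact ae_of_all _ fun t => (Real.exp_pos _).le

/-- The Laplace transform of `|z|²` for a complex Gaussian `z`. -/
theorem lintegral_exp_normSq {t : ℝ} (ht : t < 1) :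
    ∫⁻ z, ENNReal.ofReal (Real.exp (t * ‖z‖ ^ 2)) ∂complexGaussian = ENNReal.ofReal (1 - t)⁻¹ := by
  rw [lintegral_complexGaussian_radial (fun x => ENNReal.ofReal (Real.exp (t * x))) (by fun_prop),
    ← lintegral_exp_neg_mul_Ioi (by linarith : 0 < 1 - t)]
  refine lintegral_congr fun x => ?_
  rw [← ENNReal.ofReal_mul (Real.exp_pos _).le, ← Real.exp_add]
  congr 2
  ring

/-- From yᵏ/k! ≤ e^y at y = |z|²/2; the Laplace transform of |z|² at 1/2 equals 2. -/
theorem lintegral_norm_pow_le (k : ℕ) :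
    ∫⁻ z, ENNReal.ofReal (‖z‖ ^ (2 * k)) ∂complexGaussian ≤
      ENNReal.ofReal (k.factorial * 2 ^ (k + 1)) := by
  have h1 : ∀ z : ℂ, ENNReal.ofReal (‖z‖ ^ (2 * k)) ≤
      ENNReal.ofReal (k.factorial * 2 ^ k) * ENNReal.ofReal (Real.exp (1 / 2 * ‖z‖ ^ 2)) := by
    intro z
    rw [← ENNReal.ofReal_mul (by positivity)]
    apply ENNReal.ofReal_le_ofReal
    have := Real.pow_div_factorial_le_exp (1 / 2 * ‖z‖ ^ 2) (by positivity) k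
    rw [div_le_iff₀ (by positivity)] at this
    calc ‖z‖ ^ (2 * k) = 2 ^ k * (1 / 2 * ‖z‖ ^ 2) ^ k := by
          rw [← mul_pow, pow_mul]; congr 1; ring
      _ ≤ 2 ^ k * (Real.exp (1 / 2 * ‖z‖ ^ 2) * k.factorial) := by gcongr
      _ = _ := by ring
  calc _ ≤ ∫⁻ z, ENNReal.ofReal (k.factorial * 2 ^ k) *
        ENNReal.ofReal (Real.exp (1 / 2 * ‖z‖ ^ 2)) ∂complexGaussian := lintegral_mono h1
    _ = _ := by
      rw [lintegral_const_mul _ (by fun_prop), lintegral_exp_normSq (by norm_num),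
        ← ENNReal.ofReal_mul (by positivity)]
      congr 1
      norm_num
      ring

theorem lintegral_exp_mul_gaussianReal (t : ℝ) :
    ∫⁻ x, ENNReal.ofReal (Real.exp (t * x)) ∂(gaussianReal 0 (1 / 2)) =
      ENNReal.ofReal (Real.exp (t ^ 2 / 4)) := by
  rw [← ofReal_integral_eq_lintegral_ofReal]
  · have h := congrFun (mgf_id_gaussianReal (μ := 0) (v := 1 / 2)) t
    simp only [mgf, id] at h
    rw [h]
    congr 2
    simp
    ring
  · exact integrable_exp_mul_gaussianReal t
  · exact ae_of_all _ fun t => (Real.exp_pos _).le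

/-- The Laplace transform of a real linear functional of a complex Gaussian. -/
theorem lintegral_exp_re_mul (w : ℂ) :
    ∫⁻ z, ENNReal.ofReal (Real.exp ((z * w).re)) ∂complexGaussian =
      ENNReal.ofReal (Real.exp (‖w‖ ^ 2 / 4)) := by
  rw [lintegral_complexGaussian_eq_prod _ (by fun_prop)]
  have h : ∀ x y : ℝ, ENNReal.ofReal (Real.exp ((((x : ℂ) + Complex.I * (y : ℂ)) * w).re)) =
      ENNReal.ofReal (Real.exp (w.re * x)) * ENNReal.ofReal (Real.exp (-w.im * y)) := by
    intro x y
    rw [← ENNReal.ofReal_mul (Real.exp_pos _).le, ← Real.exp_add]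
    congr 2
    simp
    ring
  simp_rw [h]
  simp_rw [lintegral_const_mul _ (show Measurable fun y : ℝ =>
    ENNReal.ofReal (Real.exp (-w.im * y)) by fun_prop), lintegral_exp_mul_gaussianReal]
  rw [lintegral_mul_const _ (by fun_prop), lintegral_exp_mul_gaussianReal,
    ← ENNReal.ofReal_mul (Real.exp_pos _).le, ← Real.exp_add]
  congr 2
  rw [← Complex.normSq_eq_norm_sq, Complex.normSq_apply]
  ring

theorem integrable_id_gaussianReal : Integrable (fun x : ℝ => x) (gaussianReal 0 (1 / 2)) :=
  (memLp_id_gaussianReal 1).integrable le_rfl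

theorem integrable_sq_gaussianReal : Integrable (fun x : ℝ => x ^ 2) (gaussianReal 0 (1 / 2)) :=
  (memLp_id_gaussianReal 2).integrable_sq

theorem integral_sq_gaussianReal : ∫ x : ℝ, x ^ 2 ∂(gaussianReal 0 (1 / 2)) = 1 / 2 := by
  have h := variance_id_gaussianReal (μ := 0) (v := 1 / 2)
  rw [variance_eq_integral (by fun_prop)] at h
  simpa using h

theorem lintegral_sq_affine_gaussianReal (c t : ℝ) :
    ∫⁻ x, ENNReal.ofReal ((c + t * x) ^ 2) ∂(gaussianReal 0 (1 / 2)) =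
      ENNReal.ofReal (c ^ 2 + t ^ 2 / 2) := by
  have hi := integrable_id_gaussianReal
  have hi2 := integrable_sq_gaussianReal
  have he : (fun x : ℝ => (c + t * x) ^ 2) = fun x => c ^ 2 + (2 * c * t) * x + t ^ 2 * x ^ 2 := by
    ext x; ring
  have h1 : Integrable (fun x : ℝ => c ^ 2 + 2 * c * t * x) (gaussianReal 0 (1 / 2)) :=
    (integrable_const (μ := gaussianReal 0 (1 / 2)) (c ^ 2)).add (hi.const_mul (2 * c * t))
  have h2 := hi2.const_mul (t ^ 2)
  rw [← ofReal_integral_eq_lintegral_ofReal]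
  · rw [he, integral_add h1 h2, integral_add (integrable_const _) (hi.const_mul _),
      integral_const_mul, integral_const_mul, integral_sq_gaussianReal, integral_id_gaussianReal]
    congr 1
    simp
    ring
  · rw [he]
    exact h1.add h2
  · exact ae_of_all _ fun t => sq_nonneg _

theorem lintegral_sq_add_const_gaussianReal (d c t : ℝ) (hd : 0 ≤ d) :
    ∫⁻ x, ENNReal.ofReal ((c + t * x) ^ 2 + d) ∂(gaussianReal 0 (1 / 2)) =
      ENNReal.ofReal (c ^ 2 + t ^ 2 / 2 + d) := by
  simp_rw [ENNReal.ofReal_add (sq_nonneg _) hd]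
  rw [lintegral_add_right _ measurable_const, lintegral_sq_affine_gaussianReal, lintegral_const,
    measure_univ, mul_one, ENNReal.ofReal_add (by positivity) hd]

/-- The second moment of a real affine functional of a complex Gaussian. -/
theorem lintegral_sq_add_re_mul (c : ℝ) (w : ℂ) :
    ∫⁻ z, ENNReal.ofReal ((c + (z * w).re) ^ 2) ∂complexGaussian =
      ENNReal.ofReal (c ^ 2 + ‖w‖ ^ 2 / 2) := by
  rw [lintegral_complexGaussian_eq_prod _ (by fun_prop)]
  have h : ∀ x y : ℝ, (c + (((x : ℂ) + Complex.I * (y : ℂ)) * w).re) ^ 2 =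
      ((c + w.re * x) + (-w.im) * y) ^ 2 := by
    intro x y
    simp
    ring
  simp_rw [h, lintegral_sq_affine_gaussianReal]
  rw [lintegral_sq_add_const_gaussianReal _ _ _ (by positivity)]
  congr 1
  rw [← Complex.normSq_eq_norm_sq, Complex.normSq_apply]
  ring

/-! ### Resampling of coordinates -/

/-- Replacing the `n`-th coordinate by an independent complex Gaussian leaves `P` unchanged. -/
def Resamples (P : Measure (ℤ → ℂ)) (n : ℤ) : Prop :=
  ∀ F : (ℤ → ℂ) → ℝ≥0∞, Measurable F →
    ∫⁻ g, F g ∂P = ∫⁻ g, ∫⁻ z, F (Function.update g n z) ∂complexGaussian ∂P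

theorem measurable_update_pair (n : ℤ) :
    Measurable fun p : (ℤ → ℂ) × ℂ => Function.update p.1 n p.2 := by
  rw [measurable_pi_iff]
  intro i
  by_cases h : i = n
  · subst h
    simpa using measurable_snd
  · simp only [Function.update_of_ne h]
    exact (measurable_pi_apply i).comp measurable_fst

theorem measurable_update_const (n : ℤ) (z : ℂ) :
    Measurable fun g : ℤ → ℂ => Function.update g n z :=
  (measurable_update_pair n).comp (measurable_id.prodMk measurable_const)

instance isProbabilityMeasureGaussianFamily : IsProbabilityMeasure gaussianFamily := by
  unfold gaussianFamily
  infer_instance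

/-- A product measure is determined by its values on boxes, and the preimage of a box is a box
without the n-th side times a condition on the new coordinate. -/
theorem map_update_gaussianFamily (n : ℤ) :
    (gaussianFamily.prod complexGaussian).map
      (fun p : (ℤ → ℂ) × ℂ => Function.update p.1 n p.2) = gaussianFamily := by
  refine Measure.eq_infinitePi (μ := fun _ : ℤ => complexGaussian) fun s t ht => ?_
  rw [Measure.map_apply (measurable_update_pair n)
    (MeasurableSet.pi s.countable_toSet fun i _ => ht i)]
  have hset : (fun p : (ℤ → ℂ) × ℂ => Function.update p.1 n p.2) ⁻¹' (Set.pi (s : Set ℤ) t) =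
      (Set.pi ((s.erase n : Finset ℤ) : Set ℤ) t) ×ˢ (if n ∈ s then t n else Set.univ) := by
    ext ⟨g, z⟩
    simp only [Set.mem_preimage, Set.mem_pi, Finset.mem_coe, Set.mem_prod, Finset.mem_erase]
    constructor
    · intro h
      refine ⟨fun i hi => ?_, ?_⟩
      · simpa [Function.update_of_ne hi.1] using h i hi.2
      · split_ifs with hn
        · simpa using h n hn
        · trivial
    · rintro ⟨h1, h2⟩ i hi
      by_cases hin : i = n
      · subst hin
        rw [if_pos hi] at h2
        simpa using h2
      · simpa [Function.update_of_ne hin] using h1 i ⟨hin, hi⟩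
  rw [hset, Measure.prod_prod, gaussianFamily, Measure.infinitePi_pi _ (fun i _ => ht i)]
  split_ifs with hn
  · rw [mul_comm, Finset.mul_prod_erase s (fun i => complexGaussian (t i)) hn]
  · rw [Finset.erase_eq_of_notMem hn, measure_univ, mul_one]

theorem gaussianFamily_resamples (n : ℤ) : Resamples gaussianFamily n := by
  intro F hF
  conv_lhs => rw [← map_update_gaussianFamily n]
  rw [lintegral_map hF (measurable_update_pair n), lintegral_prod]
  exact (hF.comp (measurable_update_pair n)).aemeasurable

/-- The law of the Gaussian family with its zeroth member replaced by the constant `c`. -/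
def pinnedFamily (c : ℂ) : Measure (ℤ → ℂ) :=
  gaussianFamily.map fun g => Function.update g 0 c

instance isProbabilityMeasurePinnedFamily (c : ℂ) : IsProbabilityMeasure (pinnedFamily c) :=
  Measure.isProbabilityMeasure_map (measurable_update_const 0 c).aemeasurable

theorem lintegral_pinnedFamily (c : ℂ) {F : (ℤ → ℂ) → ℝ≥0∞} (hF : Measurable F) :
    ∫⁻ g, F g ∂(pinnedFamily c) = ∫⁻ g, F (Function.update g 0 c) ∂gaussianFamily :=
  lintegral_map hF (measurable_update_const 0 c)

theorem measurable_lintegral_update (n : ℤ) {F : (ℤ → ℂ) → ℝ≥0∞} (hF : Measurable F) :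
    Measurable fun g => ∫⁻ z, F (Function.update g n z) ∂complexGaussian :=
  (hF.comp (measurable_update_pair n)).lintegral_prod_right'

/-- Updates at different coordinates commute. Whatever only resamples nonzero modes, such as the
martingale estimates, therefore also holds with the zero mode frozen at a constant. -/
theorem pinnedFamily_resamples (c : ℂ) {n : ℤ} (hn : n ≠ 0) : Resamples (pinnedFamily c) n := by
  intro F hF
  rw [lintegral_pinnedFamily c hF, lintegral_pinnedFamily c (measurable_lintegral_update n hF),
    gaussianFamily_resamples n (fun g => F (Function.update g 0 c))
      (hF.comp (measurable_update_const 0 c))]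
  refine lintegral_congr fun g => lintegral_congr fun z => ?_
  rw [Function.update_comm hn]

/-- Functions of different coordinates are independent. -/
theorem lintegral_prod_coordinates {P : Measure (ℤ → ℂ)} [IsProbabilityMeasure P] (s : Finset ℤ)
    (hP : ∀ n ∈ s, Resamples P n) (φ : ℤ → ℂ → ℝ≥0∞) (hφ : ∀ n, Measurable (φ n)) :
    ∫⁻ g, ∏ n ∈ s, φ n (g n) ∂P = ∏ n ∈ s, ∫⁻ z, φ n z ∂complexGaussian := by
  induction s using Finset.induction_on with
  | empty => simp
  | insert n s hn ih =>
    simp only [Finset.prod_insert hn]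
    have hm : Measurable fun g : ℤ → ℂ => ∏ i ∈ s, φ i (g i) :=
      Finset.measurable_prod _ fun i _ => (hφ i).comp (measurable_pi_apply i)
    rw [hP n (by simp) (fun g => φ n (g n) * ∏ i ∈ s, φ i (g i))
      (((hφ n).comp (measurable_pi_apply n)).mul hm)]
    have h : ∀ (g : ℤ → ℂ) (z : ℂ),
        φ n (Function.update g n z n) * ∏ i ∈ s, φ i (Function.update g n z i) =
          φ n z * ∏ i ∈ s, φ i (g i) := by
      intro g z
      congr 1
      · simp
      · refine Finset.prod_congr rfl fun i hi => ?_
        rw [Function.update_of_ne (ne_of_mem_of_not_mem hi hn)]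
    simp_rw [h, lintegral_mul_const _ (hφ n)]
    rw [lintegral_const_mul _ hm, ih fun i hi => hP i (by simp [hi])]

theorem lintegral_coordinate {P : Measure (ℤ → ℂ)} [IsProbabilityMeasure P] {n : ℤ}
    (hP : Resamples P n) {φ : ℂ → ℝ≥0∞} (hφ : Measurable φ) :
    ∫⁻ g, φ (g n) ∂P = ∫⁻ z, φ z ∂complexGaussian := by
  simpa using lintegral_prod_coordinates (P := P) {n} (by simpa using hP) (fun _ => φ) fun _ => hφ

/-- Integrating out two coordinates of an exponential that is linear in them. -/
theorem lintegral_exp_add_re_mul {P : Measure (ℤ → ℂ)} {m n : ℤ} (hmn : m ≠ n)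
    (hm : Resamples P m) (hn : Resamples P n) {A : (ℤ → ℂ) → ℝ} {v w : (ℤ → ℂ) → ℂ}
    (hA : Measurable A) (hv : Measurable v) (hw : Measurable w)
    (hAm : ∀ g z, A (Function.update g m z) = A g) (hAn : ∀ g z, A (Function.update g n z) = A g)
    (hvm : ∀ g z, v (Function.update g m z) = v g) (hvn : ∀ g z, v (Function.update g n z) = v g)
    (hwm : ∀ g z, w (Function.update g m z) = w g)
    (hwn : ∀ g z, w (Function.update g n z) = w g) :
    ∫⁻ g, ENNReal.ofReal (Real.exp (A g + (g m * v g).re + (g n * w g).re)) ∂P =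
      ∫⁻ g, ENNReal.ofReal (Real.exp (A g + (‖v g‖ ^ 2 + ‖w g‖ ^ 2) / 4)) ∂P := by
  have h1 : ∀ (a : ℝ) (u : ℂ), ∫⁻ z, ENNReal.ofReal (Real.exp (a + (z * u).re)) ∂complexGaussian =
      ENNReal.ofReal (Real.exp (a + ‖u‖ ^ 2 / 4)) := by
    intro a u
    simp_rw [Real.exp_add, ENNReal.ofReal_mul (Real.exp_pos _).le]
    rw [lintegral_const_mul _ (by fun_prop), lintegral_exp_re_mul]
  rw [hn _ (by fun_prop)]
  simp only [hAn, hvn, hwn, Function.update_of_ne hmn, Function.update_self, h1]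
  have h2 : ∀ g : ℤ → ℂ, A g + (g m * v g).re + ‖w g‖ ^ 2 / 4 =
      (A g + ‖w g‖ ^ 2 / 4) + (g m * v g).re := fun g => by ring
  simp_rw [h2]
  rw [hm _ (by fun_prop)]
  simp only [hAm, hvm, hwm, Function.update_self, h1]
  refine lintegral_congr fun g => ?_
  congr 2
  ring

/-- Integrating out two coordinates of the square of a function that is affine in them. -/
theorem lintegral_sq_add_re_mul_add_re_mul {P : Measure (ℤ → ℂ)} {m n : ℤ} (hmn : m ≠ n)
    (hm : Resamples P m) (hn : Resamples P n) {A : (ℤ → ℂ) → ℝ} {v w : (ℤ → ℂ) → ℂ}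
    (hA : Measurable A) (hv : Measurable v) (hw : Measurable w)
    (hAm : ∀ g z, A (Function.update g m z) = A g) (hAn : ∀ g z, A (Function.update g n z) = A g)
    (hvm : ∀ g z, v (Function.update g m z) = v g) (hvn : ∀ g z, v (Function.update g n z) = v g)
    (hwn : ∀ g z, w (Function.update g n z) = w g) :
    ∫⁻ g, ENNReal.ofReal ((A g + (g m * v g).re + (g n * w g).re) ^ 2) ∂P =
      ∫⁻ g, ENNReal.ofReal (A g ^ 2) ∂P +
        ∫⁻ g, ENNReal.ofReal ((‖v g‖ ^ 2 + ‖w g‖ ^ 2) / 2) ∂P := by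
  have hsplit : ∀ (a : ℝ) (u : ℂ), ENNReal.ofReal (a ^ 2 + ‖u‖ ^ 2 / 2) =
      ENNReal.ofReal (a ^ 2) + ENNReal.ofReal (‖u‖ ^ 2 / 2) := fun a u =>
    ENNReal.ofReal_add (sq_nonneg _) (by positivity)
  rw [hn _ (by fun_prop)]
  simp only [hAn, hvn, hwn, Function.update_of_ne hmn, Function.update_self,
    lintegral_sq_add_re_mul]
  simp_rw [hsplit]
  rw [lintegral_add_left (by fun_prop), hm _ (by fun_prop)]
  simp only [hAm, hvm, Function.update_self, lintegral_sq_add_re_mul]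
  simp_rw [hsplit]
  rw [lintegral_add_left (by fun_prop), add_assoc, ← lintegral_add_left (by fun_prop)]
  congr 1
  refine lintegral_congr fun g => ?_
  rw [← ENNReal.ofReal_add (by positivity) (by positivity)]
  congr 1
  ring

/-! ### The quartic form on sequences of Fourier coefficients -/

/-- The frequencies `|n| ≤ N`. -/
def modes (N : ℕ) : Finset ℤ := Finset.Icc (-(N : ℤ)) N

theorem mem_modes {N : ℕ} {n : ℤ} : n ∈ modes N ↔ -(N : ℤ) ≤ n ∧ n ≤ N := Finset.mem_Icc

theorem modes_succ (N : ℕ) :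
    modes (N + 1) = insert ((N : ℤ) + 1) (insert (-((N : ℤ) + 1)) (modes N)) := by
  ext n
  simp only [mem_modes, Finset.mem_insert]
  push_cast
  omega

theorem sum_modes_succ {R : Type*} [AddCommMonoid R] (N : ℕ) (φ : ℤ → R) :
    ∑ n ∈ modes (N + 1), φ n = φ (N + 1) + (φ (-(N + 1)) + ∑ n ∈ modes N, φ n) := by
  rw [modes_succ, Finset.sum_insert, Finset.sum_insert]
  · simp only [mem_modes]
    omega
  · simp only [Finset.mem_insert, mem_modes]
    omega

theorem modes_mono {M N : ℕ} (h : M ≤ N) : modes M ⊆ modes N := by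
  intro n
  simp only [mem_modes]
  omega

theorem sum_modes_eq_sum_range {R : Type*} [AddCommMonoid R] (N : ℕ) (φ : ℤ → R) :
    ∑ n ∈ modes N, φ n = ∑ i ∈ Finset.range (2 * N + 1), φ (i - N) := by
  symm
  refine Finset.sum_nbij (fun i => (i : ℤ) - N) ?_ ?_ ?_ fun _ _ => rfl
  · intro i hi
    rw [Finset.mem_range] at hi
    simp only [mem_modes]
    omega
  · intro i _ j _ h
    simpa using h
  · intro n hn
    have hn' := mem_modes.mp (Finset.mem_coe.mp hn)
    refine ⟨(n + N).toNat, ?_, ?_⟩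
    · simp only [Finset.coe_range, Set.mem_Iio]
      omega
    · simp only
      omega

theorem sum_modes_neg {R : Type*} [AddCommMonoid R] (N : ℕ) (φ : ℤ → R) :
    ∑ n ∈ modes N, φ (-n) = ∑ n ∈ modes N, φ n := by
  refine Finset.sum_nbij (fun n => -n) ?_ ?_ ?_ fun _ _ => rfl
  · intro n
    simp only [mem_modes]
    omega
  · intro i _ j _ h
    simpa using h
  · intro n hn
    have hn' := mem_modes.mp (Finset.mem_coe.mp hn)
    exact ⟨-n, by simp only [Finset.mem_coe, mem_modes]; omega, by simp⟩

theorem sum_modes_mul_self (L : ℕ) (φ : ℤ → ℝ) :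
    ∑ k ∈ modes L, (k : ℝ) * φ k =
      ∑ i ∈ Finset.range L, ((i : ℝ) + 1) * (φ (i + 1) - φ (-(i + 1))) := by
  induction L with
  | zero => simp [modes]
  | succ L ih =>
    rw [sum_modes_succ, ih, Finset.sum_range_succ]
    push_cast
    ring

/-- The sequence `a` with the frequencies `|n| > N` removed. -/
def cutoff (N : ℕ) (a : ℤ → ℂ) (n : ℤ) : ℂ := if n ∈ modes N then a n else 0

theorem cutoff_of_mem {N : ℕ} {a : ℤ → ℂ} {n : ℤ} (h : n ∈ modes N) : cutoff N a n = a n :=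
  if_pos h

theorem cutoff_of_notMem {N : ℕ} {a : ℤ → ℂ} {n : ℤ} (h : n ∉ modes N) : cutoff N a n = 0 :=
  if_neg h

theorem cutoff_congr {N : ℕ} {a a' : ℤ → ℂ} (h : ∀ n ∈ modes N, a n = a' n) :
    cutoff N a = cutoff N a' := by
  ext n
  by_cases hn : n ∈ modes N
  · rw [cutoff_of_mem hn, cutoff_of_mem hn, h n hn]
  · rw [cutoff_of_notMem hn, cutoff_of_notMem hn]

/-- The Fourier coefficients of the square of the truncated function. -/
def selfConv (N : ℕ) (a : ℤ → ℂ) (k : ℤ) : ℂ :=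
  ∑ j ∈ modes N, cutoff N a j * cutoff N a (k - j)

/-- The functional `f_N` in terms of Fourier coefficients. -/
def quarticForm (N : ℕ) (a : ℤ → ℂ) : ℝ :=
  3 / 4 * ∑ k ∈ modes (2 * N), (k : ℝ) * ‖selfConv N a k‖ ^ 2

/-- The mass of the truncated function. -/
def massSum (N : ℕ) (a : ℤ → ℂ) : ℝ := ∑ n ∈ modes N, ‖a n‖ ^ 2

/-- The momentum of the truncated function. -/
def momentumSum (N : ℕ) (a : ℤ → ℂ) : ℝ := ∑ n ∈ modes N, (n : ℝ) * ‖a n‖ ^ 2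

/-- The diagonal quartic sum. -/
def diagonalSum (N : ℕ) (a : ℤ → ℂ) : ℝ := ∑ n ∈ modes N, (n : ℝ) * ‖a n‖ ^ 4

/-- The coefficient of the new frequency `N + 1` in the increment of the non-resonant part. -/
def posCoeff (N : ℕ) (a : ℤ → ℂ) : ℂ :=
  ∑ i ∈ Finset.range (2 * N + 1), ((i : ℂ) + 1) * (conj (selfConv N a (i + 1)) * cutoff N a (i - N))

/-- The coefficient of the new frequency `-(N + 1)` in the increment of the non-resonant part, up
to the sign. -/
def negCoeff (N : ℕ) (a : ℤ → ℂ) : ℂ :=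
  ∑ i ∈ Finset.range (2 * N + 1),
    ((i : ℂ) + 1) * (conj (selfConv N a (-(i + 1))) * cutoff N a (N - i))

/-- The non-resonant part of the quartic form. -/
def nonResonant (N : ℕ) (a : ℤ → ℂ) : ℝ :=
  ∑ K ∈ Finset.range N,
    (4 * (a (K + 1) * posCoeff K a).re - 4 * (a (-(K + 1)) * negCoeff K a).re)

theorem selfConv_eq_zero {N : ℕ} (a : ℤ → ℂ) {k : ℤ} (hk : k ∉ modes (2 * N)) :
    selfConv N a k = 0 := by
  refine Finset.sum_eq_zero fun j hj => ?_
  rw [cutoff_of_notMem (n := k - j), mul_zero]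
  simp only [mem_modes] at hk hj ⊢
  push_cast at hk
  omega

theorem cutoff_succ (N : ℕ) (a : ℤ → ℂ) (n : ℤ) :
    cutoff (N + 1) a n = cutoff N a n + ((if n = N + 1 then a (N + 1) else 0) +
      (if n = -(N + 1) then a (-(N + 1)) else 0)) := by
  by_cases h1 : n = N + 1
  · subst h1
    rw [cutoff_of_mem (by simp only [mem_modes]; omega),
      cutoff_of_notMem (by simp only [mem_modes]; omega), if_pos rfl, if_neg (by omega)]
    simp
  by_cases h2 : n = -(N + 1)
  · subst h2
    rw [cutoff_of_mem (by simp only [mem_modes]; omega),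
      cutoff_of_notMem (by simp only [mem_modes]; omega), if_pos rfl, if_neg (by omega)]
    simp
  · rw [if_neg h1, if_neg h2, add_zero, add_zero]
    by_cases h3 : n ∈ modes N
    · rw [cutoff_of_mem h3, cutoff_of_mem (modes_mono (Nat.le_succ N) h3)]
    · rw [cutoff_of_notMem h3, cutoff_of_notMem]
      simp only [mem_modes] at h3 ⊢
      omega

theorem sum_cutoff_mul_ite (N : ℕ) (a : ℤ → ℂ) (k c : ℤ) (x : ℂ) :
    ∑ j ∈ modes N, cutoff N a j * (if k - j = c then x else 0) = x * cutoff N a (k - c) := by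
  have h : ∀ j, (if k - j = c then x else 0) = if j = k - c then x else 0 := by
    intro j
    congr 1
    apply propext
    omega
  simp_rw [h, mul_ite, mul_zero, Finset.sum_ite_eq']
  split_ifs with hm
  · ring
  · rw [cutoff_of_notMem hm, mul_zero]

/-- In each bracket the larger cutoff collects the ordered pairs whose first frequency is new, the
smaller one those whose first frequency is old and second one new. Pairs of two new frequencies are
thus counted once. -/
theorem selfConv_succ (N : ℕ) (a : ℤ → ℂ) (k : ℤ) :
    selfConv (N + 1) a k = selfConv N a k +
      a (N + 1) * (cutoff (N + 1) a (k - (N + 1)) + cutoff N a (k - (N + 1))) +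
      a (-(N + 1)) * (cutoff (N + 1) a (k + (N + 1)) + cutoff N a (k + (N + 1))) := by
  have h1 : ∑ j ∈ modes N, cutoff (N + 1) a j * cutoff (N + 1) a (k - j) =
      selfConv N a k + a (N + 1) * cutoff N a (k - (N + 1)) +
        a (-(N + 1)) * cutoff N a (k + (N + 1)) := by
    have h2 : ∀ j ∈ modes N, cutoff (N + 1) a j * cutoff (N + 1) a (k - j) =
        cutoff N a j * cutoff N a (k - j) +
          (cutoff N a j * (if k - j = N + 1 then a (N + 1) else 0) +
            cutoff N a j * (if k - j = -(N + 1) then a (-(N + 1)) else 0)) := by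
      intro j hj
      rw [cutoff_of_mem (modes_mono (Nat.le_succ N) hj), cutoff_of_mem hj, cutoff_succ N a (k - j)]
      ring
    rw [Finset.sum_congr rfl h2, Finset.sum_add_distrib, Finset.sum_add_distrib,
      sum_cutoff_mul_ite, sum_cutoff_mul_ite, sub_neg_eq_add, selfConv, add_assoc]
  rw [selfConv, sum_modes_succ, h1,
    cutoff_of_mem (a := a) (N := N + 1) (n := N + 1) (by simp only [mem_modes]; omega),
    cutoff_of_mem (a := a) (N := N + 1) (n := -(N + 1)) (by simp only [mem_modes]; omega),
    sub_neg_eq_add]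
  ring

/-- A product at a positive frequency cannot use the mode -(N+1), since its partner would lie beyond
N+1. So positive frequencies only see the mode N+1 and negative ones only -(N+1). -/
theorem selfConv_succ_pos (N : ℕ) (a : ℤ → ℂ) {i : ℕ} (hi : i < 2 * N + 1) :
    selfConv (N + 1) a (i + 1) = selfConv N a (i + 1) + 2 * (a (N + 1) * cutoff N a (i - N)) := by
  rw [selfConv_succ, show (i : ℤ) + 1 - (N + 1) = i - N by ring,
    cutoff_of_notMem (N := N + 1) (n := (i : ℤ) + 1 + (N + 1)) (by simp only [mem_modes]; omega),
    cutoff_of_notMem (N := N) (n := (i : ℤ) + 1 + (N + 1)) (by simp only [mem_modes]; omega),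
    cutoff_of_mem (N := N + 1) (n := (i : ℤ) - N) (by simp only [mem_modes]; omega),
    cutoff_of_mem (N := N) (n := (i : ℤ) - N) (by simp only [mem_modes]; omega)]
  ring

theorem selfConv_succ_neg (N : ℕ) (a : ℤ → ℂ) {i : ℕ} (hi : i < 2 * N + 1) :
    selfConv (N + 1) a (-(i + 1)) =
      selfConv N a (-(i + 1)) + 2 * (a (-(N + 1)) * cutoff N a (N - i)) := by
  rw [selfConv_succ, show -((i : ℤ) + 1) + (N + 1) = N - i by ring,
    cutoff_of_notMem (N := N + 1) (n := -((i : ℤ) + 1) - (N + 1)) (by simp only [mem_modes]; omega),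
    cutoff_of_notMem (N := N) (n := -((i : ℤ) + 1) - (N + 1)) (by simp only [mem_modes]; omega),
    cutoff_of_mem (N := N + 1) (n := (N : ℤ) - i) (by simp only [mem_modes]; omega),
    cutoff_of_mem (N := N) (n := (N : ℤ) - i) (by simp only [mem_modes]; omega)]
  ring

theorem selfConv_succ_top (N : ℕ) (a : ℤ → ℂ) :
    selfConv (N + 1) a ((2 * N + 1 : ℕ) + 1) = a (N + 1) ^ 2 := by
  rw [selfConv_succ, selfConv_eq_zero a (by simp only [mem_modes]; omega),
    show ((2 * N + 1 : ℕ) : ℤ) + 1 - (N + 1) = N + 1 by push_cast; ring,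
    cutoff_of_mem (N := N + 1) (n := (N : ℤ) + 1) (by simp only [mem_modes]; omega),
    cutoff_of_notMem (N := N) (n := (N : ℤ) + 1) (by simp only [mem_modes]; omega),
    cutoff_of_notMem (N := N + 1) (by simp only [mem_modes]; omega),
    cutoff_of_notMem (N := N) (by simp only [mem_modes]; omega)]
  ring

theorem selfConv_succ_bot (N : ℕ) (a : ℤ → ℂ) :
    selfConv (N + 1) a (-((2 * N + 1 : ℕ) + 1)) = a (-(N + 1)) ^ 2 := by
  rw [selfConv_succ, selfConv_eq_zero a (by simp only [mem_modes]; omega),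
    show -(((2 * N + 1 : ℕ) : ℤ) + 1) + (N + 1) = -(N + 1) by push_cast; ring,
    cutoff_of_mem (N := N + 1) (n := -((N : ℤ) + 1)) (by simp only [mem_modes]; omega),
    cutoff_of_notMem (N := N) (n := -((N : ℤ) + 1)) (by simp only [mem_modes]; omega),
    cutoff_of_notMem (N := N + 1) (by simp only [mem_modes]; omega),
    cutoff_of_notMem (N := N) (by simp only [mem_modes]; omega)]
  ring

theorem norm_add_two_mul_sq (b x v : ℂ) :
    ‖b + 2 * (x * v)‖ ^ 2 = ‖b‖ ^ 2 + 4 * (x * (conj b * v)).re + 4 * (‖x‖ ^ 2 * ‖v‖ ^ 2) := by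
  simp only [← Complex.normSq_eq_norm_sq, Complex.normSq_apply, Complex.add_re, Complex.add_im,
    Complex.mul_re, Complex.mul_im, Complex.conj_re, Complex.conj_im, Complex.re_ofNat,
    Complex.im_ofNat]
  ring

theorem re_mul_posCoeff (N : ℕ) (a : ℤ → ℂ) (x : ℂ) :
    (x * posCoeff N a).re = ∑ i ∈ Finset.range (2 * N + 1),
      ((i : ℝ) + 1) * (x * (conj (selfConv N a (i + 1)) * cutoff N a (i - N))).re := by
  rw [posCoeff, Finset.mul_sum, Complex.re_sum]
  refine Finset.sum_congr rfl fun i _ => ?_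
  rw [mul_left_comm, ← Complex.re_ofReal_mul]
  push_cast
  rfl

theorem re_mul_negCoeff (N : ℕ) (a : ℤ → ℂ) (x : ℂ) :
    (x * negCoeff N a).re = ∑ i ∈ Finset.range (2 * N + 1),
      ((i : ℝ) + 1) * (x * (conj (selfConv N a (-(i + 1))) * cutoff N a (N - i))).re := by
  rw [negCoeff, Finset.mul_sum, Complex.re_sum]
  refine Finset.sum_congr rfl fun i _ => ?_
  rw [mul_left_comm, ← Complex.re_ofReal_mul]
  push_cast
  rfl

/-- The origin of the resonant terms: a product of the new mode N+1 with an old mode n sits at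
frequency n+N+1, and this weight splits into a mass and a momentum contribution. -/
theorem sum_range_mul_cutoff_pos (N : ℕ) (a : ℤ → ℂ) :
    ∑ i ∈ Finset.range (2 * N + 1), ((i : ℝ) + 1) * ‖cutoff N a (i - N)‖ ^ 2 =
      (N + 1) * massSum N a + momentumSum N a := by
  have h := sum_modes_eq_sum_range N fun n => ((n : ℝ) + N + 1) * ‖cutoff N a n‖ ^ 2
  have h' : ∑ i ∈ Finset.range (2 * N + 1), ((i : ℝ) + 1) * ‖cutoff N a (i - N)‖ ^ 2 =
      ∑ n ∈ modes N, ((n : ℝ) + N + 1) * ‖cutoff N a n‖ ^ 2 := by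
    rw [h]
    refine Finset.sum_congr rfl fun i _ => ?_
    push_cast
    ring
  rw [h', massSum, momentumSum, Finset.mul_sum, ← Finset.sum_add_distrib]
  refine Finset.sum_congr rfl fun n hn => ?_
  rw [cutoff_of_mem hn]
  ring

theorem sum_range_mul_cutoff_neg (N : ℕ) (a : ℤ → ℂ) :
    ∑ i ∈ Finset.range (2 * N + 1), ((i : ℝ) + 1) * ‖cutoff N a (N - i)‖ ^ 2 =
      (N + 1) * massSum N a - momentumSum N a := by
  have h := sum_modes_eq_sum_range N fun n => ((n : ℝ) + N + 1) * ‖cutoff N a (-n)‖ ^ 2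
  have h2 := sum_modes_neg N fun n => (-(n : ℝ) + N + 1) * ‖cutoff N a n‖ ^ 2
  have h' : ∑ i ∈ Finset.range (2 * N + 1), ((i : ℝ) + 1) * ‖cutoff N a (N - i)‖ ^ 2 =
      ∑ n ∈ modes N, (-(n : ℝ) + N + 1) * ‖cutoff N a n‖ ^ 2 := by
    rw [← h2]
    push_cast
    simp only [neg_neg]
    rw [h]
    refine Finset.sum_congr rfl fun i _ => ?_
    rw [neg_sub]
    push_cast
    ring
  rw [h', massSum, momentumSum, Finset.mul_sum, ← Finset.sum_sub_distrib]
  refine Finset.sum_congr rfl fun n hn => ?_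
  rw [cutoff_of_mem hn]
  ring

/-- The added term at ±(2N+1) vanishes. It makes the range of summation that of the next step of the
induction. -/
theorem sum_selfConv_extend (N : ℕ) (a : ℤ → ℂ) :
    ∑ k ∈ modes (2 * N), (k : ℝ) * ‖selfConv N a k‖ ^ 2 =
      ∑ i ∈ Finset.range (2 * N + 1),
        ((i : ℝ) + 1) * (‖selfConv N a (i + 1)‖ ^ 2 - ‖selfConv N a (-(i + 1))‖ ^ 2) := by
  rw [sum_modes_mul_self, Finset.sum_range_succ,
    selfConv_eq_zero a (k := ((2 * N : ℕ) : ℤ) + 1) (by simp only [mem_modes]; omega),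
    selfConv_eq_zero a (k := -(((2 * N : ℕ) : ℤ) + 1)) (by simp only [mem_modes]; omega)]
  simp

theorem nonResonant_succ (N : ℕ) (a : ℤ → ℂ) :
    nonResonant (N + 1) a = nonResonant N a +
      (4 * (a (N + 1) * posCoeff N a).re - 4 * (a (-(N + 1)) * negCoeff N a).re) :=
  Finset.sum_range_succ _ _

theorem massSum_succ (N : ℕ) (a : ℤ → ℂ) :
    massSum (N + 1) a = massSum N a + (‖a (N + 1)‖ ^ 2 + ‖a (-(N + 1))‖ ^ 2) := by
  rw [massSum, sum_modes_succ, massSum]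
  ring

theorem momentumSum_succ (N : ℕ) (a : ℤ → ℂ) :
    momentumSum (N + 1) a =
      momentumSum N a + ((N : ℝ) + 1) * (‖a (N + 1)‖ ^ 2 - ‖a (-(N + 1))‖ ^ 2) := by
  rw [momentumSum, sum_modes_succ, momentumSum]
  push_cast
  ring

theorem diagonalSum_succ (N : ℕ) (a : ℤ → ℂ) :
    diagonalSum (N + 1) a =
      diagonalSum N a + ((N : ℝ) + 1) * (‖a (N + 1)‖ ^ 4 - ‖a (-(N + 1))‖ ^ 4) := by
  rw [diagonalSum, sum_modes_succ, diagonalSum]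
  push_cast
  ring

/-- The decomposition of the quartic form into non-resonant and resonant parts. -/
theorem quarticForm_eq (N : ℕ) (a : ℤ → ℂ) :
    quarticForm N a = 3 / 4 * (nonResonant N a + 4 * massSum N a * momentumSum N a -
      2 * diagonalSum N a) := by
  rw [quarticForm]
  congr 1
  induction N with
  | zero => simp [modes, nonResonant, momentumSum, diagonalSum]
  | succ N ih =>
    rw [show 2 * (N + 1) = (2 * N + 1) + 1 by ring, sum_modes_mul_self, Finset.sum_range_succ,
      selfConv_succ_top, selfConv_succ_bot]
    have hstep : ∑ i ∈ Finset.range (2 * N + 1), ((i : ℝ) + 1) *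
        (‖selfConv (N + 1) a (i + 1)‖ ^ 2 - ‖selfConv (N + 1) a (-(i + 1))‖ ^ 2) =
        ∑ i ∈ Finset.range (2 * N + 1),
          ((i : ℝ) + 1) * (‖selfConv N a (i + 1)‖ ^ 2 - ‖selfConv N a (-(i + 1))‖ ^ 2) +
        4 * (a (N + 1) * posCoeff N a).re - 4 * (a (-(N + 1)) * negCoeff N a).re +
        4 * ‖a (N + 1)‖ ^ 2 * ∑ i ∈ Finset.range (2 * N + 1),
          ((i : ℝ) + 1) * ‖cutoff N a (i - N)‖ ^ 2 -
        4 * ‖a (-(N + 1))‖ ^ 2 * ∑ i ∈ Finset.range (2 * N + 1),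
          ((i : ℝ) + 1) * ‖cutoff N a (N - i)‖ ^ 2 := by
      rw [re_mul_posCoeff, re_mul_negCoeff, Finset.mul_sum, Finset.mul_sum, Finset.mul_sum,
        Finset.mul_sum, ← Finset.sum_add_distrib, ← Finset.sum_sub_distrib,
        ← Finset.sum_add_distrib, ← Finset.sum_sub_distrib]
      refine Finset.sum_congr rfl fun i hi => ?_
      rw [selfConv_succ_pos N a (Finset.mem_range.mp hi),
        selfConv_succ_neg N a (Finset.mem_range.mp hi), norm_add_two_mul_sq, norm_add_two_mul_sq]
      ring
    -- With x, y the new modes, 4 · mass · momentum grows by 4(N+1)(|x|⁴ - |y|⁴) in addition to its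
    -- mixed terms, whereas the frequencies ±(2N+2) contribute only half of that; the term -2 ·
    -- `diagonalSum` corrects this.
    rw [hstep, ← sum_selfConv_extend, ih, sum_range_mul_cutoff_pos, sum_range_mul_cutoff_neg,
      nonResonant_succ, massSum_succ, momentumSum_succ, diagonalSum_succ, norm_pow, norm_pow]
    push_cast
    ring

/-! ### Dependence on the zero mode -/

theorem zero_mem_modes (N : ℕ) : (0 : ℤ) ∈ modes N := by
  simp only [mem_modes]
  omega

theorem cutoff_update_zero (N : ℕ) (a : ℤ → ℂ) (z : ℂ) (n : ℤ) :
    cutoff N (Function.update a 0 z) n =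
      cutoff N (Function.update a 0 0) n + if n = 0 then z else 0 := by
  by_cases hn : n ∈ modes N
  · rw [cutoff_of_mem hn, cutoff_of_mem hn]
    by_cases h0 : n = 0
    · subst h0
      simp
    · simp [h0]
  · rw [cutoff_of_notMem hn, cutoff_of_notMem hn,
      if_neg (by rintro rfl; exact hn (zero_mem_modes N)), add_zero]

/-- The term z² would sit at frequency 0, which has weight zero in the quartic form. -/
theorem selfConv_update_zero (N : ℕ) (a : ℤ → ℂ) (z : ℂ) {k : ℤ} (hk : k ≠ 0) :
    selfConv N (Function.update a 0 z) k =
      selfConv N (Function.update a 0 0) k +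
        2 * (z * cutoff N (Function.update a 0 0) k) := by
  have h : ∀ j ∈ modes N, cutoff N (Function.update a 0 z) j *
      cutoff N (Function.update a 0 z) (k - j) =
      cutoff N (Function.update a 0 0) j * cutoff N (Function.update a 0 0) (k - j) +
      cutoff N (Function.update a 0 0) j * (if k - j = 0 then z else 0) +
      (if j = 0 then z * cutoff N (Function.update a 0 0) k else 0) := by
    intro j _
    rw [cutoff_update_zero N a z j, cutoff_update_zero N a z (k - j)]
    by_cases hj : j = 0
    · subst hj
      simp only [sub_zero, if_neg hk, if_true]
      ring
    · simp only [if_neg hj]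
      ring
  rw [selfConv, Finset.sum_congr rfl h, Finset.sum_add_distrib, Finset.sum_add_distrib,
    sum_cutoff_mul_ite, Finset.sum_ite_eq', if_pos (zero_mem_modes N), sub_zero, selfConv]
  ring

theorem massSum_update_zero (N : ℕ) (a : ℤ → ℂ) (z : ℂ) :
    massSum N (Function.update a 0 z) = massSum N (Function.update a 0 0) + ‖z‖ ^ 2 := by
  rw [massSum, massSum, ← Finset.add_sum_erase _ _ (zero_mem_modes N),
    ← Finset.add_sum_erase (modes N) (fun n => ‖Function.update a 0 0 n‖ ^ 2) (zero_mem_modes N)]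
  have : ∑ n ∈ (modes N).erase 0, ‖Function.update a 0 z n‖ ^ 2 =
      ∑ n ∈ (modes N).erase 0, ‖Function.update a 0 0 n‖ ^ 2 := by
    refine Finset.sum_congr rfl fun n hn => ?_
    rw [Function.update_of_ne (Finset.ne_of_mem_erase hn),
      Function.update_of_ne (Finset.ne_of_mem_erase hn)]
  rw [this]
  simp
  ring

theorem momentumSum_update_zero (N : ℕ) (a : ℤ → ℂ) (z : ℂ) :
    momentumSum N (Function.update a 0 z) = momentumSum N a := by
  refine Finset.sum_congr rfl fun n _ => ?_
  by_cases h : n = 0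
  · simp [h]
  · rw [Function.update_of_ne h]

theorem diagonalSum_update_zero (N : ℕ) (a : ℤ → ℂ) (z : ℂ) :
    diagonalSum N (Function.update a 0 z) = diagonalSum N a := by
  refine Finset.sum_congr rfl fun n _ => ?_
  by_cases h : n = 0
  · simp [h]
  · rw [Function.update_of_ne h]

/-- The coefficient of the zero mode in the non-resonant part. -/
def zeroCoeff (N : ℕ) (a : ℤ → ℂ) : ℂ :=
  ∑ k ∈ modes (2 * N), (k : ℂ) * (conj (selfConv N (Function.update a 0 0) k) *
    cutoff N (Function.update a 0 0) k)

theorem sum_modes_two_mul_cutoff (N : ℕ) (a : ℤ → ℂ) :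
    ∑ k ∈ modes (2 * N), (k : ℝ) * ‖cutoff N a k‖ ^ 2 = momentumSum N a := by
  rw [momentumSum]
  symm
  rw [← Finset.sum_subset (modes_mono (show N ≤ 2 * N by omega))]
  · refine Finset.sum_congr rfl fun k hk => ?_
    rw [cutoff_of_mem hk]
  · intro k _ hk
    rw [cutoff_of_notMem hk]
    simp

/-- The non-resonant part is real affine in the zero mode. -/
theorem nonResonant_update_zero (N : ℕ) (a : ℤ → ℂ) (z : ℂ) :
    nonResonant N (Function.update a 0 z) =
      nonResonant N (Function.update a 0 0) + 4 * (z * zeroCoeff N a).re := by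
  -- Instead of expanding the cubic coefficients, the decomposition is solved for the non-resonant
  -- part. The terms quadratic in z, namely 4|z|² times the momentum, appear both in the quartic
  -- form and in mass times momentum, and cancel.
  have h1 := quarticForm_eq N (Function.update a 0 z)
  have h2 := quarticForm_eq N (Function.update a 0 0)
  rw [massSum_update_zero, momentumSum_update_zero, diagonalSum_update_zero] at h1
  rw [momentumSum_update_zero, diagonalSum_update_zero] at h2
  have h3 : quarticForm N (Function.update a 0 z) = quarticForm N (Function.update a 0 0) +
      3 / 4 * (4 * (z * zeroCoeff N a).re + 4 * ‖z‖ ^ 2 * momentumSum N a) := by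
    rw [quarticForm, quarticForm, ← mul_add]
    congr 1
    rw [zeroCoeff, Finset.mul_sum, Complex.re_sum, Finset.mul_sum,
      ← momentumSum_update_zero N a 0, ← sum_modes_two_mul_cutoff N (Function.update a 0 0),
      Finset.mul_sum, ← Finset.sum_add_distrib, ← Finset.sum_add_distrib]
    refine Finset.sum_congr rfl fun k _ => ?_
    by_cases hk : k = 0
    · simp [hk]
    · rw [selfConv_update_zero N a z hk, norm_add_two_mul_sq,
        mul_left_comm z (k : ℂ), ← Complex.ofReal_intCast, Complex.re_ofReal_mul]
      ring
  linarith

/-- A real affine function on ℂ is determined by its values at 0, 1 and i. So convergence for these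
three frozen zero modes gives it for all of them, off one null set. -/
theorem nonResonant_update_zero_eq (N : ℕ) (a : ℤ → ℂ) (z : ℂ) :
    nonResonant N (Function.update a 0 z) =
      (1 - z.re - z.im) * nonResonant N (Function.update a 0 0) +
        z.re * nonResonant N (Function.update a 0 1) +
        z.im * nonResonant N (Function.update a 0 Complex.I) := by
  rw [nonResonant_update_zero N a z, nonResonant_update_zero N a 1,
    nonResonant_update_zero N a Complex.I]
  simp
  ring

/-! ### Trilinear bounds -/

theorem one_le_bracket (n : ℤ) : 1 ≤ bracket n := by
  rw [bracket, Real.one_le_sqrt]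
  nlinarith [sq_nonneg (n : ℝ)]

theorem abs_le_bracket (n : ℤ) : |(n : ℝ)| ≤ bracket n := by
  rw [bracket, ← Real.sqrt_sq_eq_abs]
  exact Real.sqrt_le_sqrt (by linarith)

theorem bracket_sq (n : ℤ) : bracket n ^ 2 = 1 + (n : ℝ) ^ 2 := Real.sq_sqrt (by positivity)

theorem bracket_neg (n : ℤ) : bracket (-n) = bracket n := by simp [bracket]

theorem bracket_zero : bracket 0 = 1 := by simp [bracket]

theorem natSucc_le_bracket (N : ℕ) : (N : ℝ) + 1 ≤ bracket (N + 1) := by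
  have := abs_le_bracket (N + 1)
  push_cast at this
  exact (le_abs_self _).trans this

/-- Bernoulli's inequality with exponent 1 - r at N/(N+1) = 1 - 1/(N+1). It lets the sums of
⟨n⟩^{-r} be compared with a telescoping sum. -/
theorem rpow_succ_sub_le {r : ℝ} (hr0 : 0 < r) (hr1 : r < 1) (N : ℕ) :
    (1 - r) * ((N : ℝ) + 1) ^ (-r) ≤ ((N : ℝ) + 1) ^ (1 - r) - (N : ℝ) ^ (1 - r) := by
  have hK : (0 : ℝ) < (N : ℝ) + 1 := by positivity
  have h1 : (N : ℝ) = ((N : ℝ) + 1) * (1 + -((N : ℝ) + 1)⁻¹) := by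
    field_simp
    ring
  have h2 : (0 : ℝ) ≤ 1 + -((N : ℝ) + 1)⁻¹ := by
    have : ((N : ℝ) + 1)⁻¹ ≤ 1 := inv_le_one_of_one_le₀ (by linarith [Nat.cast_nonneg (α := ℝ) N])
    linarith
  have h3 := rpow_one_add_le_one_add_mul_self (s := -((N : ℝ) + 1)⁻¹) (by linarith)
    (p := 1 - r) (by linarith) (by linarith)
  have h4 : (N : ℝ) ^ (1 - r) ≤ ((N : ℝ) + 1) ^ (1 - r) * (1 + (1 - r) * -((N : ℝ) + 1)⁻¹) := by
    conv_lhs => rw [h1]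
    rw [Real.mul_rpow hK.le h2]
    exact mul_le_mul_of_nonneg_left h3 (by positivity)
  have h5 : ((N : ℝ) + 1) ^ (-r) = ((N : ℝ) + 1) ^ (1 - r) * ((N : ℝ) + 1)⁻¹ := by
    rw [← Real.rpow_neg_one, ← Real.rpow_add hK]
    congr 1
    ring
  rw [h5]
  linarith

theorem sum_bracket_rpow_le {r : ℝ} (hr0 : 0 < r) (hr1 : r < 1) (N : ℕ) :
    ∑ n ∈ modes N, bracket n ^ (-r) ≤ 1 + 2 / (1 - r) * (N : ℝ) ^ (1 - r) := by
  have hr : 0 < 1 - r := by linarith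
  induction N with
  | zero => simp [modes, bracket_zero, Real.zero_rpow hr.ne']
  | succ N ih =>
    rw [sum_modes_succ, bracket_neg]
    have h1 : bracket (N + 1) ^ (-r) ≤ ((N : ℝ) + 1) ^ (-r) :=
      Real.rpow_le_rpow_of_nonpos (by positivity) (natSucc_le_bracket N) (by linarith)
    have h2 := rpow_succ_sub_le hr0 hr1 N
    have h3 : 2 * ((N : ℝ) + 1) ^ (-r) ≤
        2 / (1 - r) * (((N : ℝ) + 1) ^ (1 - r) - (N : ℝ) ^ (1 - r)) := by
      rw [div_mul_eq_mul_div, le_div_iff₀ hr]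
      linarith
    push_cast
    linarith

theorem sum_bracket_rpow_le' {r : ℝ} (hr0 : 0 < r) (hr1 : r < 1) (N : ℕ) :
    ∑ n ∈ modes N, bracket n ^ (-r) ≤ (1 + 2 / (1 - r)) * ((N : ℝ) + 1) ^ (1 - r) := by
  have hr : 0 < 1 - r := by linarith
  refine (sum_bracket_rpow_le hr0 hr1 N).trans ?_
  rw [add_mul, one_mul]
  have h1 : (1 : ℝ) ≤ ((N : ℝ) + 1) ^ (1 - r) :=
    Real.one_le_rpow (by linarith [Nat.cast_nonneg (α := ℝ) N]) hr.le
  have h2 : (N : ℝ) ^ (1 - r) ≤ ((N : ℝ) + 1) ^ (1 - r) :=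
    Real.rpow_le_rpow (by positivity) (by linarith) hr.le
  gcongr

theorem sum_modes_comp_le (N : ℕ) {φ : ℤ → ℝ} (hφ : ∀ n, 0 ≤ φ n)
    (hsupp : ∀ n, n ∉ modes N → φ n = 0) {ι : Type*} (s : Finset ι) (e : ι → ℤ)
    (he : Set.InjOn e s) : ∑ j ∈ s, φ (e j) ≤ ∑ n ∈ modes N, φ n := by
  classical
  rw [← Finset.sum_image he]
  calc ∑ n ∈ s.image e, φ n ≤ ∑ n ∈ s.image e ∪ modes N, φ n :=
        Finset.sum_le_sum_of_subset_of_nonneg Finset.subset_union_left fun n _ _ => hφ n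
    _ = ∑ n ∈ modes N, φ n :=
        (Finset.sum_subset Finset.subset_union_right fun n _ hn => hsupp n hn).symm

/-- The trilinear convolution sum over `|j|, |l|, |l + n - j| ≤ N`, for functions that vanish
outside `|j| ≤ N`. -/
def triSum (N : ℕ) (n : ℤ) (φ : ℤ → ℝ) : ℝ :=
  ∑ l ∈ modes N, ∑ j ∈ modes N, φ l * φ j * φ (l + n - j)

theorem triSum_sq_le (N : ℕ) (n : ℤ) (φ ψ : ℤ → ℝ) :
    triSum N n (fun j => φ j * ψ j) ^ 2 ≤
      triSum N n (fun j => φ j ^ 2) * triSum N n (fun j => ψ j ^ 2) := by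
  simp only [triSum, ← Finset.sum_product']
  have h := Finset.sum_mul_sq_le_sq_mul_sq (modes N ×ˢ modes N)
    (fun p => φ p.1 * φ p.2 * φ (p.1 + n - p.2)) (fun p => ψ p.1 * ψ p.2 * ψ (p.1 + n - p.2))
  simp only [mul_pow] at h
  refine le_of_eq_of_le ?_ h
  congr 1
  refine Finset.sum_congr rfl fun p _ => ?_
  ring

/-- If the sum of the frequencies is large, one of the factors is small. -/
theorem triSum_le_of_large {N : ℕ} {n : ℤ} {φ : ℤ → ℝ} (hφ : ∀ j, 0 ≤ φ j)
    (hsupp : ∀ j, j ∉ modes N → φ j = 0) {δ : ℝ}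
    (hδ : ∀ j : ℤ, |n| ≤ 3 * |j| → φ j ≤ δ) :
    triSum N n φ ≤ 3 * δ * (∑ j ∈ modes N, φ j) ^ 2 := by
  set S := ∑ j ∈ modes N, φ j with hS
  have hδ0 : 0 ≤ δ := (hφ _).trans (hδ n (by have := abs_nonneg n; omega))
  -- Since n = -l + j + (l+n-j), one of the three frequencies is at least |n|/3 in modulus. Its
  -- factor is replaced by δ, and each of the three possible products of the other two sums to at
  -- most S².
  have hpt : ∀ l j : ℤ, φ l * φ j * φ (l + n - j) ≤
      δ * (φ l * φ j + φ l * φ (l + n - j) + φ j * φ (l + n - j)) := by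
    intro l j
    have hl := hφ l
    have hj := hφ j
    have hk := hφ (l + n - j)
    have h1 : 0 ≤ φ l * φ j := mul_nonneg hl hj
    have h2 : 0 ≤ φ l * φ (l + n - j) := mul_nonneg hl hk
    have h3 : 0 ≤ φ j * φ (l + n - j) := mul_nonneg hj hk
    have hcase : |n| ≤ 3 * |l| ∨ |n| ≤ 3 * |j| ∨ |n| ≤ 3 * |l + n - j| := by
      by_contra hcon
      push Not at hcon
      obtain ⟨c1, c2, c3⟩ := hcon
      have : |n| ≤ |l| + |j| + |l + n - j| := by
        have e : n = -l + j + (l + n - j) := by ring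
        calc |n| = |-l + j + (l + n - j)| := by rw [← e]
          _ ≤ |-l| + |j| + |l + n - j| := abs_add_three _ _ _
          _ = _ := by rw [abs_neg]
      omega
    rcases hcase with h | h | h
    · have := mul_le_mul_of_nonneg_right (hδ l h) h3
      nlinarith
    · have := mul_le_mul_of_nonneg_right (hδ j h) h2
      nlinarith
    · have := mul_le_mul_of_nonneg_right (hδ _ h) h1
      nlinarith
  have hinner : ∀ l : ℤ, ∑ j ∈ modes N, φ (l + n - j) ≤ S := fun l =>
    sum_modes_comp_le N hφ hsupp (modes N) (fun j => l + n - j) fun a _ b _ h => by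
      simpa using h
  have hinner' : ∀ j : ℤ, ∑ l ∈ modes N, φ (l + n - j) ≤ S := fun j =>
    sum_modes_comp_le N hφ hsupp (modes N) (fun l => l + n - j) fun a _ b _ h => by
      simpa using h
  calc triSum N n φ ≤ ∑ l ∈ modes N, ∑ j ∈ modes N,
        δ * (φ l * φ j + φ l * φ (l + n - j) + φ j * φ (l + n - j)) :=
        Finset.sum_le_sum fun l _ => Finset.sum_le_sum fun j _ => hpt l j
    _ = δ * (∑ l ∈ modes N, φ l * ∑ j ∈ modes N, φ j +
        ∑ l ∈ modes N, φ l * ∑ j ∈ modes N, φ (l + n - j) +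
        ∑ j ∈ modes N, φ j * ∑ l ∈ modes N, φ (l + n - j)) := by
      simp only [Finset.mul_sum, Finset.sum_add_distrib, mul_add]
      congr 1
      rw [Finset.sum_comm]
    _ ≤ δ * (∑ l ∈ modes N, φ l * S + ∑ l ∈ modes N, φ l * S + ∑ j ∈ modes N, φ j * S) := by
      refine mul_le_mul_of_nonneg_left ?_ hδ0
      refine add_le_add (add_le_add le_rfl ?_) ?_
      · exact Finset.sum_le_sum fun l _ => mul_le_mul_of_nonneg_left (hinner l) (hφ l)
      · exact Finset.sum_le_sum fun j _ => mul_le_mul_of_nonneg_left (hinner' j) (hφ j)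
    _ = 3 * δ * S ^ 2 := by
      rw [← Finset.sum_mul]
      ring

/-- The square of the Sobolev norm of order `r / 2` of the truncated function. -/
def sobolevSum (r : ℝ) (N : ℕ) (a : ℤ → ℂ) : ℝ := ∑ n ∈ modes N, bracket n ^ r * ‖a n‖ ^ 2

theorem norm_selfConv_le (N : ℕ) (a : ℤ → ℂ) (k : ℤ) :
    ‖selfConv N a k‖ ≤ ∑ j ∈ modes N, ‖cutoff N a j‖ * ‖cutoff N a (k - j)‖ := by
  refine (norm_sum_le _ _).trans (Finset.sum_le_sum fun j _ => ?_)
  rw [norm_mul]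

/-- Of the derivative only the bound i+1 ≤ 2(N+1) is used. The shift l = i - N turns the remaining
sum into a trilinear convolution at frequency N+1. -/
theorem norm_posCoeff_le (N : ℕ) (a : ℤ → ℂ) :
    ‖posCoeff N a‖ ≤ 2 * ((N : ℝ) + 1) * triSum N (N + 1) fun j => ‖cutoff N a j‖ := by
  have h := sum_modes_eq_sum_range N fun l =>
    ∑ j ∈ modes N, ‖cutoff N a l‖ * ‖cutoff N a j‖ * ‖cutoff N a (l + (N + 1) - j)‖
  rw [triSum, h, posCoeff, Finset.mul_sum]
  refine (norm_sum_le _ _).trans (Finset.sum_le_sum fun i hi => ?_)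
  have hi' : (i : ℝ) + 1 ≤ 2 * ((N : ℝ) + 1) := by
    have := Finset.mem_range.mp hi
    have : (i : ℝ) ≤ 2 * N := by exact_mod_cast (by omega : i ≤ 2 * N)
    linarith
  rw [norm_mul, norm_mul, RCLike.norm_conj]
  have h1 : ‖(i : ℂ) + 1‖ = (i : ℝ) + 1 := by
    rw [← Nat.cast_succ, Complex.norm_natCast]
    push_cast
    ring
  rw [h1]
  refine mul_le_mul hi' ?_ (by positivity) (by positivity)
  calc _ ≤ (∑ j ∈ modes N, ‖cutoff N a j‖ * ‖cutoff N a (i + 1 - j)‖) * ‖cutoff N a (i - N)‖ := by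
        gcongr
        exact norm_selfConv_le N a _
    _ = _ := by
      rw [Finset.sum_mul]
      refine Finset.sum_congr rfl fun j _ => ?_
      rw [show (i : ℤ) - N + (N + 1) - j = i + 1 - j by ring]
      ring

theorem norm_negCoeff_le (N : ℕ) (a : ℤ → ℂ) :
    ‖negCoeff N a‖ ≤ 2 * ((N : ℝ) + 1) * triSum N (-(N + 1)) fun j => ‖cutoff N a j‖ := by
  have h := sum_modes_eq_sum_range N fun l =>
    ∑ j ∈ modes N, ‖cutoff N a (-l)‖ * ‖cutoff N a j‖ * ‖cutoff N a (-l + -(N + 1) - j)‖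
  rw [triSum, ← sum_modes_neg, h, negCoeff, Finset.mul_sum]
  refine (norm_sum_le _ _).trans (Finset.sum_le_sum fun i hi => ?_)
  have hi' : (i : ℝ) + 1 ≤ 2 * ((N : ℝ) + 1) := by
    have := Finset.mem_range.mp hi
    have : (i : ℝ) ≤ 2 * N := by exact_mod_cast (by omega : i ≤ 2 * N)
    linarith
  rw [norm_mul, norm_mul, RCLike.norm_conj]
  have h1 : ‖(i : ℂ) + 1‖ = (i : ℝ) + 1 := by
    rw [← Nat.cast_succ, Complex.norm_natCast]
    push_cast
    ring
  rw [h1]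
  refine mul_le_mul hi' ?_ (by positivity) (by positivity)
  calc _ ≤ (∑ j ∈ modes N, ‖cutoff N a j‖ * ‖cutoff N a (-(i + 1) - j)‖) *
        ‖cutoff N a (N - i)‖ := by
        gcongr
        exact norm_selfConv_le N a _
    _ = _ := by
      rw [Finset.sum_mul]
      refine Finset.sum_congr rfl fun j _ => ?_
      rw [show -((i : ℤ) - N) + -(N + 1) - j = -(i + 1) - j by ring, neg_sub]
      ring

/-- The weighted squares of the truncated sequence. -/
def weightedSq (r : ℝ) (N : ℕ) (a : ℤ → ℂ) (j : ℤ) : ℝ := bracket j ^ r * ‖cutoff N a j‖ ^ 2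

theorem weightedSq_nonneg (r : ℝ) (N : ℕ) (a : ℤ → ℂ) (j : ℤ) : 0 ≤ weightedSq r N a j :=
  mul_nonneg (Real.rpow_nonneg (bracket_pos j).le _) (sq_nonneg _)

theorem weightedSq_of_notMem {r : ℝ} {N : ℕ} {a : ℤ → ℂ} {j : ℤ} (hj : j ∉ modes N) :
    weightedSq r N a j = 0 := by simp [weightedSq, cutoff_of_notMem hj]

theorem sum_weightedSq (r : ℝ) (N : ℕ) (a : ℤ → ℂ) :
    ∑ j ∈ modes N, weightedSq r N a j = sobolevSum r N a :=
  Finset.sum_congr rfl fun j hj => by rw [weightedSq, cutoff_of_mem hj]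

theorem weightedSq_mono {r : ℝ} {M N : ℕ} (h : M ≤ N) (a : ℤ → ℂ) (j : ℤ) :
    weightedSq r M a j ≤ weightedSq r N a j := by
  by_cases hj : j ∈ modes M
  · rw [weightedSq, weightedSq, cutoff_of_mem hj, cutoff_of_mem (modes_mono h hj)]
  · rw [weightedSq_of_notMem hj]
    exact weightedSq_nonneg _ _ _ _

/-- The constant in the trilinear bound. -/
def triConst (r : ℝ) : ℝ := 3 * 3 ^ r * (1 + 2 / (1 - r)) ^ 2

theorem triConst_pos {r : ℝ} (hr1 : r < 1) : 0 < triConst r := by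
  have : 0 < 1 - r := by linarith
  unfold triConst
  positivity

/-- Cauchy–Schwarz with the weights ⟨j⟩^{r/2} and ⟨j⟩^{-r/2}. In the sum of the negative weights one
frequency is at least (N+1)/3 and yields (N+1)^{-r}, while the two free sums yield (N+1)^{1-r} each;
the total exponent is 2 - 3r. -/
theorem triSum_cutoff_sq_le {r : ℝ} (hr0 : 0 < r) (hr1 : r < 1) (N : ℕ) (a : ℤ → ℂ) {n : ℤ}
    (hn : |n| = N + 1) :
    triSum N n (fun j => ‖cutoff N a j‖) ^ 2 ≤
      triConst r * ((N : ℝ) + 1) ^ (2 - 3 * r) * triSum N n (weightedSq r N a) := by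
  set φ : ℤ → ℝ := fun j => if j ∈ modes N then bracket j ^ (-(r / 2)) else 0 with hφdef
  set ψ : ℤ → ℝ := fun j => bracket j ^ (r / 2) * ‖cutoff N a j‖ with hψdef
  have hK : (0 : ℝ) < (N : ℝ) + 1 := by positivity
  have h1 : (fun j => ‖cutoff N a j‖) = fun j => φ j * ψ j := by
    ext j
    by_cases hj : j ∈ modes N
    · simp only [hφdef, hψdef, if_pos hj]
      rw [← mul_assoc, ← Real.rpow_add (bracket_pos j)]
      simp
    · simp [hφdef, hψdef, cutoff_of_notMem hj]
  have h2 : (fun j => ψ j ^ 2) = weightedSq r N a := by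
    ext j
    simp only [hψdef, weightedSq]
    rw [mul_pow, ← Real.rpow_natCast, ← Real.rpow_mul (bracket_pos j).le]
    congr 2
    push_cast
    ring
  have h3 : ∀ j, φ j ^ 2 = if j ∈ modes N then bracket j ^ (-r) else 0 := by
    intro j
    simp only [hφdef]
    split_ifs
    · rw [← Real.rpow_natCast, ← Real.rpow_mul (bracket_pos j).le]
      congr 1
      push_cast
      ring
    · simp
  have hsum : ∑ j ∈ modes N, φ j ^ 2 = ∑ j ∈ modes N, bracket j ^ (-r) :=
    Finset.sum_congr rfl fun j hj => by rw [h3, if_pos hj]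
  have hδ : ∀ j : ℤ, |n| ≤ 3 * |j| → φ j ^ 2 ≤ 3 ^ r * ((N : ℝ) + 1) ^ (-r) := by
    intro j hj
    rw [h3]
    split_ifs
    · have hb : ((N : ℝ) + 1) / 3 ≤ bracket j := by
        refine le_trans ?_ (abs_le_bracket j)
        have : ((N : ℤ) + 1 : ℤ) ≤ 3 * |j| := hn ▸ hj
        have h' : ((N : ℝ) + 1) ≤ 3 * |(j : ℝ)| := by exact_mod_cast this
        linarith
      calc bracket j ^ (-r) ≤ (((N : ℝ) + 1) / 3) ^ (-r) :=
            Real.rpow_le_rpow_of_nonpos (by positivity) hb (by linarith)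
        _ = 3 ^ r * ((N : ℝ) + 1) ^ (-r) := by
          rw [Real.div_rpow hK.le (by norm_num), Real.rpow_neg (by norm_num : (0 : ℝ) ≤ 3)]
          field_simp
    · positivity
  have hφsum : triSum N n (fun j => φ j ^ 2) ≤ triConst r * ((N : ℝ) + 1) ^ (2 - 3 * r) := by
    refine (triSum_le_of_large (fun j => sq_nonneg _)
      (fun j hj => by rw [h3, if_neg hj]) hδ).trans ?_
    rw [hsum]
    have hs := sum_bracket_rpow_le' hr0 hr1 N
    have hs0 : 0 ≤ ∑ j ∈ modes N, bracket j ^ (-r) :=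
      Finset.sum_nonneg fun j _ => Real.rpow_nonneg (bracket_pos j).le _
    calc 3 * (3 ^ r * ((N : ℝ) + 1) ^ (-r)) * (∑ j ∈ modes N, bracket j ^ (-r)) ^ 2
        ≤ 3 * (3 ^ r * ((N : ℝ) + 1) ^ (-r)) *
          ((1 + 2 / (1 - r)) * ((N : ℝ) + 1) ^ (1 - r)) ^ 2 := by gcongr
      _ = triConst r * (((N : ℝ) + 1) ^ (-r) * (((N : ℝ) + 1) ^ (1 - r)) ^ 2) := by
        rw [triConst]
        ring
      _ = _ := by
        rw [← Real.rpow_natCast, ← Real.rpow_mul hK.le, ← Real.rpow_add hK]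
        congr 2
        push_cast
        ring
  rw [h1]
  refine (triSum_sq_le N n φ ψ).trans ?_
  rw [h2]
  refine mul_le_mul_of_nonneg_right hφsum ?_
  exact Finset.sum_nonneg fun l _ => Finset.sum_nonneg fun j _ =>
    mul_nonneg (mul_nonneg (weightedSq_nonneg _ _ _ _) (weightedSq_nonneg _ _ _ _))
      (weightedSq_nonneg _ _ _ _)

theorem triSum_weightedSq_mono {r : ℝ} {M N : ℕ} (h : M ≤ N) (n : ℤ) (a : ℤ → ℂ) :
    triSum M n (weightedSq r M a) ≤ triSum N n (weightedSq r N a) := by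
  have h0 := weightedSq_nonneg r N a
  have h0' := weightedSq_nonneg r M a
  calc triSum M n (weightedSq r M a) ≤ triSum M n (weightedSq r N a) := by
        refine Finset.sum_le_sum fun l _ => Finset.sum_le_sum fun j _ => ?_
        refine mul_le_mul (mul_le_mul (weightedSq_mono h a l) (weightedSq_mono h a j) (h0' _)
          (h0 _)) (weightedSq_mono h a _) (h0' _) (mul_nonneg (h0 _) (h0 _))
    _ ≤ triSum N n (weightedSq r N a) := by
      refine (Finset.sum_le_sum fun l _ => Finset.sum_le_sum_of_subset_of_nonneg (modes_mono h)
        fun j _ _ => ?_).trans (Finset.sum_le_sum_of_subset_of_nonneg (modes_mono h)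
        fun l _ _ => Finset.sum_nonneg fun j _ => ?_)
      · exact mul_nonneg (mul_nonneg (h0 _) (h0 _)) (h0 _)
      · exact mul_nonneg (mul_nonneg (h0 _) (h0 _)) (h0 _)

/-- For fixed l and j, distinct values of n give distinct third frequencies l+n-j, so the sum over n
is at most the unrestricted triple sum. No factor is lost in summing over the increments. -/
theorem sum_triSum_le (r : ℝ) (N : ℕ) (a : ℤ → ℂ) (s : Finset ℕ) (e : ℕ → ℤ)
    (he : Function.Injective e) :
    ∑ K ∈ s, triSum N (e K) (weightedSq r N a) ≤ sobolevSum r N a ^ 3 := by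
  have h0 := weightedSq_nonneg r N a
  have hswap : ∑ K ∈ s, triSum N (e K) (weightedSq r N a) =
      ∑ l ∈ modes N, ∑ j ∈ modes N, weightedSq r N a l * weightedSq r N a j *
        ∑ K ∈ s, weightedSq r N a (l + e K - j) := by
    simp only [triSum]
    rw [Finset.sum_comm]
    refine Finset.sum_congr rfl fun l _ => ?_
    rw [Finset.sum_comm]
    refine Finset.sum_congr rfl fun j _ => ?_
    rw [Finset.mul_sum]
  rw [hswap]
  calc _ ≤ ∑ l ∈ modes N, ∑ j ∈ modes N, weightedSq r N a l * weightedSq r N a j *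
        ∑ i ∈ modes N, weightedSq r N a i := by
        refine Finset.sum_le_sum fun l _ => Finset.sum_le_sum fun j _ =>
          mul_le_mul_of_nonneg_left ?_ (mul_nonneg (h0 _) (h0 _))
        refine sum_modes_comp_le N h0 (fun i hi => weightedSq_of_notMem hi) s
          (fun K => l + e K - j) fun x _ y _ h => he ?_
        simpa using h
    _ = _ := by
      simp only [← Finset.sum_mul, ← Finset.mul_sum, sum_weightedSq]
      ring

/-- The conditional variance of the increments of the non-resonant part. -/
def incrementSize (N : ℕ) (a : ℤ → ℂ) : ℝ :=
  (‖posCoeff N a‖ ^ 2 + ‖negCoeff N a‖ ^ 2) / bracket (N + 1) ^ 2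

theorem incrementSize_nonneg (N : ℕ) (a : ℤ → ℂ) : 0 ≤ incrementSize N a := by
  unfold incrementSize
  positivity

/-- The square (N+1)² of the derivative weight is compensated by the variance ⟨N+1⟩⁻² of the new
modes. -/
theorem incrementSize_le {r : ℝ} (hr0 : 0 < r) (hr1 : r < 1) (N : ℕ) (a : ℤ → ℂ) :
    incrementSize N a ≤ 4 * triConst r * ((N : ℝ) + 1) ^ (2 - 3 * r) *
      (triSum N (N + 1) (weightedSq r N a) + triSum N (-(N + 1)) (weightedSq r N a)) := by
  have hK : (0 : ℝ) < (N : ℝ) + 1 := by positivity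
  have hb := natSucc_le_bracket N
  have h1 := triSum_cutoff_sq_le hr0 hr1 N a (n := N + 1) (abs_of_nonneg (by omega))
  have h2 := triSum_cutoff_sq_le hr0 hr1 N a (n := -(N + 1))
    (by rw [abs_neg]; exact abs_of_nonneg (by omega))
  have p1 := pow_le_pow_left₀ (norm_nonneg _) (norm_posCoeff_le N a) 2
  have p2 := pow_le_pow_left₀ (norm_nonneg _) (norm_negCoeff_le N a) 2
  rw [mul_pow, mul_pow] at p1 p2
  rw [incrementSize, div_le_iff₀ (pow_pos (bracket_pos _) 2)]
  have hsq : ((N : ℝ) + 1) ^ 2 ≤ bracket (N + 1) ^ 2 := by gcongr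
  set A := triSum N (N + 1) (fun j => ‖cutoff N a j‖) ^ 2
  set B := triSum N (-(N + 1)) (fun j => ‖cutoff N a j‖) ^ 2
  have hA : 0 ≤ A := sq_nonneg _
  have hB : 0 ≤ B := sq_nonneg _
  calc _ ≤ 4 * (A + B) * ((N : ℝ) + 1) ^ 2 := by linarith
    _ ≤ 4 * (A + B) * bracket (N + 1) ^ 2 := by gcongr
    _ ≤ _ := by
      refine mul_le_mul_of_nonneg_right ?_ (by positivity)
      linarith

/-- For r ≥ 2/3 the factor (K+1)^{2-3r} does not increase with K. The endpoint r = 2/3 has no decay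
but the weakest norm, H^{1/3}, and serves for exponential moments; r = 5/6 gives the decay
(N₀+1)^{-1/2}. The condition r < 1 keeps the norm finite almost surely. -/
theorem sum_incrementSize_le {r : ℝ} (hr0 : 2 / 3 ≤ r) (hr1 : r < 1) (N₀ N : ℕ) (a : ℤ → ℂ) :
    ∑ K ∈ Finset.Ico N₀ N, incrementSize K a ≤
      8 * triConst r * ((N₀ : ℝ) + 1) ^ (2 - 3 * r) * sobolevSum r N a ^ 3 := by
  have hr : 0 < r := by linarith
  have hc := triConst_pos hr1
  have htri : ∀ n : ℤ, 0 ≤ triSum N n (weightedSq r N a) := fun n =>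
    Finset.sum_nonneg fun l _ => Finset.sum_nonneg fun j _ =>
    mul_nonneg (mul_nonneg (weightedSq_nonneg _ _ _ _) (weightedSq_nonneg _ _ _ _))
      (weightedSq_nonneg _ _ _ _)
  calc _ ≤ ∑ K ∈ Finset.Ico N₀ N, 4 * triConst r * ((N₀ : ℝ) + 1) ^ (2 - 3 * r) *
      (triSum N (K + 1) (weightedSq r N a) + triSum N (-(K + 1)) (weightedSq r N a)) := by
        refine Finset.sum_le_sum fun K hK => (incrementSize_le hr hr1 K a).trans ?_
        obtain ⟨h1, h2⟩ := Finset.mem_Ico.mp hK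
        have hpow : ((K : ℝ) + 1) ^ (2 - 3 * r) ≤ ((N₀ : ℝ) + 1) ^ (2 - 3 * r) :=
          Real.rpow_le_rpow_of_nonpos (by positivity) (by gcongr) (by linarith)
        refine mul_le_mul (by gcongr) (add_le_add (triSum_weightedSq_mono h2.le _ a)
          (triSum_weightedSq_mono h2.le _ a)) ?_ (by positivity)
        refine add_nonneg ?_ ?_ <;>
        exact Finset.sum_nonneg fun l _ => Finset.sum_nonneg fun j _ =>
          mul_nonneg (mul_nonneg (weightedSq_nonneg _ _ _ _) (weightedSq_nonneg _ _ _ _))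
            (weightedSq_nonneg _ _ _ _)
    _ = 4 * triConst r * ((N₀ : ℝ) + 1) ^ (2 - 3 * r) *
      (∑ K ∈ Finset.Ico N₀ N, triSum N (K + 1) (weightedSq r N a) +
        ∑ K ∈ Finset.Ico N₀ N, triSum N (-(K + 1)) (weightedSq r N a)) := by
      rw [← Finset.mul_sum, Finset.sum_add_distrib]
    _ ≤ 4 * triConst r * ((N₀ : ℝ) + 1) ^ (2 - 3 * r) *
        (sobolevSum r N a ^ 3 + sobolevSum r N a ^ 3) := by
      refine mul_le_mul_of_nonneg_left (add_le_add ?_ ?_) (by positivity)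
      · exact sum_triSum_le r N a _ (fun K : ℕ => (K : ℤ) + 1) fun x y h => by simpa using h
      · exact sum_triSum_le r N a _ (fun K : ℕ => -((K : ℤ) + 1)) fun x y h => by simpa using h
    _ = _ := by ring

/-! ### The random Fourier coefficients -/

/-- The Fourier coefficients `gₙ / ⟨n⟩` of the random series. -/
def coeffSeq (g : ℤ → ℂ) (n : ℤ) : ℂ := g n / (bracket n : ℂ)

theorem coeffSeq_update (g : ℤ → ℂ) (k : ℤ) (z : ℂ) :
    coeffSeq (Function.update g k z) = Function.update (coeffSeq g) k (z / (bracket k : ℂ)) := by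
  ext n
  by_cases h : n = k
  · subst h
    simp [coeffSeq]
  · simp [coeffSeq, h]

theorem coeffSeq_update_zero (g : ℤ → ℂ) (z : ℂ) :
    coeffSeq (Function.update g 0 z) = Function.update (coeffSeq g) 0 z := by
  rw [coeffSeq_update, bracket_zero]
  simp

theorem norm_coeffSeq_sq (g : ℤ → ℂ) (n : ℤ) :
    ‖coeffSeq g n‖ ^ 2 = (bracket n ^ 2)⁻¹ * ‖g n‖ ^ 2 := by
  rw [coeffSeq, norm_div, div_pow, Complex.norm_real, Real.norm_of_nonneg (bracket_pos n).le]
  ring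

theorem measurable_coeffSeq : Measurable coeffSeq := by
  rw [measurable_pi_iff]
  intro n
  exact (measurable_pi_apply n).div_const _

@[fun_prop]
theorem measurable_cutoff (N : ℕ) (n : ℤ) : Measurable fun a : ℤ → ℂ => cutoff N a n := by
  unfold cutoff
  split_ifs
  · exact measurable_pi_apply n
  · exact measurable_const

@[fun_prop]
theorem measurable_selfConv (N : ℕ) (k : ℤ) : Measurable fun a : ℤ → ℂ => selfConv N a k := by
  unfold selfConv
  fun_prop

@[fun_prop]
theorem measurable_posCoeff (N : ℕ) : Measurable (posCoeff N) := by
  have : Measurable (starRingEnd ℂ) := Complex.continuous_conj.measurable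
  unfold posCoeff
  fun_prop

@[fun_prop]
theorem measurable_negCoeff (N : ℕ) : Measurable (negCoeff N) := by
  have : Measurable (starRingEnd ℂ) := Complex.continuous_conj.measurable
  unfold negCoeff
  fun_prop

@[fun_prop]
theorem measurable_nonResonant (N : ℕ) : Measurable (nonResonant N) := by
  unfold nonResonant
  fun_prop

@[fun_prop]
theorem measurable_massSum (N : ℕ) : Measurable (massSum N) := by
  unfold massSum
  fun_prop

@[fun_prop]
theorem measurable_momentumSum (N : ℕ) : Measurable (momentumSum N) := by
  unfold momentumSum
  fun_prop

@[fun_prop]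
theorem measurable_diagonalSum (N : ℕ) : Measurable (diagonalSum N) := by
  unfold diagonalSum
  fun_prop

@[fun_prop]
theorem measurable_quarticForm (N : ℕ) : Measurable (quarticForm N) := by
  unfold quarticForm
  fun_prop

@[fun_prop]
theorem measurable_incrementSize (N : ℕ) : Measurable (incrementSize N) := by
  unfold incrementSize
  fun_prop

theorem posCoeff_congr {N : ℕ} {a a' : ℤ → ℂ} (h : ∀ n ∈ modes N, a n = a' n) :
    posCoeff N a = posCoeff N a' := by
  simp only [posCoeff, selfConv, cutoff_congr h]

theorem negCoeff_congr {N : ℕ} {a a' : ℤ → ℂ} (h : ∀ n ∈ modes N, a n = a' n) :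
    negCoeff N a = negCoeff N a' := by
  simp only [negCoeff, selfConv, cutoff_congr h]

theorem incrementSize_congr {N : ℕ} {a a' : ℤ → ℂ} (h : ∀ n ∈ modes N, a n = a' n) :
    incrementSize N a = incrementSize N a' := by
  rw [incrementSize, incrementSize, posCoeff_congr h, negCoeff_congr h]

/-- Adaptedness: the K-th increment involves only the modes up to K and ±(K+1). -/
theorem nonResonant_congr {N : ℕ} {a a' : ℤ → ℂ} (h : ∀ n ∈ modes N, a n = a' n) :
    nonResonant N a = nonResonant N a' := by
  refine Finset.sum_congr rfl fun K hK => ?_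
  have hKN := Finset.mem_range.mp hK
  have hsub : ∀ n ∈ modes K, a n = a' n := fun n hn => h n (modes_mono hKN.le hn)
  rw [posCoeff_congr hsub, negCoeff_congr hsub, h _ (by simp only [mem_modes]; omega),
    h _ (by simp only [mem_modes]; omega)]

theorem coeffSeq_update_eq_of_notMem {N : ℕ} {k : ℤ} (hk : k ∉ modes N) (g : ℤ → ℂ) (z : ℂ) :
    ∀ n ∈ modes N, coeffSeq (Function.update g k z) n = coeffSeq g n := by
  intro n hn
  rw [coeffSeq_update, Function.update_of_ne (ne_of_mem_of_not_mem hn hk)]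

theorem natSucc_notMem_modes (N : ℕ) : ((N : ℤ) + 1) ∉ modes N := by
  simp only [mem_modes]
  omega

theorem neg_natSucc_notMem_modes (N : ℕ) : -((N : ℤ) + 1) ∉ modes N := by
  simp only [mem_modes]
  omega

/-- Displays the increment as a real linear form in the two new Gaussians. The factor p is carried
along so that the same identity serves the exponential martingale and, with p = 1, the second
moment. -/
theorem nonResonant_increment (N : ℕ) (g : ℤ → ℂ) (p : ℝ) :
    p * (4 * (coeffSeq g (N + 1) * posCoeff N (coeffSeq g)).re -
      4 * (coeffSeq g (-(N + 1)) * negCoeff N (coeffSeq g)).re) =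
    (g (N + 1) * (((4 * p / bracket (N + 1) : ℝ) : ℂ) * posCoeff N (coeffSeq g))).re +
      (g (-(N + 1)) * (((-(4 * p) / bracket (N + 1) : ℝ) : ℂ) * negCoeff N (coeffSeq g))).re := by
  have h : ∀ (c b : ℝ) (z w : ℂ), (z * (((c / b : ℝ) : ℂ) * w)).re = c * (z / (b : ℂ) * w).re := by
    intro c b z w
    rw [← Complex.re_ofReal_mul]
    congr 1
    push_cast
    ring
  rw [h, h, coeffSeq, coeffSeq, bracket_neg]
  ring

theorem norm_sq_increment (N : ℕ) (a : ℤ → ℂ) (p : ℝ) :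
    ‖((4 * p / bracket (N + 1) : ℝ) : ℂ) * posCoeff N a‖ ^ 2 +
      ‖((-(4 * p) / bracket (N + 1) : ℝ) : ℂ) * negCoeff N a‖ ^ 2 =
      16 * p ^ 2 * incrementSize N a := by
  have hb := bracket_pos (N + 1)
  rw [incrementSize, norm_mul, norm_mul, Complex.norm_real, Complex.norm_real, mul_pow, mul_pow,
    Real.norm_eq_abs, Real.norm_eq_abs, sq_abs, sq_abs]
  field_simp
  ring

/-- The exponential martingale of the non-resonant part. -/
theorem lintegral_exp_nonResonant {P : Measure (ℤ → ℂ)} [IsProbabilityMeasure P]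
    (hP : ∀ n ≠ 0, Resamples P n) (p : ℝ) (N : ℕ) :
    ∫⁻ g, ENNReal.ofReal (Real.exp (p * nonResonant N (coeffSeq g) -
      4 * p ^ 2 * ∑ K ∈ Finset.range N, incrementSize K (coeffSeq g))) ∂P = 1 := by
  have hmc := measurable_coeffSeq
  induction N with
  | zero => simp [nonResonant]
  | succ N ih =>
    have hA := fun g z (k : ℤ) (hk : k ∉ modes N) =>
      nonResonant_congr (coeffSeq_update_eq_of_notMem hk g z)
    have hS := fun g z (k : ℤ) (hk : k ∉ modes N) (K : ℕ) (hK : K ∈ Finset.range (N + 1)) =>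
      incrementSize_congr (coeffSeq_update_eq_of_notMem (fun h => hk (modes_mono
        (Nat.lt_succ_iff.mp (Finset.mem_range.mp hK)) h)) g z : ∀ n ∈ modes K, _)
    have hL := fun g z (k : ℤ) (hk : k ∉ modes N) =>
      posCoeff_congr (coeffSeq_update_eq_of_notMem hk g z)
    have hL' := fun g z (k : ℤ) (hk : k ∉ modes N) =>
      negCoeff_congr (coeffSeq_update_eq_of_notMem hk g z)
    have hk1 := natSucc_notMem_modes N
    have hk2 := neg_natSucc_notMem_modes N
    have hAinv : ∀ (g : ℤ → ℂ) (z : ℂ) (k : ℤ), k ∉ modes N →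
        p * nonResonant N (coeffSeq (Function.update g k z)) - 4 * p ^ 2 *
          ∑ K ∈ Finset.range (N + 1), incrementSize K (coeffSeq (Function.update g k z)) =
        p * nonResonant N (coeffSeq g) - 4 * p ^ 2 *
          ∑ K ∈ Finset.range (N + 1), incrementSize K (coeffSeq g) := by
      intro g z k hk
      rw [hA g z k hk, Finset.sum_congr rfl (hS g z k hk)]
    -- The compensator up to K = N depends on the modes up to N only, so it stays fixed while ±(N+1)
    -- are integrated out. Their Laplace transform contributes 16p²/4 = 4p² times `incrementSize N`,
    -- which cancels the last term of the compensator.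
    have key := lintegral_exp_add_re_mul (P := P) (m := (N : ℤ) + 1) (n := -((N : ℤ) + 1))
      (by omega) (hP _ (by omega)) (hP _ (by omega))
      (A := fun g => p * nonResonant N (coeffSeq g) - 4 * p ^ 2 *
        ∑ K ∈ Finset.range (N + 1), incrementSize K (coeffSeq g))
      (v := fun g => ((4 * p / bracket (N + 1) : ℝ) : ℂ) * posCoeff N (coeffSeq g))
      (w := fun g => ((-(4 * p) / bracket (N + 1) : ℝ) : ℂ) * negCoeff N (coeffSeq g))
      (by fun_prop) (by fun_prop) (by fun_prop)
      (fun g z => hAinv g z _ hk1) (fun g z => hAinv g z _ hk2)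
      (fun g z => by rw [hL g z _ hk1]) (fun g z => by rw [hL g z _ hk2])
      (fun g z => by rw [hL' g z _ hk1]) (fun g z => by rw [hL' g z _ hk2])
    have e1 : ∀ g : ℤ → ℂ, p * nonResonant (N + 1) (coeffSeq g) -
        4 * p ^ 2 * ∑ K ∈ Finset.range (N + 1), incrementSize K (coeffSeq g) =
        p * nonResonant N (coeffSeq g) - 4 * p ^ 2 *
          ∑ K ∈ Finset.range (N + 1), incrementSize K (coeffSeq g) +
        (g (N + 1) * (((4 * p / bracket (N + 1) : ℝ) : ℂ) * posCoeff N (coeffSeq g))).re +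
        (g (-(N + 1)) *
          (((-(4 * p) / bracket (N + 1) : ℝ) : ℂ) * negCoeff N (coeffSeq g))).re := by
      intro g
      have := nonResonant_increment N g p
      rw [nonResonant_succ, mul_add, this]
      ring
    simp_rw [e1]
    rw [key, ← ih]
    refine lintegral_congr fun g => ?_
    rw [norm_sq_increment, Finset.sum_range_succ]
    congr 2
    ring

/-- Orthogonality of martingale increments. The factor 8 is 16/2, as Re(zw) has variance |w|²/2 for
a complex Gaussian z. -/
theorem lintegral_nonResonant_sub_sq {P : Measure (ℤ → ℂ)}
    (hP : ∀ n ≠ 0, Resamples P n) (N₀ N : ℕ) (hN : N₀ ≤ N) :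
    ∫⁻ g, ENNReal.ofReal ((nonResonant N (coeffSeq g) - nonResonant N₀ (coeffSeq g)) ^ 2) ∂P =
      ∫⁻ g, ENNReal.ofReal (8 * ∑ K ∈ Finset.Ico N₀ N, incrementSize K (coeffSeq g)) ∂P := by
  have hmc := measurable_coeffSeq
  induction N, hN using Nat.le_induction with
  | base => simp
  | succ N hN ih =>
    have hk1 := natSucc_notMem_modes N
    have hk2 := neg_natSucc_notMem_modes N
    have hAinv : ∀ (g : ℤ → ℂ) (z : ℂ) (k : ℤ), k ∉ modes N →
        nonResonant N (coeffSeq (Function.update g k z)) -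
          nonResonant N₀ (coeffSeq (Function.update g k z)) =
        nonResonant N (coeffSeq g) - nonResonant N₀ (coeffSeq g) := by
      intro g z k hk
      rw [nonResonant_congr (coeffSeq_update_eq_of_notMem hk g z),
        nonResonant_congr (coeffSeq_update_eq_of_notMem (fun h => hk (modes_mono hN h)) g z)]
    have hL := fun g z (k : ℤ) (hk : k ∉ modes N) =>
      posCoeff_congr (coeffSeq_update_eq_of_notMem hk g z)
    have hL' := fun g z (k : ℤ) (hk : k ∉ modes N) =>
      negCoeff_congr (coeffSeq_update_eq_of_notMem hk g z)
    have key := lintegral_sq_add_re_mul_add_re_mul (P := P) (m := (N : ℤ) + 1)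
      (n := -((N : ℤ) + 1)) (by omega) (hP _ (by omega)) (hP _ (by omega))
      (A := fun g => nonResonant N (coeffSeq g) - nonResonant N₀ (coeffSeq g))
      (v := fun g => ((4 * 1 / bracket (N + 1) : ℝ) : ℂ) * posCoeff N (coeffSeq g))
      (w := fun g => ((-(4 * 1) / bracket (N + 1) : ℝ) : ℂ) * negCoeff N (coeffSeq g))
      (by fun_prop) (by fun_prop) (by fun_prop)
      (fun g z => hAinv g z _ hk1) (fun g z => hAinv g z _ hk2)
      (fun g z => by rw [hL g z _ hk1]) (fun g z => by rw [hL g z _ hk2])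
      (fun g z => by rw [hL' g z _ hk2])
    have e1 : ∀ g : ℤ → ℂ, nonResonant (N + 1) (coeffSeq g) - nonResonant N₀ (coeffSeq g) =
        nonResonant N (coeffSeq g) - nonResonant N₀ (coeffSeq g) +
        (g (N + 1) * (((4 * 1 / bracket (N + 1) : ℝ) : ℂ) * posCoeff N (coeffSeq g))).re +
        (g (-(N + 1)) *
          (((-(4 * 1) / bracket (N + 1) : ℝ) : ℂ) * negCoeff N (coeffSeq g))).re := by
      intro g
      have := nonResonant_increment N g 1
      rw [nonResonant_succ]
      linarith
    simp_rw [e1]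
    rw [key, ih, ← lintegral_add_left (by fun_prop)]
    refine lintegral_congr fun g => ?_
    rw [norm_sq_increment, ← ENNReal.ofReal_add, Finset.sum_Ico_succ_top hN]
    · congr 1
      ring
    · exact mul_nonneg (by norm_num) (Finset.sum_nonneg fun K _ => incrementSize_nonneg _ _)
    · have := incrementSize_nonneg N (coeffSeq g)
      positivity

/-! ### Exponential moments of weighted sums of squares -/

/-- The left side is the Laplace transform of |z|². The exact linear term on the right matters: for
the momentum the linear terms cancel and only the squares remain. -/
theorem inv_one_sub_le_exp {x : ℝ} (hx : |x| ≤ 1 / 2) : (1 - x)⁻¹ ≤ Real.exp (x + x ^ 2) := by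
  obtain ⟨h1, h2⟩ := abs_le.mp hx
  have hpos : 0 < 1 - x := by linarith
  rw [inv_le_iff_one_le_mul₀ hpos]
  rcases le_total 0 x with h | h
  · have := Real.quadratic_le_exp_of_nonneg (x := x + x ^ 2) (by positivity)
    have h3 : 1 ≤ (1 + (x + x ^ 2) + (x + x ^ 2) ^ 2 / 2) * (1 - x) := by
      have e : (1 + (x + x ^ 2) + (x + x ^ 2) ^ 2 / 2) * (1 - x) =
        1 + x ^ 2 / 2 * (1 - x - x ^ 2 - x ^ 3) := by ring
      rw [e]
      have : 0 ≤ 1 - x - x ^ 2 - x ^ 3 := by nlinarith [mul_nonneg h h, mul_nonneg (mul_nonneg h h) h]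
      nlinarith [mul_nonneg (sq_nonneg x) this]
    exact h3.trans (mul_le_mul_of_nonneg_right this hpos.le)
  · have := Real.add_one_le_exp (x + x ^ 2)
    have h3 : 1 ≤ (x + x ^ 2 + 1) * (1 - x) := by
      have e : (x + x ^ 2 + 1) * (1 - x) = 1 + (-x) ^ 3 := by ring
      rw [e]
      have : 0 ≤ (-x) ^ 3 := pow_nonneg (by linarith) 3
      linarith
    exact h3.trans (mul_le_mul_of_nonneg_right this hpos.le)

theorem lintegral_exp_sum_normSq_le {P : Measure (ℤ → ℂ)} [IsProbabilityMeasure P] (s : Finset ℤ)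
    (hP : ∀ n ∈ s, Resamples P n) (θ : ℤ → ℝ) (hθ : ∀ n ∈ s, |θ n| ≤ 1 / 2) :
    ∫⁻ g, ENNReal.ofReal (Real.exp (∑ n ∈ s, θ n * ‖g n‖ ^ 2)) ∂P ≤
      ENNReal.ofReal (Real.exp (∑ n ∈ s, (θ n + θ n ^ 2))) := by
  simp_rw [Real.exp_sum, ENNReal.ofReal_prod_of_nonneg (fun _ _ => (Real.exp_pos _).le)]
  rw [lintegral_prod_coordinates s hP (fun n z => ENNReal.ofReal (Real.exp (θ n * ‖z‖ ^ 2)))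
    fun n => by fun_prop]
  refine Finset.prod_le_prod' fun n hn => ?_
  have h1 : θ n < 1 := by linarith [(abs_le.mp (hθ n hn)).2]
  rw [lintegral_exp_normSq h1]
  exact ENNReal.ofReal_le_ofReal (inv_one_sub_le_exp (hθ n hn))

theorem lintegral_exp_sum_normSq_le_of_nonneg {P : Measure (ℤ → ℂ)} [IsProbabilityMeasure P]
    (s : Finset ℤ) (hP : ∀ n ∈ s, Resamples P n) (θ : ℤ → ℝ) (hθ0 : ∀ n ∈ s, 0 ≤ θ n)
    (hθ : ∀ n ∈ s, θ n ≤ 1 / 2) {S : ℝ} (hS : ∑ n ∈ s, θ n ≤ S) :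
    ∫⁻ g, ENNReal.ofReal (Real.exp (∑ n ∈ s, θ n * ‖g n‖ ^ 2)) ∂P ≤
      ENNReal.ofReal (Real.exp (2 * S)) := by
  refine (lintegral_exp_sum_normSq_le s hP θ fun n hn => by
    rw [abs_of_nonneg (hθ0 n hn)]; exact hθ n hn).trans ?_
  refine ENNReal.ofReal_le_ofReal (Real.exp_le_exp.mpr ?_)
  refine le_trans ?_ (mul_le_mul_of_nonneg_left hS (by norm_num))
  rw [Finset.mul_sum]
  refine Finset.sum_le_sum fun n hn => ?_
  nlinarith [hθ0 n hn, hθ n hn]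

theorem pow_four_le_exp_add_exp (x : ℝ) : x ^ 4 ≤ 24 * (Real.exp x + Real.exp (-x)) := by
  have h := Real.pow_div_factorial_le_exp |x| (abs_nonneg x) 4
  have h4 : |x| ^ 4 = x ^ 4 := by
    rw [show (4 : ℕ) = 2 * 2 by norm_num, pow_mul, sq_abs, ← pow_mul]
  rw [h4, div_le_iff₀ (by positivity)] at h
  have hf : ((Nat.factorial 4 : ℕ) : ℝ) = 24 := by norm_num [Nat.factorial]
  rw [hf] at h
  have h2 : Real.exp |x| ≤ Real.exp x + Real.exp (-x) := by
    rcases abs_cases x with ⟨h', _⟩ | ⟨h', _⟩ <;> rw [h']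
    · linarith [Real.exp_pos (-x)]
    · linarith [Real.exp_pos x]
  linarith

/-- A fourth moment bound from two exponential moments. -/
theorem lintegral_pow_four_le {Ω : Type*} [MeasurableSpace Ω] {P : Measure Ω} {X : Ω → ℝ}
    (hX : Measurable X) {θ S : ℝ} (hθ : 0 < θ)
    (h1 : ∫⁻ ω, ENNReal.ofReal (Real.exp (θ * X ω)) ∂P ≤ ENNReal.ofReal (Real.exp S))
    (h2 : ∫⁻ ω, ENNReal.ofReal (Real.exp (-(θ * X ω))) ∂P ≤ ENNReal.ofReal (Real.exp S)) :
    ∫⁻ ω, ENNReal.ofReal (X ω ^ 4) ∂P ≤ ENNReal.ofReal (48 * Real.exp S * θ⁻¹ ^ 4) := by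
  have hpt : ∀ ω, ENNReal.ofReal (X ω ^ 4) ≤ ENNReal.ofReal (24 * θ⁻¹ ^ 4) *
      (ENNReal.ofReal (Real.exp (θ * X ω)) + ENNReal.ofReal (Real.exp (-(θ * X ω)))) := by
    intro ω
    rw [← ENNReal.ofReal_add (Real.exp_pos _).le (Real.exp_pos _).le,
      ← ENNReal.ofReal_mul (by positivity)]
    refine ENNReal.ofReal_le_ofReal ?_
    have := pow_four_le_exp_add_exp (θ * X ω)
    calc X ω ^ 4 = θ⁻¹ ^ 4 * (θ * X ω) ^ 4 := by
          rw [← mul_pow, ← mul_assoc, inv_mul_cancel₀ hθ.ne', one_mul]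
      _ ≤ θ⁻¹ ^ 4 * (24 * (Real.exp (θ * X ω) + Real.exp (-(θ * X ω)))) := by gcongr
      _ = _ := by ring
  refine (lintegral_mono hpt).trans ?_
  rw [lintegral_const_mul _ (by fun_prop), lintegral_add_left (by fun_prop)]
  calc _ ≤ ENNReal.ofReal (24 * θ⁻¹ ^ 4) *
        (ENNReal.ofReal (Real.exp S) + ENNReal.ofReal (Real.exp S)) := by gcongr
    _ = _ := by
      rw [← ENNReal.ofReal_add (Real.exp_pos _).le (Real.exp_pos _).le,
        ← ENNReal.ofReal_mul (by positivity)]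
      congr 1
      ring

theorem lintegral_pow_four_sum_normSq_le {P : Measure (ℤ → ℂ)} [IsProbabilityMeasure P]
    (s : Finset ℤ) (hP : ∀ n ∈ s, Resamples P n) (w : ℤ → ℝ) (hw : ∀ n ∈ s, 0 ≤ w n)
    {θ S : ℝ} (hθ : 0 < θ) (hθw : ∀ n ∈ s, θ * w n ≤ 1 / 2) (hS : ∑ n ∈ s, θ * w n ≤ S) :
    ∫⁻ g, ENNReal.ofReal ((∑ n ∈ s, w n * ‖g n‖ ^ 2) ^ 4) ∂P ≤
      ENNReal.ofReal (48 * Real.exp (2 * S) * θ⁻¹ ^ 4) := by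
  have hS0 : 0 ≤ S := (Finset.sum_nonneg fun n hn => mul_nonneg hθ.le (hw n hn)).trans hS
  refine lintegral_pow_four_le (by fun_prop) hθ ?_ ?_
  · have := lintegral_exp_sum_normSq_le_of_nonneg s hP (fun n => θ * w n)
      (fun n hn => mul_nonneg hθ.le (hw n hn)) hθw hS
    simpa only [Finset.mul_sum, mul_assoc] using this
  · calc _ ≤ ∫⁻ _, 1 ∂P := by
          refine lintegral_mono fun g => ?_
          rw [← ENNReal.ofReal_one]
          refine ENNReal.ofReal_le_ofReal (Real.exp_le_one_iff.mpr ?_)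
          have : 0 ≤ ∑ n ∈ s, w n * ‖g n‖ ^ 2 :=
            Finset.sum_nonneg fun n hn => mul_nonneg (hw n hn) (sq_nonneg _)
          have := mul_nonneg hθ.le this
          linarith
      _ ≤ _ := by
        rw [lintegral_const, measure_univ, mul_one, ← ENNReal.ofReal_one]
        exact ENNReal.ofReal_le_ofReal (Real.one_le_exp (by linarith))

/-! ### Sums over frequency shells -/

/-- The frequencies `N₀ < |n| ≤ N`. -/
def shell (N₀ N : ℕ) : Finset ℤ := modes N \ modes N₀

theorem mem_shell {N₀ N : ℕ} {n : ℤ} : n ∈ shell N₀ N ↔ n ∈ modes N ∧ n ∉ modes N₀ :=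
  Finset.mem_sdiff

theorem ne_zero_of_mem_shell {N₀ N : ℕ} {n : ℤ} (h : n ∈ shell N₀ N) : n ≠ 0 := by
  rintro rfl
  exact (mem_shell.mp h).2 (zero_mem_modes N₀)

theorem natSucc_le_abs_of_mem_shell {N₀ N : ℕ} {n : ℤ} (h : n ∈ shell N₀ N) :
    (N₀ : ℝ) + 1 ≤ |(n : ℝ)| := by
  have h2 := (mem_shell.mp h).2
  simp only [mem_modes] at h2
  have : (N₀ : ℤ) + 1 ≤ |n| := by
    rcases abs_cases n with ⟨h', _⟩ | ⟨h', _⟩ <;> rw [h'] <;> omega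
  exact_mod_cast this

theorem natSucc_le_bracket_of_mem_shell {N₀ N : ℕ} {n : ℤ} (h : n ∈ shell N₀ N) :
    (N₀ : ℝ) + 1 ≤ bracket n := (natSucc_le_abs_of_mem_shell h).trans (abs_le_bracket n)

theorem sum_modes_sub_sum_modes {N₀ N : ℕ} (h : N₀ ≤ N) (φ : ℤ → ℝ) :
    ∑ n ∈ modes N, φ n - ∑ n ∈ modes N₀, φ n = ∑ n ∈ shell N₀ N, φ n := by
  rw [shell, ← Finset.sum_sdiff (modes_mono h)]
  ring

theorem sum_shell_neg (N₀ N : ℕ) (φ : ℤ → ℝ) :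
    ∑ n ∈ shell N₀ N, φ (-n) = ∑ n ∈ shell N₀ N, φ n := by
  have hmem : ∀ n, n ∈ shell N₀ N → -n ∈ shell N₀ N := by
    intro n
    simp only [mem_shell, mem_modes]
    omega
  exact Finset.sum_nbij' (fun n => -n) (fun n => -n) hmem hmem (by simp) (by simp) (by simp)

/-- Telescoping: 1/(1+(N+1)²) ≤ 2/(N+1) - 2/(N+2), counted twice for ±(N+1). -/
theorem sum_shell_bracket_le (N₀ N : ℕ) :
    ∑ n ∈ shell N₀ N, (bracket n ^ 2)⁻¹ ≤ 4 / ((N₀ : ℝ) + 1) := by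
  rcases le_total N N₀ with h | h
  · rw [shell, Finset.sdiff_eq_empty_iff_subset.mpr (modes_mono h), Finset.sum_empty]
    positivity
  · suffices H : ∑ n ∈ shell N₀ N, (bracket n ^ 2)⁻¹ ≤ 4 / ((N₀ : ℝ) + 1) - 4 / ((N : ℝ) + 1) by
      have : (0 : ℝ) ≤ 4 / ((N : ℝ) + 1) := by positivity
      linarith
    rw [← sum_modes_sub_sum_modes h]
    induction N, h using Nat.le_induction with
    | base => simp
    | succ N hN ih =>
      rw [sum_modes_succ, bracket_neg, bracket_sq]
      have : (1 + (((N : ℤ) + 1 : ℤ) : ℝ) ^ 2)⁻¹ ≤ 2 / ((N : ℝ) + 1) - 2 / ((N : ℝ) + 1 + 1) := by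
        push_cast
        rw [div_sub_div _ _ (by positivity) (by positivity), inv_eq_one_div,
          div_le_div_iff₀ (by positivity) (by positivity)]
        nlinarith [Nat.cast_nonneg (α := ℝ) N]
      push_cast at this ⊢
      have e : ∀ x : ℝ, 4 / x = 2 * (2 / x) := fun x => by ring
      rw [e, e] at ih ⊢
      linarith

theorem summable_bracket_rpow {q : ℝ} (hq : 1 < q) : Summable fun n : ℤ => bracket n ^ (-q) := by
  refine Summable.of_norm_bounded_eventually (Real.summable_abs_int_rpow hq) ?_
  have : {n : ℤ | ¬ ‖bracket n ^ (-q)‖ ≤ |(n : ℝ)| ^ (-q)} ⊆ {0} := by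
    intro n hn
    by_contra h0
    apply hn
    rw [Real.norm_of_nonneg (Real.rpow_nonneg (bracket_pos n).le _)]
    refine Real.rpow_le_rpow_of_nonpos ?_ (abs_le_bracket n) (by linarith)
    exact abs_pos.mpr (Int.cast_ne_zero.mpr h0)
  exact (Set.finite_singleton (0 : ℤ)).subset this

theorem sum_bracket_rpow_le_tsum {q : ℝ} (hq : 1 < q) (s : Finset ℤ) :
    ∑ n ∈ s, bracket n ^ (-q) ≤ ∑' n : ℤ, bracket n ^ (-q) :=
  (summable_bracket_rpow hq).sum_le_tsum s fun n _ => Real.rpow_nonneg (bracket_pos n).le _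

theorem tsum_bracket_rpow_nonneg (q : ℝ) : 0 ≤ ∑' n : ℤ, bracket n ^ (-q) :=
  tsum_nonneg fun n => Real.rpow_nonneg (bracket_pos n).le _

theorem bracket_rpow_mul_norm_coeffSeq_sq (r : ℝ) (g : ℤ → ℂ) (n : ℤ) :
    bracket n ^ r * ‖coeffSeq g n‖ ^ 2 = bracket n ^ (-(2 - r)) * ‖g n‖ ^ 2 := by
  rw [norm_coeffSeq_sq, ← mul_assoc, ← Real.rpow_natCast, ← Real.rpow_neg (bracket_pos n).le,
    ← Real.rpow_add (bracket_pos n)]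
  congr 2
  push_cast
  ring

theorem bracket_rpow_neg_le_one {q : ℝ} (hq : 0 ≤ q) (n : ℤ) : bracket n ^ (-q) ≤ 1 :=
  Real.rpow_le_one_of_one_le_of_nonpos (one_le_bracket n) (by linarith)

theorem massSum_update_zero_sub (N₀ N : ℕ) (h : N₀ ≤ N) (g : ℤ → ℂ) :
    massSum N (Function.update (coeffSeq g) 0 0) - massSum N₀ (Function.update (coeffSeq g) 0 0) =
      ∑ n ∈ shell N₀ N, (bracket n ^ 2)⁻¹ * ‖g n‖ ^ 2 := by
  rw [massSum, massSum, sum_modes_sub_sum_modes h]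
  refine Finset.sum_congr rfl fun n hn => ?_
  rw [Function.update_of_ne (ne_zero_of_mem_shell hn), norm_coeffSeq_sq]

theorem massSum_update_zero_eq (N : ℕ) (g : ℤ → ℂ) :
    massSum N (Function.update (coeffSeq g) 0 0) =
      ∑ n ∈ shell 0 N, (bracket n ^ 2)⁻¹ * ‖g n‖ ^ 2 := by
  rw [← massSum_update_zero_sub 0 N (Nat.zero_le N) g]
  simp [massSum, modes]

theorem momentumSum_sub (N₀ N : ℕ) (h : N₀ ≤ N) (g : ℤ → ℂ) :
    momentumSum N (coeffSeq g) - momentumSum N₀ (coeffSeq g) =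
      ∑ n ∈ shell N₀ N, ((n : ℝ) * (bracket n ^ 2)⁻¹) * ‖g n‖ ^ 2 := by
  rw [momentumSum, momentumSum, sum_modes_sub_sum_modes h]
  refine Finset.sum_congr rfl fun n _ => ?_
  rw [norm_coeffSeq_sq]
  ring

theorem momentumSum_zero (a : ℤ → ℂ) : momentumSum 0 a = 0 := by simp [momentumSum, modes]

theorem diagonalSum_zero (a : ℤ → ℂ) : diagonalSum 0 a = 0 := by simp [diagonalSum, modes]

/-- The exponential rate √(N₀+1)/2 is less than the mass tail would allow. It is the rate of the
momentum tail below, and the decay (N₀+1)⁻² that results suffices. -/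
theorem lintegral_massTail_pow_four {P : Measure (ℤ → ℂ)} [IsProbabilityMeasure P]
    (hP : ∀ n ≠ 0, Resamples P n) (N₀ N : ℕ) :
    ∫⁻ g, ENNReal.ofReal ((∑ n ∈ shell N₀ N, (bracket n ^ 2)⁻¹ * ‖g n‖ ^ 2) ^ 4) ∂P ≤
      ENNReal.ofReal (48 * Real.exp 4 * 16 / ((N₀ : ℝ) + 1) ^ 2) := by
  set x : ℝ := √((N₀ : ℝ) + 1) with hx
  have hx2 : x ^ 2 = (N₀ : ℝ) + 1 := Real.sq_sqrt (by positivity)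
  have hx1 : 1 ≤ x := Real.one_le_sqrt.mpr (by linarith [Nat.cast_nonneg (α := ℝ) N₀])
  have hx0 : 0 < x := by linarith
  refine (lintegral_pow_four_sum_normSq_le (shell N₀ N)
    (fun n hn => hP n (ne_zero_of_mem_shell hn)) (fun n => (bracket n ^ 2)⁻¹)
    (fun n _ => by positivity) (θ := x / 2) (S := 2) (by positivity) ?_ ?_).trans ?_
  · intro n hn
    have h1 := natSucc_le_bracket_of_mem_shell hn
    have h2 : x ≤ bracket n ^ 2 := by nlinarith
    rw [div_mul_eq_mul_div, div_le_div_iff_of_pos_right (by norm_num), ← div_eq_mul_inv]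
    exact div_le_one_of_le₀ h2 (by positivity)
  · rw [← Finset.mul_sum]
    calc _ ≤ x / 2 * (4 / ((N₀ : ℝ) + 1)) := by
          gcongr
          exact sum_shell_bracket_le N₀ N
      _ ≤ 2 := by
        rw [← hx2]
        rw [show x / 2 * (4 / x ^ 2) = 2 / x by field_simp; norm_num]
        rw [div_le_iff₀ hx0]
        linarith
  · refine le_of_eq ?_
    congr 1
    rw [← hx2]
    norm_num
    field_simp
    norm_num

/-- The weights n/⟨n⟩² are not summable in absolute value, but they are odd, so the linear terms
cancel over ±n. What remains is at most t² ∑ ⟨n⟩⁻² ≤ (N₀+1)/4 · 4/(N₀+1) = 1, which dictates the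
size of t. -/
theorem lintegral_exp_momentumTail_le {P : Measure (ℤ → ℂ)} [IsProbabilityMeasure P]
    (hP : ∀ n ≠ 0, Resamples P n) (N₀ N : ℕ) {t : ℝ} (ht : |t| = √((N₀ : ℝ) + 1) / 2) :
    ∫⁻ g, ENNReal.ofReal (Real.exp
      (∑ n ∈ shell N₀ N, (t * ((n : ℝ) * (bracket n ^ 2)⁻¹)) * ‖g n‖ ^ 2)) ∂P ≤
      ENNReal.ofReal (Real.exp 1) := by
  set x : ℝ := √((N₀ : ℝ) + 1) with hx
  have hx2 : x ^ 2 = (N₀ : ℝ) + 1 := Real.sq_sqrt (by positivity)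
  have hx1 : 1 ≤ x := Real.one_le_sqrt.mpr (by linarith [Nat.cast_nonneg (α := ℝ) N₀])
  have hx0 : 0 < x := by linarith
  refine (lintegral_exp_sum_normSq_le (shell N₀ N)
    (fun n hn => hP n (ne_zero_of_mem_shell hn)) _ ?_).trans ?_
  · intro n hn
    have h1 := natSucc_le_bracket_of_mem_shell hn
    have h3 := abs_le_bracket n
    have hb := bracket_pos n
    rw [abs_mul, abs_mul, ht, abs_of_pos (by positivity : 0 < (bracket n ^ 2)⁻¹)]
    calc x / 2 * (|(n : ℝ)| * (bracket n ^ 2)⁻¹) ≤ x / 2 * (bracket n * (bracket n ^ 2)⁻¹) := by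
          gcongr
      _ = (x / bracket n) / 2 := by field_simp
      _ ≤ 1 / 2 := by
        gcongr
        exact div_le_one_of_le₀ (by nlinarith) hb.le
  · refine ENNReal.ofReal_le_ofReal (Real.exp_le_exp.mpr ?_)
    rw [Finset.sum_add_distrib]
    have hodd : ∑ n ∈ shell N₀ N, t * ((n : ℝ) * (bracket n ^ 2)⁻¹) = 0 := by
      have := sum_shell_neg N₀ N fun n => t * ((n : ℝ) * (bracket n ^ 2)⁻¹)
      simp only [bracket_neg, Int.cast_neg, neg_mul, mul_neg, Finset.sum_neg_distrib] at this
      linarith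
    rw [hodd, zero_add]
    calc _ ≤ ∑ n ∈ shell N₀ N, x ^ 2 / 4 * (bracket n ^ 2)⁻¹ := by
          refine Finset.sum_le_sum fun n _ => ?_
          have h3 := abs_le_bracket n
          have hb := bracket_pos n
          have hn2 : (n : ℝ) ^ 2 ≤ bracket n ^ 2 := by
            rw [bracket_sq]
            linarith
          have ht2 : t ^ 2 = x ^ 2 / 4 := by
            rw [← sq_abs, ht]
            ring
          rw [mul_pow, mul_pow, ht2]
          refine mul_le_mul_of_nonneg_left ?_ (by positivity)
          calc (n : ℝ) ^ 2 * (bracket n ^ 2)⁻¹ ^ 2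
              ≤ bracket n ^ 2 * (bracket n ^ 2)⁻¹ ^ 2 := by gcongr
            _ = _ := by field_simp
      _ ≤ x ^ 2 / 4 * (4 / ((N₀ : ℝ) + 1)) := by
        rw [← Finset.mul_sum]
        gcongr
        exact sum_shell_bracket_le N₀ N
      _ = 1 := by
        rw [← hx2]
        field_simp

theorem lintegral_momentumTail_pow_four {P : Measure (ℤ → ℂ)} [IsProbabilityMeasure P]
    (hP : ∀ n ≠ 0, Resamples P n) (N₀ N : ℕ) :
    ∫⁻ g, ENNReal.ofReal
        ((∑ n ∈ shell N₀ N, ((n : ℝ) * (bracket n ^ 2)⁻¹) * ‖g n‖ ^ 2) ^ 4) ∂P ≤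
      ENNReal.ofReal (48 * Real.exp 1 * 16 / ((N₀ : ℝ) + 1) ^ 2) := by
  set x : ℝ := √((N₀ : ℝ) + 1) with hx
  have hx2 : x ^ 2 = (N₀ : ℝ) + 1 := Real.sq_sqrt (by positivity)
  have hx1 : 1 ≤ x := Real.one_le_sqrt.mpr (by linarith [Nat.cast_nonneg (α := ℝ) N₀])
  have hx0 : 0 < x := by linarith
  refine (lintegral_pow_four_le (by fun_prop) (θ := x / 2) (S := 1) (by positivity) ?_ ?_).trans ?_
  · have := lintegral_exp_momentumTail_le hP N₀ N (t := x / 2) (abs_of_pos (by positivity))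
    simpa only [Finset.mul_sum, mul_assoc] using this
  · have := lintegral_exp_momentumTail_le hP N₀ N (t := -(x / 2)) (by rw [abs_neg]; exact abs_of_pos (by positivity))
    simpa only [Finset.mul_sum, mul_assoc, neg_mul, Finset.sum_neg_distrib] using this
  · refine le_of_eq ?_
    congr 1
    rw [← hx2]
    norm_num
    field_simp
    norm_num

/-- With wₙ = ⟨n⟩^{1/2} |aₙ|² this is ∑ wₙ² ≤ (∑ wₙ)², so the H^{1/4} norm controls the diagonal
sum. -/
theorem abs_diagonalSum_sub_le (N₀ N : ℕ) (h : N₀ ≤ N) (a : ℤ → ℂ) :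
    |diagonalSum N a - diagonalSum N₀ a| ≤
      (∑ n ∈ shell N₀ N, bracket n ^ (1 / 2 : ℝ) * ‖a n‖ ^ 2) ^ 2 := by
  rw [diagonalSum, diagonalSum, sum_modes_sub_sum_modes h]
  refine (Finset.abs_sum_le_sum_abs _ _).trans ?_
  refine le_trans (Finset.sum_le_sum fun n _ => ?_) (Finset.sum_sq_le_sq_sum_of_nonneg
    (s := shell N₀ N) (f := fun n => bracket n ^ (1 / 2 : ℝ) * ‖a n‖ ^ 2) fun n _ =>
      mul_nonneg (Real.rpow_nonneg (bracket_pos n).le _) (sq_nonneg _))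
  have hb : (bracket n ^ (1 / 2 : ℝ)) ^ 2 = bracket n := by
    rw [← Real.sqrt_eq_rpow, Real.sq_sqrt (bracket_pos n).le]
  rw [mul_pow, hb, abs_mul, abs_of_nonneg (by positivity : 0 ≤ ‖a n‖ ^ 4)]
  calc |(n : ℝ)| * ‖a n‖ ^ 4 ≤ bracket n * ‖a n‖ ^ 4 := by
        gcongr
        exact abs_le_bracket n
    _ = _ := by ring

/-- The weights ⟨n⟩^{-3/2} can spare a factor ⟨n⟩^{1/4} and remain summable; on the shell that
factor is at least (N₀+1)^{1/4}, which becomes the exponential rate. The decay (N₀+1)⁻¹ is then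
weakened to the rate common to all components. -/
theorem exists_lintegral_diagonalTail_le :
    ∃ C : ℝ, 0 ≤ C ∧ ∀ (P : Measure (ℤ → ℂ)) [IsProbabilityMeasure P],
      (∀ n ≠ 0, Resamples P n) → ∀ N₀ N : ℕ, N₀ ≤ N →
      ∫⁻ g, ENNReal.ofReal
        ((diagonalSum N (coeffSeq g) - diagonalSum N₀ (coeffSeq g)) ^ 2) ∂P ≤
      ENNReal.ofReal (C * ((N₀ : ℝ) + 1) ^ (-(1 / 2) : ℝ)) := by
  set T := ∑' n : ℤ, bracket n ^ (-(5 / 4) : ℝ) with hT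
  refine ⟨48 * Real.exp (2 * T) * 16, by positivity, fun P _ hP N₀ N hN => ?_⟩
  have hK : (1 : ℝ) ≤ (N₀ : ℝ) + 1 := by linarith [Nat.cast_nonneg (α := ℝ) N₀]
  have hK0 : (0 : ℝ) < (N₀ : ℝ) + 1 := by linarith
  set θ : ℝ := ((N₀ : ℝ) + 1) ^ (1 / 4 : ℝ) / 2 with hθ
  have hθ0 : 0 < θ := by positivity
  have hw : ∀ n ∈ shell N₀ N, θ * bracket n ^ (-(2 - 1 / 2) : ℝ) ≤ bracket n ^ (-(5 / 4) : ℝ) / 2 := by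
    intro n hn
    have h1 : ((N₀ : ℝ) + 1) ^ (1 / 4 : ℝ) ≤ bracket n ^ (1 / 4 : ℝ) :=
      Real.rpow_le_rpow hK0.le (natSucc_le_bracket_of_mem_shell hn) (by norm_num)
    calc θ * bracket n ^ (-(2 - 1 / 2) : ℝ)
        ≤ bracket n ^ (1 / 4 : ℝ) / 2 * bracket n ^ (-(2 - 1 / 2) : ℝ) := by
          rw [hθ]
          have := Real.rpow_nonneg (bracket_pos n).le (-(2 - 1 / 2) : ℝ)
          gcongr
      _ = bracket n ^ (1 / 4 : ℝ) * bracket n ^ (-(2 - 1 / 2) : ℝ) / 2 := by ring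
      _ = _ := by
        rw [← Real.rpow_add (bracket_pos n)]
        norm_num
  have hmain := lintegral_pow_four_sum_normSq_le (P := P) (shell N₀ N)
    (fun n hn => hP n (ne_zero_of_mem_shell hn)) (fun n => bracket n ^ (-(2 - 1 / 2) : ℝ))
    (fun n _ => Real.rpow_nonneg (bracket_pos n).le _) (θ := θ) (S := T) hθ0
    (fun n hn => (hw n hn).trans (by
      have := bracket_rpow_neg_le_one (q := 5 / 4) (by norm_num) n
      linarith))
    ((Finset.sum_le_sum hw).trans (by
      rw [← Finset.sum_div]
      have := sum_bracket_rpow_le_tsum (q := 5 / 4) (by norm_num) (shell N₀ N)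
      have := tsum_bracket_rpow_nonneg (5 / 4)
      linarith))
  refine le_trans (lintegral_mono fun g => ENNReal.ofReal_le_ofReal ?_) 
    (hmain.trans (ENNReal.ofReal_le_ofReal ?_))
  · have := abs_diagonalSum_sub_le N₀ N hN (coeffSeq g)
    simp_rw [bracket_rpow_mul_norm_coeffSeq_sq] at this
    calc _ = |diagonalSum N (coeffSeq g) - diagonalSum N₀ (coeffSeq g)| ^ 2 := (sq_abs _).symm
      _ ≤ _ := pow_le_pow_left₀ (abs_nonneg _) this 2
      _ = _ := by ring
  · have e : θ⁻¹ ^ 4 = 16 * ((N₀ : ℝ) + 1) ^ (-1 : ℝ) := by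
      rw [hθ, inv_div, div_pow, ← Real.rpow_natCast (((N₀ : ℝ) + 1) ^ (1 / 4 : ℝ)),
        ← Real.rpow_mul hK0.le, Real.rpow_neg hK0.le]
      norm_num
      ring
    have e2 : ((N₀ : ℝ) + 1) ^ (-1 : ℝ) ≤ ((N₀ : ℝ) + 1) ^ (-(1 / 2) : ℝ) :=
      Real.rpow_le_rpow_of_exponent_le hK (by norm_num)
    rw [e]
    calc _ = 48 * Real.exp (2 * T) * 16 * ((N₀ : ℝ) + 1) ^ (-1 : ℝ) := by ring
      _ ≤ _ := by gcongr

/-! ### Convergence of the components of the quartic form -/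

theorem sobolevSum_coeffSeq (r : ℝ) (N : ℕ) (g : ℤ → ℂ) :
    sobolevSum r N (coeffSeq g) =
      ‖g 0‖ ^ 2 + ∑ n ∈ shell 0 N, bracket n ^ (-(2 - r)) * ‖g n‖ ^ 2 := by
  have h := sum_modes_sub_sum_modes (Nat.zero_le N) fun n => bracket n ^ (-(2 - r)) * ‖g n‖ ^ 2
  have h0 : ∑ n ∈ modes 0, bracket n ^ (-(2 - r)) * ‖g n‖ ^ 2 = ‖g 0‖ ^ 2 := by
    simp [modes, bracket_zero]
  rw [h0] at h
  rw [sobolevSum, ← h]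
  simp_rw [bracket_rpow_mul_norm_coeffSeq_sq]
  ring

/-- The variance identity for the pinned family together with the trilinear bound at r = 5/6, where
2 - 3r = -1/2. The norm involved has the summable weights ⟨n⟩^{-7/6}, so it has a fourth moment, and
its cube is at most one plus its fourth power. -/
theorem lintegral_nonResonant_tail_le (c : ℂ) :
    ∃ C : ℝ, 0 ≤ C ∧ ∀ N₀ N : ℕ, N₀ ≤ N →
      ∫⁻ g, ENNReal.ofReal ((nonResonant N (coeffSeq (Function.update g 0 c)) -
        nonResonant N₀ (coeffSeq (Function.update g 0 c))) ^ 2) ∂gaussianFamily ≤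
      ENNReal.ofReal (C * ((N₀ : ℝ) + 1) ^ (-(1 / 2) : ℝ)) := by
  have hmc := measurable_coeffSeq
  have hP : ∀ n ≠ 0, Resamples gaussianFamily n := fun n _ => gaussianFamily_resamples n
  set T := ∑' n : ℤ, bracket n ^ (-(7 / 6) : ℝ) with hT
  have hT0 : 0 ≤ T := tsum_bracket_rpow_nonneg (7 / 6)
  set D := 64 * triConst (5 / 6) with hD
  have hD0 : 0 ≤ D := mul_nonneg (by norm_num) (triConst_pos (by norm_num)).le
  refine ⟨D * (4 * (‖c‖ ^ 6 + 1 + 48 * Real.exp (2 * T) * 16)), by positivity, fun N₀ N hN => ?_⟩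
  set κ : ℝ := ((N₀ : ℝ) + 1) ^ (-(1 / 2) : ℝ) with hκ
  have hκ0 : 0 ≤ κ := by positivity
  set Y : (ℤ → ℂ) → ℝ := fun g => ∑ n ∈ shell 0 N, bracket n ^ (-(7 / 6) : ℝ) * ‖g n‖ ^ 2 with hY
  have hYm : Measurable Y := by
    rw [hY]
    fun_prop
  have hY4 : ∫⁻ g, ENNReal.ofReal (Y g ^ 4) ∂gaussianFamily ≤
      ENNReal.ofReal (48 * Real.exp (2 * T) * 16) := by
    refine (lintegral_pow_four_sum_normSq_le (P := gaussianFamily) (shell 0 N)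
      (fun n _ => gaussianFamily_resamples n) (fun n => bracket n ^ (-(7 / 6) : ℝ))
      (fun n _ => Real.rpow_nonneg (bracket_pos n).le _) (θ := 1 / 2) (S := T) (by norm_num)
      (fun n _ => ?_) ?_).trans (le_of_eq ?_)
    · have := bracket_rpow_neg_le_one (q := 7 / 6) (by norm_num) n
      linarith
    · rw [← Finset.mul_sum]
      have := sum_bracket_rpow_le_tsum (q := 7 / 6) (by norm_num) (shell 0 N)
      linarith
    · congr 1
      norm_num
  have hpin := lintegral_nonResonant_sub_sq (P := pinnedFamily c)
    (fun n hn => pinnedFamily_resamples c hn) N₀ N hN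
  rw [lintegral_pinnedFamily c (by fun_prop), lintegral_pinnedFamily c (by fun_prop)] at hpin
  rw [hpin]
  have hpt : ∀ g : ℤ → ℂ, ENNReal.ofReal (8 * ∑ K ∈ Finset.Ico N₀ N,
      incrementSize K (coeffSeq (Function.update g 0 c))) ≤
      ENNReal.ofReal (D * κ) * (ENNReal.ofReal (4 * (‖c‖ ^ 6 + 1)) +
        ENNReal.ofReal 4 * ENNReal.ofReal (Y g ^ 4)) := by
    intro g
    have hYg : 0 ≤ Y g := Finset.sum_nonneg fun n _ =>
      mul_nonneg (Real.rpow_nonneg (bracket_pos n).le _) (sq_nonneg _)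
    rw [← ENNReal.ofReal_mul (by norm_num), ← ENNReal.ofReal_add (by positivity) (by positivity),
      ← ENNReal.ofReal_mul (by positivity)]
    refine ENNReal.ofReal_le_ofReal ?_
    have h1 := sum_incrementSize_le (r := 5 / 6) (by norm_num) (by norm_num) N₀ N
      (coeffSeq (Function.update g 0 c))
    have h2 : sobolevSum (5 / 6) N (coeffSeq (Function.update g 0 c)) = ‖c‖ ^ 2 + Y g := by
      rw [sobolevSum_coeffSeq, Function.update_self]
      congr 1
      refine Finset.sum_congr rfl fun n hn => ?_
      rw [Function.update_of_ne (ne_zero_of_mem_shell hn)]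
      norm_num
    have h3 : (‖c‖ ^ 2 + Y g) ^ 3 ≤ 4 * (‖c‖ ^ 6 + 1) + 4 * Y g ^ 4 := by
      have e1 : (‖c‖ ^ 2 + Y g) ^ 3 ≤ 4 * ((‖c‖ ^ 2) ^ 3 + Y g ^ 3) := by
        have hx : 0 ≤ ‖c‖ ^ 2 := sq_nonneg _
        nlinarith [mul_nonneg (add_nonneg hx hYg) (sq_nonneg (‖c‖ ^ 2 - Y g))]
      have e2 : Y g ^ 3 ≤ 1 + Y g ^ 4 := by
        rcases le_total (Y g) 1 with h | h
        · have := pow_le_one₀ hYg h (n := 3)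
          have := pow_nonneg hYg 4
          linarith
        · have := pow_le_pow_right₀ h (show 3 ≤ 4 by norm_num)
          linarith
      have e3 : (‖c‖ ^ 2) ^ 3 = ‖c‖ ^ 6 := by ring
      linarith
    rw [h2, show (2 - 3 * (5 / 6) : ℝ) = -(1 / 2) by norm_num, ← hκ] at h1
    calc _ ≤ 8 * (8 * triConst (5 / 6) * κ * (‖c‖ ^ 2 + Y g) ^ 3) := by gcongr
      _ = D * κ * (‖c‖ ^ 2 + Y g) ^ 3 := by
        rw [hD]
        ring
      _ ≤ _ := mul_le_mul_of_nonneg_left h3 (by positivity)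
  refine (lintegral_mono hpt).trans ?_
  rw [lintegral_const_mul _ (by fun_prop), lintegral_add_left (by fun_prop), lintegral_const,
    measure_univ, mul_one, lintegral_const_mul _ (by fun_prop)]
  calc _ ≤ ENNReal.ofReal (D * κ) * (ENNReal.ofReal (4 * (‖c‖ ^ 6 + 1)) +
        ENNReal.ofReal 4 * ENNReal.ofReal (48 * Real.exp (2 * T) * 16)) := by gcongr
    _ = _ := by
      rw [← ENNReal.ofReal_mul (by norm_num), ← ENNReal.ofReal_add (by positivity) (by positivity),
        ← ENNReal.ofReal_mul (by positivity)]
      congr 1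
      ring

/-- The inequality of arithmetic and geometric means for X⁴ and Y⁴; the parameter κ balances a
bounded factor against a small one. -/
theorem lintegral_sq_mul_le {Ω : Type*} [MeasurableSpace Ω] {P : Measure Ω} {X Y : Ω → ℝ}
    (hX : Measurable X) (hY : Measurable Y) {A B κ : ℝ} (hκ : 0 < κ) (hA : 0 ≤ A) (hB : 0 ≤ B)
    (h1 : ∫⁻ ω, ENNReal.ofReal (X ω ^ 4) ∂P ≤ ENNReal.ofReal A)
    (h2 : ∫⁻ ω, ENNReal.ofReal (Y ω ^ 4) ∂P ≤ ENNReal.ofReal B) :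
    ∫⁻ ω, ENNReal.ofReal ((X ω * Y ω) ^ 2) ∂P ≤ ENNReal.ofReal (κ * A + κ⁻¹ * B) := by
  have hpt : ∀ ω, ENNReal.ofReal ((X ω * Y ω) ^ 2) ≤
      ENNReal.ofReal κ * ENNReal.ofReal (X ω ^ 4) + ENNReal.ofReal κ⁻¹ * ENNReal.ofReal (Y ω ^ 4) := by
    intro ω
    have hx : 0 ≤ X ω ^ 4 := by positivity
    have hy : 0 ≤ Y ω ^ 4 := by positivity
    rw [← ENNReal.ofReal_mul hκ.le, ← ENNReal.ofReal_mul (by positivity),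
      ← ENNReal.ofReal_add (by positivity) (by positivity)]
    refine ENNReal.ofReal_le_ofReal ?_
    have h : 0 ≤ κ * (X ω ^ 2 - κ⁻¹ * Y ω ^ 2) ^ 2 := by positivity
    have e : κ * (X ω ^ 2 - κ⁻¹ * Y ω ^ 2) ^ 2 =
        κ * X ω ^ 4 + κ⁻¹ * Y ω ^ 4 - 2 * (X ω * Y ω) ^ 2 := by
      field_simp
      ring
    have : 0 ≤ (X ω * Y ω) ^ 2 := sq_nonneg _
    linarith
  refine (lintegral_mono hpt).trans ?_
  rw [lintegral_add_left (by fun_prop), lintegral_const_mul _ (by fun_prop),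
    lintegral_const_mul _ (by fun_prop)]
  calc _ ≤ ENNReal.ofReal κ * ENNReal.ofReal A + ENNReal.ofReal κ⁻¹ * ENNReal.ofReal B := by gcongr
    _ = _ := by
      rw [← ENNReal.ofReal_mul hκ.le, ← ENNReal.ofReal_mul (by positivity),
        ← ENNReal.ofReal_add (by positivity) (by positivity)]

theorem lintegral_sq_add_le {Ω : Type*} [MeasurableSpace Ω] {P : Measure Ω} {X Y : Ω → ℝ}
    (hX : Measurable X) {A B : ℝ} (hA : 0 ≤ A) (hB : 0 ≤ B)
    (h1 : ∫⁻ ω, ENNReal.ofReal (X ω ^ 2) ∂P ≤ ENNReal.ofReal A)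
    (h2 : ∫⁻ ω, ENNReal.ofReal (Y ω ^ 2) ∂P ≤ ENNReal.ofReal B) :
    ∫⁻ ω, ENNReal.ofReal ((X ω + Y ω) ^ 2) ∂P ≤ ENNReal.ofReal (2 * A + 2 * B) := by
  have hpt : ∀ ω, ENNReal.ofReal ((X ω + Y ω) ^ 2) ≤
      2 * ENNReal.ofReal (X ω ^ 2) + 2 * ENNReal.ofReal (Y ω ^ 2) := by
    intro ω
    rw [← ENNReal.ofReal_ofNat, ← ENNReal.ofReal_mul (by norm_num),
      ← ENNReal.ofReal_mul (by norm_num), ← ENNReal.ofReal_add (by positivity) (by positivity)]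
    refine ENNReal.ofReal_le_ofReal ?_
    nlinarith [sq_nonneg (X ω - Y ω)]
  refine (lintegral_mono hpt).trans ?_
  rw [lintegral_add_left (by fun_prop), lintegral_const_mul _ (by fun_prop),
    lintegral_const_mul' _ _ (by norm_num)]
  calc _ ≤ 2 * ENNReal.ofReal A + 2 * ENNReal.ofReal B := by gcongr
    _ = _ := by
      rw [ENNReal.ofReal_add (by positivity) (by positivity), ENNReal.ofReal_mul (by norm_num),
        ENNReal.ofReal_mul (by norm_num), ENNReal.ofReal_ofNat]

theorem inv_natSucc_le_rpow (N₀ : ℕ) : ((N₀ : ℝ) + 1)⁻¹ ≤ ((N₀ : ℝ) + 1) ^ (-(1 / 2) : ℝ) := by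
  have hK : (1 : ℝ) ≤ (N₀ : ℝ) + 1 := by linarith [Nat.cast_nonneg (α := ℝ) N₀]
  rw [← Real.rpow_neg_one]
  exact Real.rpow_le_rpow_of_exponent_le hK (by norm_num)

theorem lintegral_momentum_tail_sq_le (N₀ N : ℕ) (hN : N₀ ≤ N) :
    ∫⁻ g, ENNReal.ofReal ((momentumSum N (coeffSeq g) - momentumSum N₀ (coeffSeq g)) ^ 2)
      ∂gaussianFamily ≤
      ENNReal.ofReal ((1 + 48 * Real.exp 1 * 16) * ((N₀ : ℝ) + 1) ^ (-(1 / 2) : ℝ)) := by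
  have hP : ∀ n ≠ 0, Resamples gaussianFamily n := fun n _ => gaussianFamily_resamples n
  have hK0 : (0 : ℝ) < (N₀ : ℝ) + 1 := by positivity
  have h4 := lintegral_momentumTail_pow_four hP N₀ N
  -- With first factor 1 the product estimate passes from fourth to second moments; κ = (N₀+1)⁻¹
  -- makes both terms of order (N₀+1)⁻¹.
  have := lintegral_sq_mul_le (P := gaussianFamily) (X := fun _ => 1)
    (Y := fun g => ∑ n ∈ shell N₀ N, ((n : ℝ) * (bracket n ^ 2)⁻¹) * ‖g n‖ ^ 2)
    (κ := ((N₀ : ℝ) + 1)⁻¹) (A := 1) measurable_const (by fun_prop) (by positivity) (by norm_num)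
    (by positivity) (by simp) h4
  simp_rw [one_mul] at this
  simp_rw [momentumSum_sub N₀ N hN]
  refine this.trans (ENNReal.ofReal_le_ofReal ?_)
  have h := inv_natSucc_le_rpow N₀
  rw [inv_inv]
  calc _ = (1 + 48 * Real.exp 1 * 16) * ((N₀ : ℝ) + 1)⁻¹ := by field_simp
    _ ≤ _ := by gcongr

theorem lintegral_massMomentum_tail_le :
    ∃ C : ℝ, 0 ≤ C ∧ ∀ N₀ N : ℕ, N₀ ≤ N →
      ∫⁻ g, ENNReal.ofReal
        ((massSum N (Function.update (coeffSeq g) 0 0) * momentumSum N (coeffSeq g) -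
          massSum N₀ (Function.update (coeffSeq g) 0 0) * momentumSum N₀ (coeffSeq g)) ^ 2)
            ∂gaussianFamily ≤
      ENNReal.ofReal (C * ((N₀ : ℝ) + 1) ^ (-(1 / 2) : ℝ)) := by
  have hmc := measurable_coeffSeq
  have hP : ∀ n ≠ 0, Resamples gaussianFamily n := fun n _ => gaussianFamily_resamples n
  set A := 48 * Real.exp 4 * 16 with hA
  set B := 48 * Real.exp 1 * 16 with hB
  have hA0 : 0 ≤ A := by positivity
  have hB0 : 0 ≤ B := by positivity
  refine ⟨4 * (A + B), by positivity, fun N₀ N hN => ?_⟩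
  have hK0 : (0 : ℝ) < (N₀ : ℝ) + 1 := by positivity
  have hM : ∀ N₀ N : ℕ, Measurable fun g : ℤ → ℂ =>
      ∑ n ∈ shell N₀ N, (bracket n ^ 2)⁻¹ * ‖g n‖ ^ 2 := fun _ _ => by fun_prop
  have hX : ∀ N₀ N : ℕ, Measurable fun g : ℤ → ℂ =>
      ∑ n ∈ shell N₀ N, ((n : ℝ) * (bracket n ^ 2)⁻¹) * ‖g n‖ ^ 2 := fun _ _ => by fun_prop
  have e : ∀ g : ℤ → ℂ,
      massSum N (Function.update (coeffSeq g) 0 0) * momentumSum N (coeffSeq g) -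
          massSum N₀ (Function.update (coeffSeq g) 0 0) * momentumSum N₀ (coeffSeq g) =
      (∑ n ∈ shell 0 N, (bracket n ^ 2)⁻¹ * ‖g n‖ ^ 2) *
        (∑ n ∈ shell N₀ N, ((n : ℝ) * (bracket n ^ 2)⁻¹) * ‖g n‖ ^ 2) +
      (∑ n ∈ shell N₀ N, (bracket n ^ 2)⁻¹ * ‖g n‖ ^ 2) *
        (∑ n ∈ shell 0 N₀, ((n : ℝ) * (bracket n ^ 2)⁻¹) * ‖g n‖ ^ 2) := by
    intro g
    rw [← momentumSum_sub N₀ N hN, ← massSum_update_zero_sub N₀ N hN,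
      ← momentumSum_sub 0 N₀ (Nat.zero_le _), ← massSum_update_zero_eq, momentumSum_zero]
    ring
  simp_rw [e]
  have m1 := lintegral_massTail_pow_four hP 0 N
  have m2 := lintegral_massTail_pow_four hP N₀ N
  have x1 := lintegral_momentumTail_pow_four hP N₀ N
  have x2 := lintegral_momentumTail_pow_four hP 0 N₀
  -- In each product one factor is a tail with fourth moment of order (N₀+1)⁻² and the other has
  -- bounded fourth moment. In `t1` the tail comes second and in `t2` first, hence the reciprocal
  -- values of κ.
  have t1 := lintegral_sq_mul_le (hM 0 N) (hX N₀ N) (κ := ((N₀ : ℝ) + 1)⁻¹) (by positivity)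
    (by positivity) (by positivity) m1 x1
  have t2 := lintegral_sq_mul_le (hM N₀ N) (hX 0 N₀) (κ := ((N₀ : ℝ) + 1)) (by positivity)
    (by positivity) (by positivity) m2 x2
  refine (lintegral_sq_add_le ((hM 0 N).mul (hX N₀ N)) (by positivity) (by positivity)
    t1 t2).trans (ENNReal.ofReal_le_ofReal ?_)
  have h := inv_natSucc_le_rpow N₀
  rw [← hA, ← hB, inv_inv]
  calc _ = 4 * (A + B) * ((N₀ : ℝ) + 1)⁻¹ := by
        push_cast
        field_simp
        ring
    _ ≤ _ := by gcongr

/-- The coefficient functions of the quartic form, as a polynomial in the zero mode. -/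
def component (i : Fin 5) (N : ℕ) (g : ℤ → ℂ) : ℝ :=
  ![nonResonant N (coeffSeq (Function.update g 0 0)),
    nonResonant N (coeffSeq (Function.update g 0 1)),
    nonResonant N (coeffSeq (Function.update g 0 Complex.I)),
    momentumSum N (coeffSeq g),
    massSum N (Function.update (coeffSeq g) 0 0) * momentumSum N (coeffSeq g) -
      1 / 2 * diagonalSum N (coeffSeq g)] i

/-- The polynomials in the zero mode that go with `component`. -/
def zeroPoly (i : Fin 5) (z : ℂ) : ℝ :=
  ![3 / 4 * (1 - z.re - z.im), 3 / 4 * z.re, 3 / 4 * z.im, 3 * ‖z‖ ^ 2, 3] i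

theorem quarticForm_update_zero (N : ℕ) (g : ℤ → ℂ) (z : ℂ) :
    quarticForm N (coeffSeq (Function.update g 0 z)) = ∑ i, zeroPoly i z * component i N g := by
  rw [quarticForm_eq, coeffSeq_update_zero, nonResonant_update_zero_eq, massSum_update_zero,
    momentumSum_update_zero, diagonalSum_update_zero]
  simp only [Fin.sum_univ_five, zeroPoly, component, coeffSeq_update_zero]
  simp only [Matrix.cons_val]
  ring

theorem measurable_component (i : Fin 5) (N : ℕ) : Measurable (component i N) := by
  have hmc := measurable_coeffSeq
  have hu := fun z => measurable_update_const 0 z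
  have h0 : Measurable fun g : ℤ → ℂ => Function.update (coeffSeq g) 0 0 :=
    (measurable_update_const 0 0).comp hmc
  unfold component
  fin_cases i <;> simp only [Fin.reduceFinMk, Fin.zero_eta, Fin.mk_one, Matrix.cons_val] <;> fun_prop

theorem continuous_zeroPoly (i : Fin 5) : Continuous (zeroPoly i) := by
  unfold zeroPoly
  fin_cases i <;> simp only [Fin.reduceFinMk, Fin.zero_eta, Fin.mk_one, Matrix.cons_val] <;> fun_prop

theorem exists_lintegral_component_sub_sq_le (i : Fin 5) :
    ∃ C : ℝ, 0 ≤ C ∧ ∀ N₀ N : ℕ, N₀ ≤ N →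
      ∫⁻ g, ENNReal.ofReal ((component i N g - component i N₀ g) ^ 2) ∂gaussianFamily ≤
      ENNReal.ofReal (C * ((N₀ : ℝ) + 1) ^ (-(1 / 2) : ℝ)) := by
  fin_cases i
  · exact lintegral_nonResonant_tail_le 0
  · exact lintegral_nonResonant_tail_le 1
  · exact lintegral_nonResonant_tail_le Complex.I
  · exact ⟨_, by positivity, lintegral_momentum_tail_sq_le⟩
  · obtain ⟨C₁, h₁, H₁⟩ := lintegral_massMomentum_tail_le
    obtain ⟨C₂, h₂, H₂⟩ := exists_lintegral_diagonalTail_le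
    refine ⟨2 * C₁ + 2 * C₂, by positivity, fun N₀ N hN => ?_⟩
    have hmc := measurable_coeffSeq
    have h0 : Measurable fun g : ℤ → ℂ => Function.update (coeffSeq g) 0 0 :=
      (measurable_update_const 0 0).comp hmc
    have t1 := H₁ N₀ N hN
    have t2 := H₂ gaussianFamily (fun n _ => gaussianFamily_resamples n) N₀ N hN
    have t2' : ∫⁻ g, ENNReal.ofReal ((-(1 / 2) * (diagonalSum N (coeffSeq g) -
        diagonalSum N₀ (coeffSeq g))) ^ 2) ∂gaussianFamily ≤
        ENNReal.ofReal (C₂ * ((N₀ : ℝ) + 1) ^ (-(1 / 2) : ℝ)) := by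
      refine (lintegral_mono fun g => ENNReal.ofReal_le_ofReal ?_).trans t2
      rw [mul_pow]
      have := sq_nonneg (diagonalSum N (coeffSeq g) - diagonalSum N₀ (coeffSeq g))
      nlinarith
    have t3 := lintegral_sq_add_le (by fun_prop) (by positivity) (by positivity) t1 t2'
    refine le_trans (le_of_eq ?_) (t3.trans (le_of_eq ?_))
    · refine lintegral_congr fun g => ?_
      congr 2
      simp only [component]
      simp only [Fin.reduceFinMk, Matrix.cons_val]
      ring
    · congr 1
      ring

/-! ### Almost sure limits along the powers of two -/

theorem rpow_natPow_le (j : ℕ) :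
    (((2 ^ j : ℕ) : ℝ) + 1) ^ (-(1 / 2) : ℝ) ≤ (((2 : ℝ) ^ (-(1 / 4) : ℝ)) ^ j) ^ 2 := by
  have h2 : (0 : ℝ) ≤ 2 := by norm_num
  calc (((2 ^ j : ℕ) : ℝ) + 1) ^ (-(1 / 2) : ℝ) ≤ ((2 : ℝ) ^ j) ^ (-(1 / 2) : ℝ) := by
        refine Real.rpow_le_rpow_of_nonpos (by positivity) ?_ (by norm_num)
        push_cast
        linarith
    _ = _ := by
      rw [← pow_mul, ← Real.rpow_natCast (2 : ℝ) j, ← Real.rpow_mul h2,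
        ← Real.rpow_natCast ((2 : ℝ) ^ (-(1 / 4) : ℝ)), ← Real.rpow_mul h2]
      congr 1
      push_cast
      ring

/-- The L² distance of consecutive dyadic terms is of order 2^{-j/4}, so the sum of their distances
is integrable and hence almost surely finite. Along all N the rate N^{-1/4} would not be summable.
-/
theorem ae_exists_tendsto_dyadic {Ω : Type*} [MeasurableSpace Ω] {P : Measure Ω}
    [IsProbabilityMeasure P] {F : ℕ → Ω → ℝ} (hF : ∀ N, Measurable (F N)) {C : ℝ} (hC : 0 ≤ C)
    (h : ∀ N₀ N : ℕ, N₀ ≤ N → ∫⁻ ω, ENNReal.ofReal ((F N ω - F N₀ ω) ^ 2) ∂P ≤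
      ENNReal.ofReal (C * ((N₀ : ℝ) + 1) ^ (-(1 / 2) : ℝ))) :
    ∀ᵐ ω ∂P, ∃ l, Tendsto (fun j : ℕ => F (2 ^ j) ω) atTop (𝓝 l) := by
  set q : ℝ := (2 : ℝ) ^ (-(1 / 4) : ℝ) with hq
  have hq0 : 0 < q := by positivity
  have hq1 : q < 1 := Real.rpow_lt_one_of_one_lt_of_neg (by norm_num) (by norm_num)
  have hterm : ∀ j : ℕ, ∫⁻ ω, ENNReal.ofReal |F (2 ^ (j + 1)) ω - F (2 ^ j) ω| ∂P ≤
      ENNReal.ofReal ((C + 1) * q ^ j) := by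
    intro j
    have hqj : 0 < q ^ j := by positivity
    -- From 2|x| ≤ q^{-j} x² + q^j, which trades the first moment for the second with a geometric
    -- error.
    have hpt : ∀ ω, ENNReal.ofReal |F (2 ^ (j + 1)) ω - F (2 ^ j) ω| ≤
        ENNReal.ofReal (q ^ j)⁻¹ * ENNReal.ofReal ((F (2 ^ (j + 1)) ω - F (2 ^ j) ω) ^ 2) +
          ENNReal.ofReal (q ^ j) := by
      intro ω
      set x := F (2 ^ (j + 1)) ω - F (2 ^ j) ω
      rw [← ENNReal.ofReal_mul (by positivity), ← ENNReal.ofReal_add (by positivity) hqj.le]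
      refine ENNReal.ofReal_le_ofReal ?_
      have h1 : 0 ≤ (q ^ j)⁻¹ * (|x| - q ^ j) ^ 2 := by positivity
      have e : (q ^ j)⁻¹ * (|x| - q ^ j) ^ 2 = (q ^ j)⁻¹ * x ^ 2 + q ^ j - 2 * |x| := by
        rw [sub_sq, sq_abs]
        field_simp
        ring
      have := abs_nonneg x
      linarith
    refine (lintegral_mono hpt).trans ?_
    rw [lintegral_add_right _ measurable_const, lintegral_const, measure_univ, mul_one,
      lintegral_const_mul _ (by fun_prop)]
    have hj := h (2 ^ j) (2 ^ (j + 1)) (Nat.pow_le_pow_right (by norm_num) (Nat.le_succ j))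
    calc _ ≤ ENNReal.ofReal (q ^ j)⁻¹ * ENNReal.ofReal (C * (q ^ j) ^ 2) +
          ENNReal.ofReal (q ^ j) := by
          gcongr
          refine hj.trans (ENNReal.ofReal_le_ofReal ?_)
          exact mul_le_mul_of_nonneg_left (rpow_natPow_le j) hC
      _ = _ := by
        rw [← ENNReal.ofReal_mul (by positivity), ← ENNReal.ofReal_add (by positivity) hqj.le]
        congr 1
        field_simp
  have hsum : ∫⁻ ω, ∑' j : ℕ, ENNReal.ofReal |F (2 ^ (j + 1)) ω - F (2 ^ j) ω| ∂P ≠ ∞ := by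
    rw [lintegral_tsum fun j => by fun_prop]
    refine ne_top_of_le_ne_top ?_ (ENNReal.tsum_le_tsum hterm)
    exact ((summable_geometric_of_lt_one hq0.le hq1).mul_left (C + 1)).tsum_ofReal_ne_top
  have hae := ae_lt_top (Measurable.tsum fun j => by fun_prop) hsum
  filter_upwards [hae] with ω hω
  refine cauchySeq_tendsto_of_complete (cauchySeq_of_summable_dist ?_)
  have := ENNReal.summable_toReal hω.ne
  refine this.congr fun j => ?_
  rw [ENNReal.toReal_ofReal (abs_nonneg _), dist_comm, Real.dist_eq]

/-- Fatou's lemma along the powers of two. Although the pointwise limit is dyadic, the whole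
sequence converges to it in L² with the same rate. -/
theorem lintegral_sub_dyadic_limit_le {Ω : Type*} [MeasurableSpace Ω] {P : Measure Ω}
    {F : ℕ → Ω → ℝ} (hF : ∀ N, Measurable (F N)) {C : ℝ}
    (h : ∀ N₀ N : ℕ, N₀ ≤ N → ∫⁻ ω, ENNReal.ofReal ((F N ω - F N₀ ω) ^ 2) ∂P ≤
      ENNReal.ofReal (C * ((N₀ : ℝ) + 1) ^ (-(1 / 2) : ℝ))) {L : Ω → ℝ}
    (hL : ∀ᵐ ω ∂P, Tendsto (fun j : ℕ => F (2 ^ j) ω) atTop (𝓝 (L ω))) (N : ℕ) :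
    ∫⁻ ω, ENNReal.ofReal ((F N ω - L ω) ^ 2) ∂P ≤
      ENNReal.ofReal (C * ((N : ℝ) + 1) ^ (-(1 / 2) : ℝ)) := by
  calc _ ≤ ∫⁻ ω, liminf (fun j : ℕ => ENNReal.ofReal ((F (2 ^ j) ω - F N ω) ^ 2)) atTop ∂P := by
        refine lintegral_mono_ae ?_
        filter_upwards [hL] with ω hω
        have ht : Tendsto (fun j : ℕ => ENNReal.ofReal ((F (2 ^ j) ω - F N ω) ^ 2)) atTop
            (𝓝 (ENNReal.ofReal ((L ω - F N ω) ^ 2))) :=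
          (ENNReal.continuous_ofReal.tendsto _).comp ((hω.sub_const _).pow 2)
        rw [ht.liminf_eq, ← neg_sq, neg_sub]
    _ ≤ liminf (fun j : ℕ => ∫⁻ ω, ENNReal.ofReal ((F (2 ^ j) ω - F N ω) ^ 2) ∂P) atTop :=
        lintegral_liminf_le fun j => by fun_prop
    _ ≤ liminf (fun _ : ℕ => ENNReal.ofReal (C * ((N : ℝ) + 1) ^ (-(1 / 2) : ℝ))) atTop := by
        refine liminf_le_liminf ?_
        filter_upwards [eventually_ge_atTop N] with j hj
        exact h N (2 ^ j) (hj.trans Nat.lt_two_pow_self.le)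
    _ = _ := liminf_const _

/-- The limit of `component` along the powers of two. -/
def componentLimit (i : Fin 5) (g : ℤ → ℂ) : ℝ :=
  limUnder atTop fun j : ℕ => component i (2 ^ j) g

theorem measurable_componentLimit (i : Fin 5) : Measurable (componentLimit i) :=
  (StronglyMeasurable.limUnder fun j =>
    (measurable_component i (2 ^ j)).stronglyMeasurable).measurable

/-- All components converge along the powers of two. -/
def ComponentsConverge (g : ℤ → ℂ) : Prop :=
  ∀ i, Tendsto (fun j : ℕ => component i (2 ^ j) g) atTop (𝓝 (componentLimit i g))

theorem ae_componentsConverge : ∀ᵐ g ∂gaussianFamily, ComponentsConverge g := by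
  rw [show (∀ᵐ g ∂gaussianFamily, ComponentsConverge g) ↔ ∀ᵐ g ∂gaussianFamily, ∀ i,
    Tendsto (fun j : ℕ => component i (2 ^ j) g) atTop (𝓝 (componentLimit i g)) from Iff.rfl,
    ae_all_iff]
  intro i
  obtain ⟨C, hC, h⟩ := exists_lintegral_component_sub_sq_le i
  filter_upwards [ae_exists_tendsto_dyadic (measurable_component i) hC h] with g hg
  exact tendsto_nhds_limUnder hg

/-- The limit of the quartic form, as a function of the zero mode. -/
def quarticLimit (z : ℂ) (g : ℤ → ℂ) : ℝ := ∑ i, zeroPoly i z * componentLimit i g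

/-- The exceptional set does not depend on z. This is what carries the limit over to the mass
sphere, a Gaussian null set that is reached by moving the zero mode. -/
theorem ComponentsConverge.tendsto_quarticForm {g : ℤ → ℂ} (hg : ComponentsConverge g) (z : ℂ) :
    Tendsto (fun j : ℕ => quarticForm (2 ^ j) (coeffSeq (Function.update g 0 z))) atTop
      (𝓝 (quarticLimit z g)) := by
  simp_rw [quarticForm_update_zero]
  exact tendsto_finsetSum _ fun i _ => (hg i).const_mul _

theorem continuous_quarticLimit (g : ℤ → ℂ) : Continuous fun z => quarticLimit z g :=
  continuous_finsetSum _ fun i _ => (continuous_zeroPoly i).mul continuous_const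

theorem quarticForm_sub_quarticLimit_sq_le (N : ℕ) (g : ℤ → ℂ) (z : ℂ) :
    (quarticForm N (coeffSeq (Function.update g 0 z)) - quarticLimit z g) ^ 2 ≤
      5 * ∑ i, zeroPoly i z ^ 2 * (component i N g - componentLimit i g) ^ 2 := by
  rw [quarticForm_update_zero, quarticLimit, ← Finset.sum_sub_distrib]
  simp_rw [← mul_sub]
  refine (sq_sum_le_card_mul_sum_sq (s := Finset.univ)).trans (le_of_eq ?_)
  simp [mul_pow]

theorem exists_lintegral_component_sub_limit_le :
    ∃ C : ℝ, 0 ≤ C ∧ ∀ (i : Fin 5) (N : ℕ),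
      ∫⁻ g, ENNReal.ofReal ((component i N g - componentLimit i g) ^ 2) ∂gaussianFamily ≤
        ENNReal.ofReal (C * ((N : ℝ) + 1) ^ (-(1 / 2) : ℝ)) := by
  choose C hC h using exists_lintegral_component_sub_sq_le
  refine ⟨∑ i, C i, Finset.sum_nonneg fun i _ => hC i, fun i N => ?_⟩
  have hi : C i ≤ ∑ i, C i := Finset.single_le_sum (fun i _ => hC i) (Finset.mem_univ i)
  refine (lintegral_sub_dyadic_limit_le (measurable_component i) (h i) ?_ N).trans
    (ENNReal.ofReal_le_ofReal (by gcongr))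
  filter_upwards [ae_componentsConverge] with g hg using hg i

/-! ### Exponential integrability on small mass -/

/-- The mass of the frequencies `0 < |n| ≤ N`. -/
def lowMass (N : ℕ) (g : ℤ → ℂ) : ℝ := ∑ n ∈ shell 0 N, (bracket n ^ 2)⁻¹ * ‖g n‖ ^ 2

/-- The square of the `H^{1/3}` norm of the frequencies `0 < |n| ≤ N`. -/
def lowSobolev (N : ℕ) (g : ℤ → ℂ) : ℝ :=
  ∑ n ∈ shell 0 N, bracket n ^ (-(4 / 3) : ℝ) * ‖g n‖ ^ 2

theorem lowSobolev_nonneg (N : ℕ) (g : ℤ → ℂ) : 0 ≤ lowSobolev N g :=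
  Finset.sum_nonneg fun n _ => mul_nonneg (Real.rpow_nonneg (bracket_pos n).le _) (sq_nonneg _)

@[fun_prop]
theorem measurable_lowMass (N : ℕ) : Measurable (lowMass N) := by
  unfold lowMass
  fun_prop

@[fun_prop]
theorem measurable_lowSobolev (N : ℕ) : Measurable (lowSobolev N) := by
  unfold lowSobolev
  fun_prop

theorem bracket_le_natSucc {J : ℕ} {n : ℤ} (hn : n ∈ modes J) : bracket n ≤ (J : ℝ) + 1 := by
  rw [bracket, Real.sqrt_le_left (by positivity)]
  have h : |(n : ℝ)| ≤ J := by
    rw [mem_modes] at hn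
    have : |n| ≤ J := abs_le.mpr hn
    exact_mod_cast this
  have h2 : (n : ℝ) ^ 2 ≤ (J : ℝ) ^ 2 := by
    rw [← sq_abs]
    gcongr
  nlinarith [Nat.cast_nonneg (α := ℝ) J]

/-- As ⟨n⟩^{-4/3} = ⟨n⟩^{2/3} ⟨n⟩⁻², the frequencies up to J are controlled by the mass at the price
(J+1)^{2/3}. -/
theorem lowSobolev_le (J N : ℕ) (g : ℤ → ℂ) :
    lowSobolev N g ≤ ((J : ℝ) + 1) ^ (2 / 3 : ℝ) * lowMass N g +
      ∑ n ∈ shell J N, bracket n ^ (-(4 / 3) : ℝ) * ‖g n‖ ^ 2 := by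
  have hsub : shell J N ⊆ shell 0 N := fun n hn =>
    mem_shell.mpr ⟨(mem_shell.mp hn).1, fun h => (mem_shell.mp hn).2 (modes_mono (Nat.zero_le J) h)⟩
  have h0 : ∀ n : ℤ, 0 ≤ bracket n ^ (-(4 / 3) : ℝ) := fun n =>
    Real.rpow_nonneg (bracket_pos n).le _
  rw [lowSobolev, lowMass, Finset.mul_sum, ← Finset.sum_sdiff hsub]
  have h1 : ∑ n ∈ shell 0 N \ shell J N, bracket n ^ (-(4 / 3) : ℝ) * ‖g n‖ ^ 2 ≤
      ∑ n ∈ shell 0 N, ((J : ℝ) + 1) ^ (2 / 3 : ℝ) * ((bracket n ^ 2)⁻¹ * ‖g n‖ ^ 2) := by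
    refine (Finset.sum_le_sum fun n hn => ?_).trans (Finset.sum_le_sum_of_subset_of_nonneg
      Finset.sdiff_subset fun n _ _ => by positivity)
    have hn' : n ∈ modes J := by
      by_contra hJ
      obtain ⟨ha, hb⟩ := Finset.mem_sdiff.mp hn
      exact hb (mem_shell.mpr ⟨(mem_shell.mp ha).1, hJ⟩)
    rw [← mul_assoc]
    refine mul_le_mul_of_nonneg_right ?_ (sq_nonneg _)
    calc bracket n ^ (-(4 / 3) : ℝ) = bracket n ^ (2 / 3 : ℝ) * (bracket n ^ 2)⁻¹ := by
          rw [← Real.rpow_natCast, ← Real.rpow_neg (bracket_pos n).le,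
            ← Real.rpow_add (bracket_pos n)]
          norm_num
      _ ≤ _ := by
        refine mul_le_mul_of_nonneg_right ?_ (by positivity)
        exact Real.rpow_le_rpow (bracket_pos n).le (bracket_le_natSucc hn') (by norm_num)
  linarith

theorem rpow_two_thirds_pow_three (J : ℕ) :
    (((J : ℝ) + 1) ^ (2 / 3 : ℝ)) ^ 3 = ((J : ℝ) + 1) ^ 2 := by
  rw [← Real.rpow_natCast, ← Real.rpow_mul (by positivity), ← Real.rpow_natCast]
  norm_num

theorem rpow_two_thirds_sq (J : ℕ) :
    (((J : ℝ) + 1) ^ (2 / 3 : ℝ)) ^ 2 = ((J : ℝ) + 1) ^ (4 / 3 : ℝ) := by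
  rw [← Real.rpow_natCast, ← Real.rpow_mul (by positivity)]
  norm_num

/-- Beyond J all weights are at most (J+1)^{-4/3}, so the exponential rate (J+1)^{4/3}/2 is
admissible. The resulting bound grows only like the exponential of J^{4/3}, which is of lower order
than J². -/
theorem lintegral_exp_highSobolev_le (J N : ℕ) :
    ∫⁻ g, ENNReal.ofReal (Real.exp (((J : ℝ) + 1) ^ (4 / 3 : ℝ) / 2 *
      ∑ n ∈ shell J N, bracket n ^ (-(4 / 3) : ℝ) * ‖g n‖ ^ 2)) ∂gaussianFamily ≤
      ENNReal.ofReal (Real.exp (((J : ℝ) + 1) ^ (4 / 3 : ℝ) *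
        ∑' n : ℤ, bracket n ^ (-(4 / 3) : ℝ))) := by
  have h0 : ∀ n : ℤ, 0 ≤ bracket n ^ (-(4 / 3) : ℝ) := fun n =>
    Real.rpow_nonneg (bracket_pos n).le _
  have h := lintegral_exp_sum_normSq_le_of_nonneg (P := gaussianFamily) (shell J N)
    (fun n _ => gaussianFamily_resamples n)
    (fun n => ((J : ℝ) + 1) ^ (4 / 3 : ℝ) / 2 * bracket n ^ (-(4 / 3) : ℝ))
    (fun n _ => mul_nonneg (by positivity) (h0 n)) (fun n hn => ?_)
    (S := ((J : ℝ) + 1) ^ (4 / 3 : ℝ) / 2 * ∑' n : ℤ, bracket n ^ (-(4 / 3) : ℝ)) ?_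
  · simp only [mul_assoc, ← Finset.mul_sum] at h
    refine h.trans (le_of_eq ?_)
    congr 2
    ring
  · have h1 := Real.rpow_le_rpow (by positivity) (natSucc_le_bracket_of_mem_shell hn)
      (show (0 : ℝ) ≤ 4 / 3 by norm_num)
    have h2 : ((J : ℝ) + 1) ^ (4 / 3 : ℝ) * bracket n ^ (-(4 / 3) : ℝ) ≤ 1 := by
      rw [Real.rpow_neg (bracket_pos n).le, ← div_eq_mul_inv]
      exact div_le_one_of_le₀ h1 (Real.rpow_nonneg (bracket_pos n).le _)
    linarith
  · rw [← Finset.mul_sum]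
    exact mul_le_mul_of_nonneg_left (sum_bracket_rpow_le_tsum (by norm_num) _) (by positivity)

/-- Let Λ be the squared norm, and suppose 2m(J+1)^{2/3} ≤ Λ < 2m(J+2)^{2/3}. The low frequencies
carry at most m(J+1)^{2/3}, so the tail beyond J carries at least as much, and inserting its
exponential, as in Chernoff's bound, gains exp(-(m/2)(J+1)²). Summing over all J gives a pointwise
bound that can be integrated term by term. -/
theorem exp_lowSobolev_le {C m : ℝ} (hC : 0 ≤ C) (hm : 0 < m) (N : ℕ) (g : ℤ → ℂ)
    (hg : lowMass N g ≤ m) :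
    ENNReal.ofReal (Real.exp (C * lowSobolev N g ^ 3)) ≤
      ENNReal.ofReal (Real.exp (C * (2 * m) ^ 3)) +
      ∑' J : ℕ, ENNReal.ofReal
        (Real.exp (8 * C * m ^ 3 * ((J : ℝ) + 2) ^ 2 - m / 2 * ((J : ℝ) + 1) ^ 2)) *
        ENNReal.ofReal (Real.exp (((J : ℝ) + 1) ^ (4 / 3 : ℝ) / 2 *
          ∑ n ∈ shell J N, bracket n ^ (-(4 / 3) : ℝ) * ‖g n‖ ^ 2)) := by
  set Λ := lowSobolev N g with hΛ
  have hΛ0 : 0 ≤ Λ := lowSobolev_nonneg N g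
  rcases le_or_gt Λ (2 * m) with h | h
  · refine le_trans (ENNReal.ofReal_le_ofReal (Real.exp_le_exp.mpr ?_)) le_self_add
    gcongr
  · have hex : ∃ J : ℕ, Λ < 2 * m * ((J : ℝ) + 1) ^ (2 / 3 : ℝ) := by
      have ht : Tendsto (fun J : ℕ => 2 * m * ((J : ℝ) + 1) ^ (2 / 3 : ℝ)) atTop atTop :=
        Tendsto.const_mul_atTop (by positivity) ((tendsto_rpow_atTop (by norm_num)).comp
          (tendsto_atTop_add_const_right _ _ tendsto_natCast_atTop_atTop))
      exact (ht.eventually_gt_atTop Λ).exists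
    classical
    obtain ⟨J, hJ⟩ : ∃ J, Nat.find hex = J + 1 := by
      refine Nat.exists_eq_succ_of_ne_zero fun h0 => ?_
      have := Nat.find_spec hex
      rw [h0] at this
      norm_num at this
      linarith
    have h1 : Λ < 2 * m * (((J + 1 : ℕ) : ℝ) + 1) ^ (2 / 3 : ℝ) := by
      have := Nat.find_spec hex
      rwa [hJ] at this
    have h2 : 2 * m * ((J : ℝ) + 1) ^ (2 / 3 : ℝ) ≤ Λ := by
      have := Nat.find_min hex (m := J) (by omega)
      exact not_lt.mp this
    set R := ∑ n ∈ shell J N, bracket n ^ (-(4 / 3) : ℝ) * ‖g n‖ ^ 2 with hR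
    have h3 := lowSobolev_le J N g
    rw [← hΛ, ← hR] at h3
    set y : ℝ := ((J : ℝ) + 1) ^ (2 / 3 : ℝ) with hy
    have hy0 : 0 < y := by positivity
    have h4 : m * y ≤ R := by
      have : y * lowMass N g ≤ y * m := mul_le_mul_of_nonneg_left hg hy0.le
      linarith
    have h5 : Λ ^ 3 ≤ 8 * m ^ 3 * ((J : ℝ) + 2) ^ 2 := by
      calc Λ ^ 3 ≤ (2 * m * (((J + 1 : ℕ) : ℝ) + 1) ^ (2 / 3 : ℝ)) ^ 3 := by gcongr
        _ = 8 * m ^ 3 * ((J : ℝ) + 2) ^ 2 := by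
          rw [mul_pow, rpow_two_thirds_pow_three]
          push_cast
          ring
    have h6 : m / 2 * ((J : ℝ) + 1) ^ 2 ≤ ((J : ℝ) + 1) ^ (4 / 3 : ℝ) / 2 * R := by
      rw [← rpow_two_thirds_pow_three, ← rpow_two_thirds_sq, ← hy]
      nlinarith [mul_le_mul_of_nonneg_left h4 (sq_nonneg y)]
    refine le_trans ?_ le_add_self
    refine le_trans ?_ (ENNReal.le_tsum J)
    rw [← ENNReal.ofReal_mul (Real.exp_pos _).le, ← Real.exp_add]
    refine ENNReal.ofReal_le_ofReal (Real.exp_le_exp.mpr ?_)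
    have := mul_le_mul_of_nonneg_left h5 hC
    linarith

theorem summable_exp_gaussian_tail {m T : ℝ} (hm : 0 < m) (hT : 0 ≤ T) :
    Summable fun J : ℕ =>
      Real.exp (-(m / 4) * ((J : ℝ) + 1) ^ 2 + ((J : ℝ) + 1) ^ (4 / 3 : ℝ) * T) := by
  -- With y = (J+1)^{2/3}, the bound y² ≤ δ y³ + δ⁻² absorbs the power 4/3 of J+1 into its square;
  -- this δ makes T δ ≤ m/8, half of the available coefficient m/4.
  set δ : ℝ := m / (8 * (T + 1)) with hδ
  have hδ0 : 0 < δ := by positivity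
  have hbound : ∀ J : ℕ, -(m / 4) * ((J : ℝ) + 1) ^ 2 + ((J : ℝ) + 1) ^ (4 / 3 : ℝ) * T ≤
      T * δ⁻¹ ^ 2 + (J : ℝ) * (-(m / 8)) := by
    intro J
    set y : ℝ := ((J : ℝ) + 1) ^ (2 / 3 : ℝ) with hy
    have hy0 : 0 < y := by positivity
    have hy3 : y ^ 3 = ((J : ℝ) + 1) ^ 2 := rpow_two_thirds_pow_three J
    have hy2 : y ^ 2 = ((J : ℝ) + 1) ^ (4 / 3 : ℝ) := rpow_two_thirds_sq J
    have h1 : y ^ 2 ≤ δ * y ^ 3 + δ⁻¹ ^ 2 := by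
      rcases le_total δ⁻¹ y with h | h
      · have : 1 ≤ δ * y := by
          rw [inv_le_iff_one_le_mul₀ hδ0] at h
          linarith
        have h' : 0 ≤ (δ * y - 1) * y ^ 2 := mul_nonneg (by linarith) (sq_nonneg y)
        have : 0 ≤ δ⁻¹ ^ 2 := by positivity
        nlinarith
      · have : y ^ 2 ≤ δ⁻¹ ^ 2 := by gcongr
        have : 0 ≤ δ * y ^ 3 := by positivity
        linarith
    have h2 : T * δ ≤ m / 8 := by
      rw [hδ, ← mul_div_assoc, div_le_div_iff₀ (by positivity) (by norm_num)]
      nlinarith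
    rw [← hy2]
    have h3 : y ^ 2 * T ≤ m / 8 * ((J : ℝ) + 1) ^ 2 + T * δ⁻¹ ^ 2 := by
      have a1 := mul_le_mul_of_nonneg_left h1 hT
      have a2 := mul_le_mul_of_nonneg_right h2 (pow_pos hy0 3).le
      rw [← hy3]
      nlinarith
    have h4 : (J : ℝ) ≤ ((J : ℝ) + 1) ^ 2 := by nlinarith [Nat.cast_nonneg (α := ℝ) J]
    nlinarith
  have hgeom : Summable fun J : ℕ => Real.exp (T * δ⁻¹ ^ 2) * Real.exp ((J : ℝ) * (-(m / 8))) :=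
    (Real.summable_exp_nat_mul_iff.mpr (by linarith)).mul_left _
  refine Summable.of_nonneg_of_le (fun J => (Real.exp_pos _).le) (fun J => ?_) hgeom
  rw [← Real.exp_add]
  exact Real.exp_le_exp.mpr (hbound J)

/-- Exponential integrability of the sixth power of the `H^{1/3}` norm on small mass. -/
theorem exists_lintegral_exp_lowSobolev_le {C m : ℝ} (hC : 0 ≤ C) (hm : 0 < m)
    (hmC : m ≤ 1 / (16 * (C + 1))) :
    ∃ K : ℝ≥0∞, K ≠ ∞ ∧ ∀ N : ℕ,
      ∫⁻ g in {g | lowMass N g ≤ m}, ENNReal.ofReal (Real.exp (C * lowSobolev N g ^ 3))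
        ∂gaussianFamily ≤ K := by
  set T := ∑' n : ℤ, bracket n ^ (-(4 / 3) : ℝ) with hT
  have hT0 : 0 ≤ T := tsum_bracket_rpow_nonneg (4 / 3)
  refine ⟨ENNReal.ofReal (Real.exp (C * (2 * m) ^ 3)) + ∑' J : ℕ, ENNReal.ofReal
    (Real.exp (-(m / 4) * ((J : ℝ) + 1) ^ 2 + ((J : ℝ) + 1) ^ (4 / 3 : ℝ) * T)), ?_, fun N => ?_⟩
  · exact ENNReal.add_ne_top.mpr
      ⟨ENNReal.ofReal_ne_top, (summable_exp_gaussian_tail hm hT0).tsum_ofReal_ne_top⟩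
  · have hset : MeasurableSet {g | lowMass N g ≤ m} :=
      measurableSet_le (measurable_lowMass N) measurable_const
    calc _ ≤ ∫⁻ g in {g | lowMass N g ≤ m}, (ENNReal.ofReal (Real.exp (C * (2 * m) ^ 3)) +
        ∑' J : ℕ, ENNReal.ofReal
          (Real.exp (8 * C * m ^ 3 * ((J : ℝ) + 2) ^ 2 - m / 2 * ((J : ℝ) + 1) ^ 2)) *
          ENNReal.ofReal (Real.exp (((J : ℝ) + 1) ^ (4 / 3 : ℝ) / 2 *
            ∑ n ∈ shell J N, bracket n ^ (-(4 / 3) : ℝ) * ‖g n‖ ^ 2))) ∂gaussianFamily :=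
          setLIntegral_mono' hset fun g hg => exp_lowSobolev_le hC hm N g hg
      _ ≤ ∫⁻ g, (ENNReal.ofReal (Real.exp (C * (2 * m) ^ 3)) +
        ∑' J : ℕ, ENNReal.ofReal
          (Real.exp (8 * C * m ^ 3 * ((J : ℝ) + 2) ^ 2 - m / 2 * ((J : ℝ) + 1) ^ 2)) *
          ENNReal.ofReal (Real.exp (((J : ℝ) + 1) ^ (4 / 3 : ℝ) / 2 *
            ∑ n ∈ shell J N, bracket n ^ (-(4 / 3) : ℝ) * ‖g n‖ ^ 2))) ∂gaussianFamily :=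
          setLIntegral_le_lintegral _ _
      _ ≤ _ := by
        rw [lintegral_add_left measurable_const, lintegral_const, measure_univ, mul_one,
          lintegral_tsum fun J => Measurable.aemeasurable (by fun_prop)]
        refine add_le_add le_rfl (ENNReal.tsum_le_tsum fun J => ?_)
        rw [lintegral_const_mul _ (by fun_prop)]
        refine (mul_le_mul_right (lintegral_exp_highSobolev_le J N) _).trans ?_
        rw [← ENNReal.ofReal_mul (Real.exp_pos _).le, ← Real.exp_add]
        refine ENNReal.ofReal_le_ofReal (Real.exp_le_exp.mpr ?_)
        rw [← hT]
        -- Here the mass must be small: the growth 8 C m³ (J+2)² ≤ 32 C m³ (J+1)² may use up only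
        -- half of the gain (m/2)(J+1)².
        have h1 : 32 * C * m ^ 3 ≤ m / 4 := by
          rw [le_div_iff₀ (by positivity)] at hmC
          have h2 : m * C ≤ 1 / 16 := by nlinarith
          have h3 : m ≤ 1 / 16 := by nlinarith
          have h4 : m * C * m ≤ 1 / 256 := by
            have := mul_nonneg hm.le hC
            nlinarith
          nlinarith
        have h2 : ((J : ℝ) + 2) ^ 2 ≤ 4 * ((J : ℝ) + 1) ^ 2 := by
          nlinarith [Nat.cast_nonneg (α := ℝ) J]
        have h3 : 8 * C * m ^ 3 * ((J : ℝ) + 2) ^ 2 ≤ m / 4 * ((J : ℝ) + 1) ^ 2 := by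
          calc _ ≤ 8 * C * m ^ 3 * (4 * ((J : ℝ) + 1) ^ 2) := by gcongr
            _ = 32 * C * m ^ 3 * ((J : ℝ) + 1) ^ 2 := by ring
            _ ≤ _ := by gcongr
        linarith

/-! ### The envelope of the weights -/

/-- The corners of the square of side `2 h` about the origin. -/
def corner (h : ℝ) (b : Bool × Bool) : ℂ := ⟨if b.1 then h else -h, if b.2 then h else -h⟩

/-- A real affine function on a square is bounded by its value at some corner. -/
theorem exists_corner_le {h : ℝ} {z : ℂ} (hz : ‖z‖ ≤ h) (w : ℂ) :
    ∃ b, (z * w).re ≤ (corner h b * w).re := by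
  have hx := (Complex.abs_re_le_norm z).trans hz
  have hy := (Complex.abs_im_le_norm z).trans hz
  obtain ⟨hx1, hx2⟩ := abs_le.mp hx
  obtain ⟨hy1, hy2⟩ := abs_le.mp hy
  refine ⟨(decide (0 ≤ w.re), decide (w.im ≤ 0)), ?_⟩
  simp only [corner, Complex.mul_re, decide_eq_true_eq]
  have h1 : z.re * w.re ≤ (if 0 ≤ w.re then h else -h) * w.re := by
    split_ifs with hw
    · exact mul_le_mul_of_nonneg_right hx2 hw
    · exact mul_le_mul_of_nonpos_right hx1 (not_le.mp hw).le
  have h2 : (if w.im ≤ 0 then h else -h) * w.im ≤ z.im * w.im := by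
    split_ifs with hw
    · exact mul_le_mul_of_nonpos_right hy2 hw
    · exact mul_le_mul_of_nonneg_right hy1 (not_le.mp hw).le
  linarith

theorem exp_add_add_le (x y z : ℝ) :
    Real.exp (x + y + z) ≤ Real.exp (3 * x) + Real.exp (3 * y) + Real.exp (3 * z) := by
  have hx := Real.exp_pos (3 * x)
  have hy := Real.exp_pos (3 * y)
  have hz := Real.exp_pos (3 * z)
  rcases le_total x y with h1 | h1 <;> rcases le_total y z with h2 | h2 <;>
    rcases le_total x z with h3 | h3
  all_goals first
    | (have := Real.exp_le_exp.mpr (show x + y + z ≤ 3 * x by linarith); linarith)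
    | (have := Real.exp_le_exp.mpr (show x + y + z ≤ 3 * y by linarith); linarith)
    | (have := Real.exp_le_exp.mpr (show x + y + z ≤ 3 * z by linarith); linarith)

/-- A bound of `exp f_N` that does not depend on the zero mode. -/
def envelope (m : ℝ) (N : ℕ) (g : ℤ → ℂ) : ℝ≥0∞ :=
  Set.indicator {g | lowMass N g ≤ 2 * m} (fun g =>
    ∑ b, ENNReal.ofReal (Real.exp
      (9 / 4 * nonResonant N (coeffSeq (Function.update g 0 (corner √(2 * m) b))))) +
    ENNReal.ofReal (Real.exp (1 / 2 * |momentumSum N (coeffSeq g)|)) +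
    ENNReal.ofReal (Real.exp (9 / 2 * |diagonalSum N (coeffSeq g)|))) g

theorem measurable_envelope (m : ℝ) (N : ℕ) : Measurable (envelope m N) := by
  have hmc := measurable_coeffSeq
  have hu := fun z => measurable_update_const 0 z
  refine Measurable.indicator ?_ (measurableSet_le (measurable_lowMass N) measurable_const)
  fun_prop

/-- The non-resonant part is affine in z and thus bounded by its value at a corner. The momentum has
the coefficient 3 · mass ≤ 12m ≤ 1/6. The three terms are separated by bounding the exponential of a
sum by exponentials of three times each term, which produces the coefficients 9/4, 1/2 and 9/2. -/
theorem exp_quarticForm_le_envelope {m : ℝ} (hm1 : m ≤ 1 / 72) (N : ℕ) (g : ℤ → ℂ)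
    {z : ℂ} (hz : ‖z‖ ^ 2 ≤ 2 * m) (hg : lowMass N g ≤ 2 * m) :
    ENNReal.ofReal (Real.exp (quarticForm N (coeffSeq (Function.update g 0 z)))) ≤
      envelope m N g := by
  rw [envelope, Set.indicator_of_mem (show g ∈ {g | lowMass N g ≤ 2 * m} from hg)]
  rw [quarticForm_eq, coeffSeq_update_zero, massSum_update_zero, momentumSum_update_zero,
    diagonalSum_update_zero, massSum_update_zero_eq]
  set X := momentumSum N (coeffSeq g)
  set Y := diagonalSum N (coeffSeq g)
  have hM0 : 0 ≤ lowMass N g := Finset.sum_nonneg fun n _ => by positivity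
  obtain ⟨b, hb⟩ := exists_corner_le (h := √(2 * m)) (z := z)
    (Real.le_sqrt_of_sq_le hz) (zeroCoeff N (coeffSeq g))
  have hNR : nonResonant N (Function.update (coeffSeq g) 0 z) ≤
      nonResonant N (coeffSeq (Function.update g 0 (corner √(2 * m) b))) := by
    rw [coeffSeq_update_zero, nonResonant_update_zero N _ z,
      nonResonant_update_zero N _ (corner √(2 * m) b)]
    linarith
  have hX : 3 * (lowMass N g + ‖z‖ ^ 2) * X ≤ 1 / 6 * |X| := by
    have h1 : 3 * (lowMass N g + ‖z‖ ^ 2) ≤ 1 / 6 := by linarith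
    calc _ ≤ 3 * (lowMass N g + ‖z‖ ^ 2) * |X| :=
          mul_le_mul_of_nonneg_left (le_abs_self X) (by positivity)
      _ ≤ _ := mul_le_mul_of_nonneg_right h1 (abs_nonneg X)
  have hY : -(3 / 2) * Y ≤ 3 / 2 * |Y| := by
    have := neg_abs_le Y
    linarith
  rw [show (∑ n ∈ shell 0 N, (bracket n ^ 2)⁻¹ * ‖g n‖ ^ 2) = lowMass N g from rfl]
  have hexp : Real.exp (3 / 4 * (nonResonant N (Function.update (coeffSeq g) 0 z) +
      4 * (lowMass N g + ‖z‖ ^ 2) * X - 2 * Y)) ≤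
      Real.exp (9 / 4 * nonResonant N (coeffSeq (Function.update g 0 (corner √(2 * m) b)))) +
      Real.exp (1 / 2 * |X|) + Real.exp (9 / 2 * |Y|) := by
    have h := exp_add_add_le
      (3 / 4 * nonResonant N (coeffSeq (Function.update g 0 (corner √(2 * m) b))))
      (1 / 6 * |X|) (3 / 2 * |Y|)
    rw [← mul_assoc, ← mul_assoc, ← mul_assoc, show (3 * (3 / 4) : ℝ) = 9 / 4 by norm_num,
      show (3 * (1 / 6) : ℝ) = 1 / 2 by norm_num, show (3 * (3 / 2) : ℝ) = 9 / 2 by norm_num] at h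
    refine le_trans (Real.exp_le_exp.mpr ?_) h
    linarith
  refine (ENNReal.ofReal_le_ofReal hexp).trans ?_
  rw [ENNReal.ofReal_add (by positivity) (by positivity),
    ENNReal.ofReal_add (by positivity) (by positivity)]
  gcongr
  exact Finset.single_le_sum (f := fun b => ENNReal.ofReal (Real.exp
      (9 / 4 * nonResonant N (coeffSeq (Function.update g 0 (corner √(2 * m) b))))))
    (fun _ _ => zero_le) (Finset.mem_univ b)

/-- The constant in the exponential bound. -/
def expConst : ℝ := 2592 * triConst (2 / 3) + 9 / 2

theorem expConst_nonneg : 0 ≤ expConst := by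
  have := triConst_pos (r := 2 / 3) (by norm_num)
  unfold expConst
  positivity

/-- Here 81 = 4 · (9/2)² is the compensator constant for p = 9/2, and 2592 = 81 · 8 · 4, with 8 from
the variance bound and 4 from (x+y)³ ≤ 4(x³+y³). The summand 9/2 of `expConst` is reserved for the
diagonal sum. -/
theorem sum_incrementSize_pinned_le (N : ℕ) (g : ℤ → ℂ) (c : ℂ) :
    81 * ∑ K ∈ Finset.range N, incrementSize K (coeffSeq (Function.update g 0 c)) ≤
      expConst * ‖c‖ ^ 6 + expConst * lowSobolev N g ^ 3 := by
  have h1 := sum_incrementSize_le (r := 2 / 3) (by norm_num) (by norm_num) 0 N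
    (coeffSeq (Function.update g 0 c))
  have h2 : sobolevSum (2 / 3) N (coeffSeq (Function.update g 0 c)) =
      ‖c‖ ^ 2 + lowSobolev N g := by
    rw [sobolevSum_coeffSeq, Function.update_self, lowSobolev]
    congr 1
    refine Finset.sum_congr rfl fun n hn => ?_
    rw [Function.update_of_ne (ne_zero_of_mem_shell hn)]
    norm_num
  have hL := lowSobolev_nonneg N g
  have h3 : (‖c‖ ^ 2 + lowSobolev N g) ^ 3 ≤ 4 * (‖c‖ ^ 6 + lowSobolev N g ^ 3) := by
    have hx : 0 ≤ ‖c‖ ^ 2 := sq_nonneg _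
    have e3 : (‖c‖ ^ 2) ^ 3 = ‖c‖ ^ 6 := by ring
    nlinarith [mul_nonneg (add_nonneg hx hL) (sq_nonneg (‖c‖ ^ 2 - lowSobolev N g))]
  have ht := triConst_pos (r := 2 / 3) (by norm_num)
  rw [h2, Nat.Ico_zero_eq_range] at h1
  norm_num at h1
  have h4 : 0 ≤ ‖c‖ ^ 6 + lowSobolev N g ^ 3 := by positivity
  calc _ ≤ 81 * (8 * triConst (2 / 3) * (‖c‖ ^ 2 + lowSobolev N g) ^ 3) := by gcongr
    _ ≤ 81 * (8 * triConst (2 / 3) * (4 * (‖c‖ ^ 6 + lowSobolev N g ^ 3))) := by gcongr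
    _ = (2592 * triConst (2 / 3)) * (‖c‖ ^ 6 + lowSobolev N g ^ 3) := by ring
    _ ≤ expConst * (‖c‖ ^ 6 + lowSobolev N g ^ 3) := by
      refine mul_le_mul_of_nonneg_right ?_ h4
      unfold expConst
      linarith
    _ = _ := by ring

/-- Let A be the non-resonant part and V its summed `incrementSize`. Either (9/4)A ≤ 81V, and the
norm controls the exponential, or (9/4)A ≤ (9/2)A - 81V, and the exponential martingale with p =
9/2, of total mass 1, does. This replaces Hölder's inequality. -/
theorem lintegral_exp_nonResonant_pinned_le {m : ℝ} (N : ℕ) (c : ℂ) {K : ℝ≥0∞}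
    (hK : ∫⁻ g in {g | lowMass N g ≤ m},
      ENNReal.ofReal (Real.exp (expConst * lowSobolev N g ^ 3)) ∂gaussianFamily ≤ K) :
    ∫⁻ g in {g | lowMass N g ≤ m}, ENNReal.ofReal (Real.exp
      (9 / 4 * nonResonant N (coeffSeq (Function.update g 0 c)))) ∂gaussianFamily ≤
      1 + ENNReal.ofReal (Real.exp (expConst * ‖c‖ ^ 6)) * K := by
  have hmc := measurable_coeffSeq
  have hu := measurable_update_const 0 c
  have hmart := lintegral_exp_nonResonant (P := pinnedFamily c)
    (fun n hn => pinnedFamily_resamples c hn) (9 / 2) N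
  rw [lintegral_pinnedFamily c (by fun_prop)] at hmart
  have hpt : ∀ g : ℤ → ℂ, ENNReal.ofReal (Real.exp
      (9 / 4 * nonResonant N (coeffSeq (Function.update g 0 c)))) ≤
      ENNReal.ofReal (Real.exp (9 / 2 * nonResonant N (coeffSeq (Function.update g 0 c)) -
        4 * (9 / 2) ^ 2 * ∑ K ∈ Finset.range N,
          incrementSize K (coeffSeq (Function.update g 0 c)))) +
      ENNReal.ofReal (Real.exp (expConst * ‖c‖ ^ 6)) *
        ENNReal.ofReal (Real.exp (expConst * lowSobolev N g ^ 3)) := by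
    intro g
    have hV := sum_incrementSize_pinned_le N g c
    set A := nonResonant N (coeffSeq (Function.update g 0 c))
    set V := ∑ K ∈ Finset.range N, incrementSize K (coeffSeq (Function.update g 0 c))
    rw [← ENNReal.ofReal_mul (Real.exp_pos _).le, ← Real.exp_add,
      ← ENNReal.ofReal_add (Real.exp_pos _).le (Real.exp_pos _).le]
    refine ENNReal.ofReal_le_ofReal ?_
    rcases le_total (9 / 4 * A) (81 * V) with h | h
    · have := Real.exp_le_exp.mpr (h.trans hV)
      linarith [Real.exp_pos (9 / 2 * A - 4 * (9 / 2) ^ 2 * V)]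
    · have : Real.exp (9 / 4 * A) ≤ Real.exp (9 / 2 * A - 4 * (9 / 2) ^ 2 * V) :=
        Real.exp_le_exp.mpr (by linarith)
      linarith [Real.exp_pos (expConst * ‖c‖ ^ 6 + expConst * lowSobolev N g ^ 3)]
  refine (lintegral_mono hpt).trans ?_
  rw [lintegral_add_left (by fun_prop), lintegral_const_mul _ (by fun_prop)]
  gcongr
  exact (setLIntegral_le_lintegral _ _).trans hmart.le

theorem abs_diagonalSum_le (N : ℕ) (g : ℤ → ℂ) :
    |diagonalSum N (coeffSeq g)| ≤ 1 + lowSobolev N g ^ 3 := by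
  have h := abs_diagonalSum_sub_le 0 N (Nat.zero_le N) (coeffSeq g)
  rw [diagonalSum_zero, sub_zero] at h
  simp_rw [bracket_rpow_mul_norm_coeffSeq_sq] at h
  have hL := lowSobolev_nonneg N g
  have h1 : ∑ n ∈ shell 0 N, bracket n ^ (-(2 - 1 / 2) : ℝ) * ‖g n‖ ^ 2 ≤ lowSobolev N g := by
    refine Finset.sum_le_sum fun n _ => mul_le_mul_of_nonneg_right ?_ (sq_nonneg _)
    exact Real.rpow_le_rpow_of_exponent_le (one_le_bracket n) (by norm_num)
  have h0 : 0 ≤ ∑ n ∈ shell 0 N, bracket n ^ (-(2 - 1 / 2) : ℝ) * ‖g n‖ ^ 2 :=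
    Finset.sum_nonneg fun n _ => mul_nonneg (Real.rpow_nonneg (bracket_pos n).le _) (sq_nonneg _)
  have h2 := pow_le_pow_left₀ h0 h1 2
  have h3 : lowSobolev N g ^ 2 ≤ 1 + lowSobolev N g ^ 3 := by
    rcases le_total (lowSobolev N g) 1 with h' | h'
    · have := pow_le_one₀ hL h' (n := 2)
      have := pow_nonneg hL 3
      linarith
    · have := pow_le_pow_right₀ h' (show 2 ≤ 3 by norm_num)
      linarith
  linarith

theorem lintegral_exp_diagonalSum_le {m : ℝ} (N : ℕ) {K : ℝ≥0∞}
    (hK : ∫⁻ g in {g | lowMass N g ≤ m},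
      ENNReal.ofReal (Real.exp (expConst * lowSobolev N g ^ 3)) ∂gaussianFamily ≤ K) :
    ∫⁻ g in {g | lowMass N g ≤ m}, ENNReal.ofReal (Real.exp
      (9 / 2 * |diagonalSum N (coeffSeq g)|)) ∂gaussianFamily ≤
      ENNReal.ofReal (Real.exp (9 / 2)) * K := by
  calc _ ≤ ∫⁻ g in {g | lowMass N g ≤ m}, ENNReal.ofReal (Real.exp (9 / 2)) *
        ENNReal.ofReal (Real.exp (expConst * lowSobolev N g ^ 3)) ∂gaussianFamily := by
        refine lintegral_mono fun g => ?_
        rw [← ENNReal.ofReal_mul (Real.exp_pos _).le, ← Real.exp_add]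
        refine ENNReal.ofReal_le_ofReal (Real.exp_le_exp.mpr ?_)
        have h1 := abs_diagonalSum_le N g
        have h2 : 9 / 2 * lowSobolev N g ^ 3 ≤ expConst * lowSobolev N g ^ 3 := by
          refine mul_le_mul_of_nonneg_right ?_ (pow_nonneg (lowSobolev_nonneg N g) 3)
          have := triConst_pos (r := 2 / 3) (by norm_num)
          unfold expConst
          linarith
        linarith
    _ ≤ _ := by
      rw [lintegral_const_mul _ (by fun_prop)]
      gcongr

/-- No restriction to small mass is needed: for N₀ = 0 the rate of the momentum tail bound is
exactly the 1/2 that occurs in the envelope. -/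
theorem lintegral_exp_momentumSum_le (N : ℕ) :
    ∫⁻ g, ENNReal.ofReal (Real.exp (1 / 2 * |momentumSum N (coeffSeq g)|)) ∂gaussianFamily ≤
      ENNReal.ofReal (Real.exp 1) + ENNReal.ofReal (Real.exp 1) := by
  have hmc := measurable_coeffSeq
  have hP : ∀ n ≠ 0, Resamples gaussianFamily n := fun n _ => gaussianFamily_resamples n
  have key : ∀ t : ℝ, |t| = 1 / 2 →
      ∫⁻ g, ENNReal.ofReal (Real.exp (t * momentumSum N (coeffSeq g))) ∂gaussianFamily ≤
        ENNReal.ofReal (Real.exp 1) := by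
    intro t ht
    have h := lintegral_exp_momentumTail_le hP 0 N (t := t) (by rw [ht]; norm_num)
    have e : ∀ g : ℤ → ℂ, t * momentumSum N (coeffSeq g) =
        ∑ n ∈ shell 0 N, (t * ((n : ℝ) * (bracket n ^ 2)⁻¹)) * ‖g n‖ ^ 2 := by
      intro g
      have := momentumSum_sub 0 N (Nat.zero_le N) g
      rw [momentumSum_zero, sub_zero] at this
      rw [this, Finset.mul_sum]
      refine Finset.sum_congr rfl fun n _ => ?_
      ring
    simp_rw [e]
    exact h
  calc _ ≤ ∫⁻ g, (ENNReal.ofReal (Real.exp (1 / 2 * momentumSum N (coeffSeq g))) +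
        ENNReal.ofReal (Real.exp (-(1 / 2) * momentumSum N (coeffSeq g)))) ∂gaussianFamily := by
        refine lintegral_mono fun g => ?_
        rcases abs_cases (momentumSum N (coeffSeq g)) with ⟨h, _⟩ | ⟨h, _⟩ <;> rw [h]
        · exact le_self_add
        · rw [show 1 / 2 * -momentumSum N (coeffSeq g) = -(1 / 2) * momentumSum N (coeffSeq g) by
            ring]
          exact le_add_self
    _ ≤ _ := by
      rw [lintegral_add_left (by fun_prop)]
      exact add_le_add (key _ (abs_of_pos (by norm_num)))
        (key _ (by rw [abs_neg]; exact abs_of_pos (by norm_num)))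

/-- The mass threshold. -/
def massThreshold : ℝ := 1 / (72 * (expConst + 1))

theorem massThreshold_pos : 0 < massThreshold := by
  have := expConst_nonneg
  unfold massThreshold
  positivity

theorem massThreshold_le : massThreshold ≤ 1 / 72 := by
  have := expConst_nonneg
  unfold massThreshold
  rw [div_le_div_iff₀ (by positivity) (by norm_num)]
  linarith

theorem exists_lintegral_envelope_le {m : ℝ} (hm : 0 < m) (hm' : m ≤ massThreshold) :
    ∃ K : ℝ≥0∞, K ≠ ∞ ∧ ∀ N, ∫⁻ g, envelope m N g ∂gaussianFamily ≤ K := by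
  have hmc := measurable_coeffSeq
  have hu := fun z => measurable_update_const 0 z
  have hE := expConst_nonneg
  -- The threshold is doubled because a shell about m with ε < m reaches up to mass 2m; 2m ≤
  -- 1/(36(C+1)) is still small enough.
  obtain ⟨K, hK, h⟩ := exists_lintegral_exp_lowSobolev_le (C := expConst) (m := 2 * m) hE
    (by positivity) (by
      unfold massThreshold at hm'
      rw [le_div_iff₀ (by positivity)] at hm' ⊢
      nlinarith)
  refine ⟨∑ b, (1 + ENNReal.ofReal (Real.exp (expConst * ‖corner √(2 * m) b‖ ^ 6)) * K) +
    (ENNReal.ofReal (Real.exp 1) + ENNReal.ofReal (Real.exp 1)) +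
    ENNReal.ofReal (Real.exp (9 / 2)) * K, ?_, fun N => ?_⟩
  · refine ENNReal.add_ne_top.mpr ⟨ENNReal.add_ne_top.mpr ⟨?_, by simp⟩,
      ENNReal.mul_ne_top ENNReal.ofReal_ne_top hK⟩
    refine ENNReal.sum_ne_top.mpr fun b _ => ENNReal.add_ne_top.mpr ⟨ENNReal.one_ne_top,
      ENNReal.mul_ne_top ENNReal.ofReal_ne_top hK⟩
  · unfold envelope
    rw [lintegral_indicator (measurableSet_le (measurable_lowMass N) measurable_const),
      lintegral_add_left (by fun_prop), lintegral_add_left (by fun_prop),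
      lintegral_finsetSum _ (fun b _ => by fun_prop)]
    gcongr with b
    · exact lintegral_exp_nonResonant_pinned_le N _ (h N)
    · exact (setLIntegral_le_lintegral _ _).trans (lintegral_exp_momentumSum_le N)
    · exact lintegral_exp_diagonalSum_le N (h N)

/-- The limiting envelope. -/
def envelopeLimit (m : ℝ) (g : ℤ → ℂ) : ℝ≥0∞ := liminf (fun j : ℕ => envelope m (2 ^ j) g) atTop

theorem measurable_envelopeLimit (m : ℝ) : Measurable (envelopeLimit m) :=
  Measurable.liminf fun j => measurable_envelope m (2 ^ j)

theorem lintegral_envelopeLimit_ne_top {m : ℝ} (hm : 0 < m) (hm' : m ≤ massThreshold) :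
    ∫⁻ g, envelopeLimit m g ∂gaussianFamily ≠ ∞ := by
  obtain ⟨K, hK, h⟩ := exists_lintegral_envelope_le hm hm'
  refine ne_top_of_le_ne_top hK ((lintegral_liminf_le fun j => measurable_envelope m _).trans ?_)
  exact (liminf_le_liminf (Eventually.of_forall fun j => h (2 ^ j))).trans (liminf_const K).le

/-- The right side does not involve z, so it can dominate the weight uniformly in the radius and the
angle of the zero mode. -/
theorem exp_quarticLimit_le {m : ℝ} (hm' : m ≤ massThreshold) {g : ℤ → ℂ}
    (hg : ComponentsConverge g) {z : ℂ} (hz : ‖z‖ ^ 2 ≤ 2 * m) (hM : ∀ N, lowMass N g ≤ 2 * m) :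
    ENNReal.ofReal (Real.exp (quarticLimit z g)) ≤ envelopeLimit m g := by
  have ht : Tendsto (fun j : ℕ => ENNReal.ofReal (Real.exp
      (quarticForm (2 ^ j) (coeffSeq (Function.update g 0 z))))) atTop
      (𝓝 (ENNReal.ofReal (Real.exp (quarticLimit z g)))) :=
    (ENNReal.continuous_ofReal.tendsto _).comp
      ((Real.continuous_exp.tendsto _).comp (hg.tendsto_quarticForm z))
  rw [← ht.liminf_eq]
  exact liminf_le_liminf (Eventually.of_forall fun j =>
    exp_quarticForm_le_envelope (hm'.trans massThreshold_le) _ g hz (hM _))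

/-! ### The random series in `L²` -/

instance secondCountableTopologyL2 : SecondCountableTopology L2 := by
  have : Fact ((2 : ℝ≥0∞) ≠ ∞) := ⟨by norm_num⟩
  infer_instance

/-- The coefficients of the random series are square summable. -/
def SquareSummable (g : ℤ → ℂ) : Prop := Summable fun n => ‖coeffSeq g n‖ ^ 2

theorem summable_congr_off {f f' : ℤ → ℝ} (k : ℤ) (h : ∀ n, n ≠ k → f n = f' n) :
    Summable f ↔ Summable f' := by
  refine summable_congr_cofinite ?_
  filter_upwards [(Set.finite_singleton k).compl_mem_cofinite] with n hn
  exact h n hn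

theorem coeffSeq_update_of_ne (g : ℤ → ℂ) {k n : ℤ} (h : n ≠ k) (z : ℂ) :
    coeffSeq (Function.update g k z) n = coeffSeq g n := by
  simp [coeffSeq, Function.update_of_ne h]

theorem squareSummable_update {g : ℤ → ℂ} (k : ℤ) (z : ℂ) :
    SquareSummable (Function.update g k z) ↔ SquareSummable g :=
  summable_congr_off k fun n hn => by rw [coeffSeq_update_of_ne g hn]

theorem measurable_coeffSeq_apply (n : ℤ) : Measurable fun g => coeffSeq g n :=
  (measurable_pi_apply n).comp measurable_coeffSeq

/-- The expectation is at most a multiple of ∑ ⟨n⟩^{2σ-2}, which is finite for σ < 1/2. The factor 4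
is the crude bound for E|gₙ|². -/
theorem ae_summable_bracket_mul {σ : ℝ} (hσ : σ < 1 / 2) :
    ∀ᵐ g ∂gaussianFamily, Summable fun n => bracket n ^ (2 * σ) * ‖coeffSeq g n‖ ^ 2 := by
  have hq : 1 < 2 - 2 * σ := by linarith
  have hfin : ∫⁻ g, ∑' n : ℤ, ENNReal.ofReal (bracket n ^ (2 * σ) * ‖coeffSeq g n‖ ^ 2)
      ∂gaussianFamily ≠ ∞ := by
    rw [lintegral_tsum fun n => Measurable.aemeasurable (by
      have := measurable_coeffSeq_apply n
      fun_prop)]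
    have hterm : ∀ n : ℤ, ∫⁻ g, ENNReal.ofReal (bracket n ^ (2 * σ) * ‖coeffSeq g n‖ ^ 2)
        ∂gaussianFamily ≤ ENNReal.ofReal (bracket n ^ (-(2 - 2 * σ)) * 4) := by
      intro n
      have hb : 0 ≤ bracket n ^ (-(2 - 2 * σ)) := Real.rpow_nonneg (bracket_pos n).le _
      simp_rw [bracket_rpow_mul_norm_coeffSeq_sq, ENNReal.ofReal_mul hb]
      rw [lintegral_const_mul _ (by fun_prop),
        lintegral_coordinate (gaussianFamily_resamples n)
          (φ := fun z => ENNReal.ofReal (‖z‖ ^ 2)) (by fun_prop)]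
      gcongr
      refine (le_of_eq ?_).trans ((lintegral_norm_pow_le 1).trans (le_of_eq ?_))
      · rfl
      · norm_num
    refine ne_top_of_le_ne_top ?_ (ENNReal.tsum_le_tsum hterm)
    exact ((summable_bracket_rpow hq).mul_right 4).tsum_ofReal_ne_top
  have hae := ae_lt_top (Measurable.tsum fun n => by
      have := measurable_coeffSeq_apply n
      fun_prop) hfin
  filter_upwards [hae] with g hg
  have := ENNReal.summable_toReal hg.ne
  refine this.congr fun n => ?_
  have hb : 0 ≤ bracket n ^ (2 * σ) := Real.rpow_nonneg (bracket_pos n).le _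
  rw [ENNReal.toReal_ofReal (by positivity)]

theorem ae_squareSummable : ∀ᵐ g ∂gaussianFamily, SquareSummable g := by
  filter_upwards [ae_summable_bracket_mul (σ := 0) (by norm_num)] with g hg
  simpa [SquareSummable] using hg

theorem coeffs_eq_repr (u : L2) (n : ℤ) : coeffs u n = fourierBasis.repr u n :=
  (fourierBasis_repr u n).symm

theorem coeffs_injective : Function.Injective coeffs := by
  intro u v h
  apply fourierBasis.repr.injective
  ext n
  rw [← coeffs_eq_repr, ← coeffs_eq_repr, h]

theorem continuous_coeffs : Continuous coeffs := by
  refine continuous_pi fun n => ?_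
  simp_rw [coeffs_eq_repr, HilbertBasis.repr_apply_apply]
  fun_prop

theorem coeffs_add (u v : L2) : coeffs (u + v) = coeffs u + coeffs v := by
  ext n
  simp only [Pi.add_apply, coeffs_eq_repr, map_add, lp.coeFn_add]

theorem coeffs_smul (c : ℂ) (u : L2) : coeffs (c • u) = c • coeffs u := by
  ext n
  simp only [Pi.smul_apply, coeffs_eq_repr, map_smul, lp.coeFn_smul]

theorem coeffs_fourierLp (k : ℤ) : coeffs (fourierLp 2 k) = Pi.single k 1 := by
  ext n
  have : (fourierLp 2 k : L2) = fourierBasis k := by rw [coe_fourierBasis]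
  rw [coeffs_eq_repr, this, HilbertBasis.repr_self, lp.single_apply]

theorem norm_sq_eq_tsum (u : L2) : ‖u‖ ^ 2 = ∑' n, ‖coeffs u n‖ ^ 2 := by
  have := lp.norm_rpow_eq_tsum (p := 2) (by norm_num) (fourierBasis.repr u)
  norm_num at this
  rw [this]
  simp_rw [coeffs_eq_repr]

theorem SquareSummable.memℓp {g : ℤ → ℂ} (hg : SquareSummable g) : Memℓp (coeffSeq g) 2 := by
  refine memℓp_gen ?_
  simpa [SquareSummable] using hg

theorem SquareSummable.hasSum {g : ℤ → ℂ} (hg : SquareSummable g) :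
    HasSum (fun n : ℤ => (g n / (bracket n : ℂ)) • (fourierLp 2 n : L2)) (randomSeries g) := by
  have h := HilbertBasis.hasSum_repr_symm (fourierBasis (T := 2 * π)) ⟨coeffSeq g, hg.memℓp⟩
  simp only [coe_fourierBasis] at h
  have e : (fun n : ℤ => (g n / (bracket n : ℂ)) • (fourierLp 2 n : L2)) =
    fun i => (⟨coeffSeq g, hg.memℓp⟩ : lp (fun _ : ℤ => ℂ) 2) i • fourierLp 2 i := rfl
  rw [randomSeries, e]
  exact h.summable.hasSum

theorem coeffs_randomSeries {g : ℤ → ℂ} (hg : SquareSummable g) :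
    coeffs (randomSeries g) = coeffSeq g := by
  have h := HilbertBasis.hasSum_repr_symm (fourierBasis (T := 2 * π)) ⟨coeffSeq g, hg.memℓp⟩
  simp only [coe_fourierBasis] at h
  have e := h.unique hg.hasSum
  ext n
  rw [coeffs_eq_repr, ← e, LinearIsometryEquiv.apply_symm_apply]

theorem norm_sq_randomSeries {g : ℤ → ℂ} (hg : SquareSummable g) :
    ‖randomSeries g‖ ^ 2 = ∑' n, ‖coeffSeq g n‖ ^ 2 := by
  rw [norm_sq_eq_tsum, coeffs_randomSeries hg]

/-- The partial sums of the random series. -/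
def partialSeries (N : ℕ) (g : ℤ → ℂ) : L2 := ∑ n ∈ modes N, coeffSeq g n • fourierLp 2 n

theorem measurable_partialSeries (N : ℕ) : Measurable (partialSeries N) := by
  refine Finset.measurable_fun_sum _ fun n _ => ?_
  exact (measurable_coeffSeq_apply n).smul_const _

theorem tendsto_modes : Tendsto modes atTop atTop := by
  refine tendsto_atTop_finset_of_monotone (fun _ _ h => modes_mono h) fun n => ?_
  refine ⟨n.natAbs, ?_⟩
  rw [mem_modes]
  omega

theorem SquareSummable.tendsto_partialSeries {g : ℤ → ℂ} (hg : SquareSummable g) :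
    Tendsto (fun N => partialSeries N g) atTop (𝓝 (randomSeries g)) :=
  hg.hasSum.comp tendsto_modes

theorem randomSeries_update {g : ℤ → ℂ} (hg : SquareSummable g) (k : ℤ) (z : ℂ) :
    randomSeries (Function.update g k z) =
      randomSeries (Function.update g k 0) + (z / (bracket k : ℂ)) • fourierLp 2 k := by
  apply coeffs_injective
  rw [coeffs_add, coeffs_smul, coeffs_fourierLp,
    coeffs_randomSeries ((squareSummable_update k z).mpr hg),
    coeffs_randomSeries ((squareSummable_update k 0).mpr hg)]
  ext n
  by_cases h : n = k
  · subst h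
    simp [coeffSeq]
  · simp [coeffSeq_update_of_ne g h, h]

/-- The Lusin–Souslin theorem for a continuous injection of a Polish space. A measure on L² is thus
determined by its image on sequences. -/
theorem measurableEmbedding_coeffs : MeasurableEmbedding coeffs :=
  continuous_coeffs.measurableEmbedding coeffs_injective

/-! ### The energy in terms of the Fourier coefficients -/

theorem truncation_sq (N : ℕ) (u : L2) (x : ℝ) :
    truncation N u x ^ 2 =
      ∑ k ∈ modes (2 * N), selfConv N (coeffs u) k * Complex.exp (Complex.I * k * x) := by
  have h : ∀ k ∈ modes (2 * N), selfConv N (coeffs u) k * Complex.exp (Complex.I * k * x) =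
      ∑ j ∈ modes N, coeffs u j * Complex.exp (Complex.I * j * x) *
        (cutoff N (coeffs u) (k - j) * Complex.exp (Complex.I * ((k - j : ℤ) : ℂ) * x)) := by
    intro k _
    rw [selfConv, Finset.sum_mul]
    refine Finset.sum_congr rfl fun j hj => ?_
    have : Complex.exp (Complex.I * k * x) = Complex.exp (Complex.I * j * x) *
        Complex.exp (Complex.I * ((k - j : ℤ) : ℂ) * x) := by
      rw [← Complex.exp_add]
      congr 1
      push_cast
      ring
    rw [this, cutoff_of_mem hj]
    ring
  rw [Finset.sum_congr rfl h, Finset.sum_comm, sq, truncation, Finset.sum_mul]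
  refine Finset.sum_congr rfl fun j hj => ?_
  rw [← Finset.mul_sum]
  congr 1
  have hj' := mem_modes.mp hj
  symm
  rw [← Finset.sum_subset (s₁ := (modes N).map (addLeftEmbedding j))]
  · rw [Finset.sum_map]
    refine Finset.sum_congr rfl fun n hn => ?_
    simp only [addLeftEmbedding_apply, add_sub_cancel_left]
    rw [cutoff_of_mem hn]
  · intro k hk
    simp only [Finset.mem_map, addLeftEmbedding_apply, mem_modes] at hk ⊢
    obtain ⟨n, hn, rfl⟩ := hk
    push_cast
    omega
  · intro k _ hk
    rw [cutoff_of_notMem, zero_mul]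
    intro hk'
    apply hk
    simp only [Finset.mem_map, addLeftEmbedding_apply]
    exact ⟨k - j, hk', by ring⟩

theorem integral_exp_int (k : ℤ) :
    ∫ x in (0 : ℝ)..(2 * π), Complex.exp (Complex.I * k * x) =
      if k = 0 then (2 * π : ℂ) else 0 := by
  split_ifs with h
  · subst h
    simp
  · have hc : Complex.I * (k : ℂ) ≠ 0 :=
      mul_ne_zero Complex.I_ne_zero (Int.cast_ne_zero.mpr h)
    rw [integral_exp_mul_complex hc]
    have : Complex.exp (Complex.I * k * ((2 * π : ℝ) : ℂ)) = 1 := by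
      rw [Complex.exp_eq_one_iff]
      exact ⟨k, by push_cast; ring⟩
    rw [this]
    simp

theorem hasDerivAt_truncation_sq (N : ℕ) (u : L2) (x : ℝ) :
    HasDerivAt (fun y : ℝ => truncation N u y ^ 2)
      (∑ k ∈ modes (2 * N), selfConv N (coeffs u) k *
        (Complex.exp (Complex.I * k * x) * (Complex.I * k))) x := by
  have e : (fun y : ℝ => truncation N u y ^ 2) = fun y : ℝ =>
      ∑ k ∈ modes (2 * N), selfConv N (coeffs u) k * Complex.exp (Complex.I * k * y) :=
    funext fun y => truncation_sq N u y
  rw [e]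
  refine HasDerivAt.fun_sum fun k _ => HasDerivAt.const_mul _ ?_
  refine HasDerivAt.cexp ?_
  simpa using (Complex.ofRealCLM.hasDerivAt (x := x)).const_mul (Complex.I * (k : ℂ))

theorem conj_exp_int (k : ℤ) (x : ℝ) :
    conj (Complex.exp (Complex.I * k * x)) = Complex.exp (Complex.I * ((-k : ℤ) : ℂ) * x) := by
  rw [← Complex.exp_conj]
  simp

/-- Parseval: in the double sum over frequencies only k = l survives. The derivative brings a factor
i, and -(3i/4) · i = 3/4, so the expression is real. -/
theorem energyTerm_eq (N : ℕ) (u : L2) : energyTerm N u = quarticForm N (coeffs u) := by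
  set b := selfConv N (coeffs u)
  have hintegral : ∀ x : ℝ, conj (truncation N u x) ^ 2 * deriv (fun y : ℝ => truncation N u y ^ 2) x =
      ∑ l ∈ modes (2 * N), ∑ k ∈ modes (2 * N), (conj (b l) * b k * (Complex.I * k)) *
        Complex.exp (Complex.I * ((k - l : ℤ) : ℂ) * x) := by
    intro x
    rw [(hasDerivAt_truncation_sq N u x).deriv, ← map_pow, truncation_sq, map_sum, Finset.sum_mul]
    refine Finset.sum_congr rfl fun l _ => ?_
    rw [Finset.mul_sum]
    refine Finset.sum_congr rfl fun k _ => ?_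
    rw [map_mul, conj_exp_int]
    have : Complex.exp (Complex.I * ((k - l : ℤ) : ℂ) * x) =
        Complex.exp (Complex.I * ((-l : ℤ) : ℂ) * x) * Complex.exp (Complex.I * k * x) := by
      rw [← Complex.exp_add]
      congr 1
      push_cast
      ring
    rw [this]
    ring
  have hcont : ∀ (c : ℂ) (k : ℤ), IntervalIntegrable
      (fun x : ℝ => c * Complex.exp (Complex.I * k * x)) volume 0 (2 * π) := fun c k =>
    Continuous.intervalIntegrable (by fun_prop) _ _
  have hI : ∫ x in (0 : ℝ)..(2 * π), conj (truncation N u x) ^ 2 *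
      deriv (fun y : ℝ => truncation N u y ^ 2) x =
      ∑ l ∈ modes (2 * N), (2 * π : ℂ) * Complex.I * ((l * ‖b l‖ ^ 2 : ℝ) : ℂ) := by
    simp_rw [hintegral]
    rw [intervalIntegral.integral_finsetSum fun l _ =>
      Continuous.intervalIntegrable (by fun_prop) _ _]
    refine Finset.sum_congr rfl fun l hl => ?_
    rw [intervalIntegral.integral_finsetSum fun k _ => hcont _ _]
    simp_rw [intervalIntegral.integral_const_mul, integral_exp_int, sub_eq_zero, mul_ite, mul_zero]
    rw [Finset.sum_ite_eq' _ l, if_pos hl]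
    have := Complex.conj_mul' (b l)
    rw [this]
    push_cast
    ring
  rw [energyTerm, hI, quarticForm, ← Finset.mul_sum, ← Complex.ofReal_sum]
  have hpi : (π : ℂ) ≠ 0 := Complex.ofReal_ne_zero.mpr Real.pi_ne_zero
  have e : -(3 * Complex.I / 4) * ((2 * π : ℝ) : ℂ)⁻¹ * (2 * (π : ℂ) * Complex.I *
      ((∑ l ∈ modes (2 * N), (l : ℝ) * ‖b l‖ ^ 2 : ℝ) : ℂ)) =
      ((3 / 4 * ∑ l ∈ modes (2 * N), (l : ℝ) * ‖b l‖ ^ 2 : ℝ) : ℂ) := by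
    push_cast
    field_simp
    rw [Complex.I_sq]
    ring
  rw [e, Complex.ofReal_re]

theorem measurable_energyTerm (N : ℕ) : Measurable (energyTerm N) := by
  have : energyTerm N = fun u => quarticForm N (coeffs u) := funext (energyTerm_eq N)
  rw [this]
  exact (measurable_quarticForm N).comp continuous_coeffs.measurable

theorem measurable_energyLimit : Measurable energyLimit :=
  (StronglyMeasurable.limUnder fun j =>
    (measurable_energyTerm (2 ^ j)).stronglyMeasurable).measurable

theorem energyTerm_randomSeries {g : ℤ → ℂ} (hg : SquareSummable g) (N : ℕ) :
    energyTerm N (randomSeries g) = quarticForm N (coeffSeq g) := by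
  rw [energyTerm_eq, coeffs_randomSeries hg]

theorem energyLimit_randomSeries {g : ℤ → ℂ} (hg : SquareSummable g) (hc : ComponentsConverge g)
    (z : ℂ) : energyLimit (randomSeries (Function.update g 0 z)) = quarticLimit z g := by
  have h : (fun j : ℕ => energyTerm (2 ^ j) (randomSeries (Function.update g 0 z))) =
      fun j : ℕ => quarticForm (2 ^ j) (coeffSeq (Function.update g 0 z)) :=
    funext fun j => energyTerm_randomSeries ((squareSummable_update 0 z).mpr hg) _
  rw [energyLimit, h]
  exact (hc.tendsto_quarticForm z).limUnder_eq

/-! ### The sixth power and the weight -/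

instance factOneLeSix : Fact ((1 : ℝ≥0∞) ≤ 6) := ⟨by norm_num⟩

/-- Fatou's lemma along an almost everywhere convergent subsequence. The sextic integral is
therefore lower semicontinuous on L², hence measurable. -/
theorem isClosed_sixthPower_le (c : ℝ≥0∞) : IsClosed {u : L2 | sixthPower u ≤ c} := by
  refine IsSeqClosed.isClosed fun v u hv hvu => ?_
  have hm := tendstoInMeasure_of_tendsto_Lp hvu
  obtain ⟨ns, -, hns⟩ := hm.exists_seq_tendsto_ae
  calc sixthPower u
      = ∫⁻ x, liminf (fun i => ‖v (ns i) x‖ₑ ^ 6) atTop ∂AddCircle.haarAddCircle := by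
        refine lintegral_congr_ae ?_
        filter_upwards [hns] with x hx
        exact (((ENNReal.continuous_pow 6).tendsto _).comp
          ((continuous_enorm.tendsto _).comp hx)).liminf_eq.symm
    _ ≤ liminf (fun i => sixthPower (v (ns i))) atTop := by
        refine lintegral_liminf_le' fun i => ?_
        exact ((Lp.stronglyMeasurable _).measurable.enorm.pow_const 6).aemeasurable
    _ ≤ liminf (fun _ : ℕ => c) atTop :=
        liminf_le_liminf (Eventually.of_forall fun i => hv (ns i))
    _ = c := liminf_const c

theorem lowerSemicontinuous_sixthPower : LowerSemicontinuous sixthPower :=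
  lowerSemicontinuous_iff_isClosed_preimage.mpr fun c => isClosed_sixthPower_le c

theorem measurable_sixthPower : Measurable sixthPower :=
  lowerSemicontinuous_sixthPower.measurable

theorem measurable_weight : Measurable weight := by
  unfold weight
  have h1 := measurable_sixthPower
  have h2 := measurable_energyLimit
  refine Measurable.ite (h1 (measurableSet_singleton ∞)) measurable_const ?_
  fun_prop

/-- The sextic term has the favourable sign and is discarded; integrability rests on f and small
mass alone. -/
theorem weight_le (u : L2) : weight u ≤ ENNReal.ofReal (Real.exp (energyLimit u)) := by
  unfold weight
  split_ifs
  · exact zero_le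
  · refine ENNReal.ofReal_le_ofReal (Real.exp_le_exp.mpr ?_)
    have := ENNReal.toReal_nonneg (a := sixthPower u)
    linarith

theorem sixthPower_eq_of_ae {u : L2} {w : Lp ℂ 6 (AddCircle.haarAddCircle : Measure Torus)}
    (h : (u : Torus → ℂ) =ᵐ[AddCircle.haarAddCircle] w) :
    sixthPower u = ENNReal.ofReal (‖w‖ ^ 6) := by
  have e : sixthPower u = eLpNorm w 6 AddCircle.haarAddCircle ^ 6 := by
    rw [eLpNorm_eq_lintegral_rpow_enorm_toReal (by norm_num) (by norm_num), ← ENNReal.rpow_natCast,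
      ← ENNReal.rpow_mul]
    norm_num
    refine lintegral_congr_ae ?_
    filter_upwards [h] with x hx
    rw [hx]
  rw [e, Lp.norm_def, ENNReal.ofReal_pow ENNReal.toReal_nonneg,
    ENNReal.ofReal_toReal (Lp.eLpNorm_ne_top w)]

/-- The sextic integral is not continuous on L², but along the line of constants through a function
in L⁶ it is a power of an L⁶ norm, hence continuous in z. -/
theorem exists_sixthPower_add_eq {v : L2} (hv : sixthPower v ≠ ∞) :
    ∃ w : Lp ℂ 6 (AddCircle.haarAddCircle : Measure Torus), ∀ z : ℂ,
      sixthPower (v + z • fourierLp 2 0) = ENNReal.ofReal (‖w + z • fourierLp 6 0‖ ^ 6) := by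
  have hmem : MemLp v 6 (AddCircle.haarAddCircle : Measure Torus) := by
    refine ⟨Lp.aestronglyMeasurable v, ?_⟩
    rw [eLpNorm_eq_lintegral_rpow_enorm_toReal (by norm_num) (by norm_num)]
    refine ENNReal.rpow_lt_top_of_nonneg (by positivity) ?_
    norm_num
    exact hv
  refine ⟨hmem.toLp, fun z => sixthPower_eq_of_ae ?_⟩
  filter_upwards [Lp.coeFn_add v (z • fourierLp 2 0), Lp.coeFn_smul z (fourierLp 2 0 : L2),
    coeFn_fourierLp (T := 2 * π) 2 0, hmem.coeFn_toLp,
    Lp.coeFn_add hmem.toLp (z • fourierLp 6 0),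
    Lp.coeFn_smul z (fourierLp 6 0 : Lp ℂ 6 (AddCircle.haarAddCircle : Measure Torus)),
    coeFn_fourierLp (T := 2 * π) 6 0] with x h1 h2 h3 h4 h5 h6 h7
  rw [h1, h5, Pi.add_apply, Pi.add_apply, h2, h6, h4, Pi.smul_apply, Pi.smul_apply, h3, h7]

theorem sixthPower_add_ne_top {v : L2} (hv : sixthPower v ≠ ∞) (z : ℂ) :
    sixthPower (v + z • fourierLp 2 0) ≠ ∞ := by
  obtain ⟨w, hw⟩ := exists_sixthPower_add_eq hv
  rw [hw]
  exact ENNReal.ofReal_ne_top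

theorem sixthPower_partialSeries (N : ℕ) (g : ℤ → ℂ) :
    sixthPower (partialSeries N g) =
      ∫⁻ x, ‖∑ n ∈ modes N, coeffSeq g n * fourier n x‖ₑ ^ 6
        ∂(AddCircle.haarAddCircle : Measure Torus) := by
  have e : partialSeries N g =
      ContinuousMap.toLp (E := ℂ) 2 (AddCircle.haarAddCircle : Measure Torus) ℂ
        (∑ n ∈ modes N, coeffSeq g n • fourier n) := by
    rw [map_sum]
    simp_rw [map_smul]
    rfl
  rw [sixthPower, e]
  refine lintegral_congr_ae ?_
  filter_upwards [ContinuousMap.coeFn_toLp (p := 2) (𝕜 := ℂ)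
    (AddCircle.haarAddCircle : Measure Torus)
    (∑ n ∈ modes N, coeffSeq g n • fourier n)] with x hx
  rw [hx]
  simp

theorem norm_pow_six_le (z : ℂ) :
    ‖z‖ ^ 6 ≤ 2880 * (Real.exp z.re + Real.exp (-z.re) + Real.exp z.im + Real.exp (-z.im)) := by
  have h : ∀ a : ℝ, a ^ 6 ≤ 720 * (Real.exp a + Real.exp (-a)) := by
    intro a
    have h1 := Real.pow_div_factorial_le_exp |a| (abs_nonneg a) 6
    have h2 : Real.exp |a| ≤ Real.exp a + Real.exp (-a) := by
      rcases abs_cases a with ⟨h, _⟩ | ⟨h, _⟩ <;> rw [h]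
      · linarith [Real.exp_pos (-a)]
      · linarith [Real.exp_pos a]
    have h3 : |a| ^ 6 = a ^ 6 := by rw [Even.pow_abs (by decide)]
    rw [h3] at h1
    norm_num [Nat.factorial] at h1
    linarith
  have e : ‖z‖ ^ 6 = (z.re ^ 2 + z.im ^ 2) ^ 3 := by
    rw [show (6 : ℕ) = 2 * 3 from rfl, pow_mul, Complex.sq_norm, Complex.normSq_apply]
    ring
  have h1 := h z.re
  have h2 := h z.im
  have h3 : (z.re ^ 2 + z.im ^ 2) ^ 3 ≤ 4 * (z.re ^ 6 + z.im ^ 6) := by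
    nlinarith [mul_nonneg (add_nonneg (sq_nonneg z.re) (sq_nonneg z.im))
      (sq_nonneg (z.re ^ 2 - z.im ^ 2))]
  rw [e]
  linarith

theorem lintegral_exp_re_sum (N : ℕ) (c : ℂ) (hc : ‖c‖ = 1) (x : Torus) :
    ∫⁻ g, ENNReal.ofReal (Real.exp (((∑ n ∈ modes N, coeffSeq g n * fourier n x) * c).re))
      ∂gaussianFamily ≤ ENNReal.ofReal (Real.exp (∑' n : ℤ, bracket n ^ (-(2 : ℝ)))) := by
  have e : ∀ g : ℤ → ℂ,
      ENNReal.ofReal (Real.exp (((∑ n ∈ modes N, coeffSeq g n * fourier n x) * c).re)) =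
      ∏ n ∈ modes N,
        ENNReal.ofReal (Real.exp ((g n * (fourier n x * c / (bracket n : ℂ))).re)) := by
    intro g
    rw [← ENNReal.ofReal_prod_of_nonneg fun n _ => (Real.exp_pos _).le, ← Real.exp_sum,
      Finset.sum_mul, Complex.re_sum]
    congr 2
    refine Finset.sum_congr rfl fun n _ => ?_
    congr 1
    rw [coeffSeq]
    ring
  simp_rw [e]
  rw [lintegral_prod_coordinates (modes N) (fun n _ => gaussianFamily_resamples n)
    (fun n z => ENNReal.ofReal (Real.exp ((z * (fourier n x * c / (bracket n : ℂ))).re)))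
    fun n => by fun_prop]
  simp_rw [lintegral_exp_re_mul]
  rw [← ENNReal.ofReal_prod_of_nonneg fun n _ => (Real.exp_pos _).le, ← Real.exp_sum]
  refine ENNReal.ofReal_le_ofReal (Real.exp_le_exp.mpr ?_)
  refine le_trans (Finset.sum_le_sum fun n _ => ?_) ((summable_bracket_rpow (q := 2)
    (by norm_num)).sum_le_tsum (modes N) fun n _ => Real.rpow_nonneg (bracket_pos n).le _)
  have hb := bracket_pos n
  have hn : ‖fourier n x * c / (bracket n : ℂ)‖ = (bracket n)⁻¹ := by
    rw [norm_div, norm_mul, hc, Complex.norm_real, Real.norm_of_nonneg hb.le, fourier_apply,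
      Circle.norm_coe]
    ring
  rw [hn, Real.rpow_neg hb.le, Real.rpow_two, inv_pow]
  have : 0 < (bracket n ^ 2)⁻¹ := by positivity
  linarith

/-- At each point x the partial sum is a complex Gaussian whose variance is bounded uniformly in x
and N. Exponential moments in the directions ±1 and ±i bound its sixth moment, and Tonelli's theorem
does the rest. -/
theorem exists_lintegral_sixthPower_le : ∃ C : ℝ≥0∞, C ≠ ∞ ∧ ∀ N : ℕ,
    ∫⁻ g, sixthPower (partialSeries N g) ∂gaussianFamily ≤ C := by
  set E := ENNReal.ofReal (Real.exp (∑' n : ℤ, bracket n ^ (-(2 : ℝ))))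
  refine ⟨ENNReal.ofReal 2880 * (E + E + E + E), ?_, fun N => ?_⟩
  · refine ENNReal.mul_ne_top ENNReal.ofReal_ne_top ?_
    simp [E]
  simp_rw [sixthPower_partialSeries]
  set S : (ℤ → ℂ) → Torus → ℂ := fun g x => ∑ n ∈ modes N, coeffSeq g n * fourier n x with hS
  have hSm : Measurable (Function.uncurry S) := by
    refine Finset.measurable_fun_sum _ fun n _ => ?_
    exact ((measurable_coeffSeq_apply n).comp measurable_fst).mul
      ((fourier n).continuous.measurable.comp measurable_snd)
  rw [lintegral_lintegral_swap ((hSm.enorm.pow_const 6).aemeasurable)]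
  have hbound : ∀ x : Torus, ∫⁻ g, ‖S g x‖ₑ ^ 6 ∂gaussianFamily ≤
      ENNReal.ofReal 2880 * (E + E + E + E) := by
    intro x
    have hSx : Measurable fun g => S g x := hSm.comp (measurable_id.prodMk measurable_const)
    have hpt : ∀ g, ‖S g x‖ₑ ^ 6 ≤ ENNReal.ofReal 2880 *
        (ENNReal.ofReal (Real.exp ((S g x * 1).re)) + ENNReal.ofReal (Real.exp ((S g x * (-1)).re)) +
          ENNReal.ofReal (Real.exp ((S g x * (-Complex.I)).re)) +
          ENNReal.ofReal (Real.exp ((S g x * Complex.I).re))) := by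
      intro g
      have hp := fun r : ℝ => (Real.exp_pos r).le
      rw [← ENNReal.ofReal_add (hp _) (hp _), ← ENNReal.ofReal_add (add_nonneg (hp _) (hp _)) (hp _),
        ← ENNReal.ofReal_add (add_nonneg (add_nonneg (hp _) (hp _)) (hp _)) (hp _),
        ← ENNReal.ofReal_mul (by norm_num), ← ofReal_norm,
        ← ENNReal.ofReal_pow (norm_nonneg _)]
      refine ENNReal.ofReal_le_ofReal ((norm_pow_six_le _).trans (le_of_eq ?_))
      simp
    refine (lintegral_mono hpt).trans ?_
    rw [lintegral_const_mul _ (by fun_prop), lintegral_add_left (by fun_prop),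
      lintegral_add_left (by fun_prop), lintegral_add_left (by fun_prop)]
    gcongr <;> exact lintegral_exp_re_sum N _ (by simp) x
  refine (lintegral_mono hbound).trans ?_
  rw [lintegral_const, measure_univ, mul_one]

theorem ae_sixthPower_ne_top : ∀ᵐ g ∂gaussianFamily, sixthPower (randomSeries g) ≠ ∞ := by
  obtain ⟨C, hC, h⟩ := exists_lintegral_sixthPower_le
  have hm : ∀ N, Measurable fun g => sixthPower (partialSeries N g) := fun N =>
    measurable_sixthPower.comp (measurable_partialSeries N)
  have hfin : ∫⁻ g, liminf (fun N => sixthPower (partialSeries N g)) atTop ∂gaussianFamily ≠ ∞ := by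
    refine ne_top_of_le_ne_top hC ((lintegral_liminf_le hm).trans ?_)
    refine (liminf_le_liminf (Eventually.of_forall h)).trans (le_of_eq (liminf_const C))
  filter_upwards [ae_lt_top (Measurable.liminf hm) hfin, ae_squareSummable] with g hg hs
  refine ne_top_of_le_ne_top hg.ne ?_
  exact (lowerSemicontinuous_sixthPower.le_liminf _).trans
    (hs.tendsto_partialSeries.liminf_le_liminf_comp)

/-- The properties of almost all `g` that make the weight a continuous function of the zero
mode. -/
structure IsRegular (g : ℤ → ℂ) : Prop where
  squareSummable : SquareSummable g
  componentsConverge : ComponentsConverge g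
  sixthPower_ne_top : sixthPower (randomSeries (Function.update g 0 0)) ≠ ∞

theorem randomSeries_update_zero {g : ℤ → ℂ} (hg : SquareSummable g) (z : ℂ) :
    randomSeries (Function.update g 0 z) =
      randomSeries (Function.update g 0 0) + z • fourierLp 2 0 := by
  rw [randomSeries_update hg 0 z, bracket_zero]
  simp

theorem ae_isRegular : ∀ᵐ g ∂gaussianFamily, IsRegular g := by
  filter_upwards [ae_squareSummable, ae_componentsConverge, ae_sixthPower_ne_top] with g h1 h2 h3
  refine ⟨h1, h2, ?_⟩
  have e : randomSeries (Function.update g 0 0) = randomSeries g + (-g 0) • fourierLp 2 0 := by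
    have := randomSeries_update_zero h1 (g 0)
    rw [Function.update_eq_self] at this
    rw [this, add_assoc, ← add_smul]
    simp
  rw [e]
  exact sixthPower_add_ne_top h3 _

theorem IsRegular.weight_eq {g : ℤ → ℂ} (hg : IsRegular g) :
    ∃ w : Lp ℂ 6 (AddCircle.haarAddCircle : Measure Torus), ∀ z : ℂ,
      weight (randomSeries (Function.update g 0 z)) =
        ENNReal.ofReal (Real.exp (quarticLimit z g - ‖w + z • fourierLp 6 0‖ ^ 6 / 2)) := by
  obtain ⟨w, hw⟩ := exists_sixthPower_add_eq hg.sixthPower_ne_top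
  refine ⟨w, fun z => ?_⟩
  have h6 : sixthPower (randomSeries (Function.update g 0 z)) =
      ENNReal.ofReal (‖w + z • fourierLp 6 0‖ ^ 6) := by
    rw [randomSeries_update_zero hg.squareSummable, hw]
  rw [weight, if_neg (by rw [h6]; exact ENNReal.ofReal_ne_top), h6,
    ENNReal.toReal_ofReal (by positivity),
    energyLimit_randomSeries hg.squareSummable hg.componentsConverge]

theorem IsRegular.continuous_weight {g : ℤ → ℂ} (hg : IsRegular g) :
    Continuous fun z => weight (randomSeries (Function.update g 0 z)) := by
  obtain ⟨w, hw⟩ := hg.weight_eq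
  simp_rw [hw]
  have := continuous_quarticLimit g
  exact ENNReal.continuous_ofReal.comp (by fun_prop)

theorem IsRegular.weight_pos {g : ℤ → ℂ} (hg : IsRegular g) (z : ℂ) :
    0 < weight (randomSeries (Function.update g 0 z)) := by
  obtain ⟨w, hw⟩ := hg.weight_eq
  rw [hw]
  exact ENNReal.ofReal_pos.mpr (Real.exp_pos _)

/-! ### Sobolev spaces -/

theorem isometry_toEll2 (σ : ℝ) : Isometry (Sobolev.toEll2 σ) :=
  AddMonoidHomClass.isometry_of_norm _ fun _ => rfl

theorem bracket_rpow_ne_zero (σ : ℝ) (n : ℤ) : ((bracket n ^ σ : ℝ) : ℂ) ≠ 0 :=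
  Complex.ofReal_ne_zero.mpr (Real.rpow_pos_of_pos (bracket_pos n) σ).ne'

theorem surjective_toEll2 (σ : ℝ) : Function.Surjective (Sobolev.toEll2 σ) := by
  intro a
  have e : (fun n => ((bracket n ^ σ : ℝ) : ℂ) * (((bracket n ^ σ : ℝ) : ℂ)⁻¹ * a n)) = a := by
    ext n
    rw [mul_inv_cancel_left₀ (bracket_rpow_ne_zero σ n)]
  have hmem : (fun n => ((bracket n ^ σ : ℝ) : ℂ)⁻¹ * a n) ∈ sobolevSubmodule σ := by
    change Memℓp (fun n => ((bracket n ^ σ : ℝ) : ℂ) * (((bracket n ^ σ : ℝ) : ℂ)⁻¹ * a n)) 2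
    rw [e]
    exact lp.memℓp a
  refine ⟨⟨_, hmem⟩, ?_⟩
  ext n
  exact congrFun e n

/-- `H^σ` is isometric to `ℓ²`. -/
def sobolevIsometryEquiv (σ : ℝ) : Sobolev σ ≃ᵢ lp (fun _ : ℤ => ℂ) 2 :=
  IsometryEquiv.mk' (Sobolev.toEll2 σ) (Function.surjInv (surjective_toEll2 σ))
    (Function.surjInv_eq (surjective_toEll2 σ)) (isometry_toEll2 σ)

instance secondCountableTopologySobolev (σ : ℝ) : SecondCountableTopology (Sobolev σ) :=
  ((sobolevIsometryEquiv σ).toHomeomorph.trans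
    (fourierBasis (T := 2 * π)).repr.toHomeomorph.symm).secondCountableTopology

instance completeSpaceSobolev (σ : ℝ) : CompleteSpace (Sobolev σ) :=
  (sobolevIsometryEquiv σ).completeSpace

theorem continuous_sobolev_coeffs (σ : ℝ) : Continuous (Sobolev.coeffs (σ := σ)) := by
  refine continuous_pi fun n => ?_
  have e : (fun u : Sobolev σ => u.coeffs n) =
      fun u => ((bracket n ^ σ : ℝ) : ℂ)⁻¹ * Sobolev.toEll2 σ u n := by
    ext u
    exact (inv_mul_cancel_left₀ (bracket_rpow_ne_zero σ n) _).symm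
  rw [e]
  refine continuous_const.mul ?_
  have h1 := (isometry_toEll2 σ).continuous
  have h2 : Continuous fun a : lp (fun _ : ℤ => ℂ) 2 => a n :=
    (lp.evalCLM ℂ (fun _ : ℤ => ℂ) 2 n).continuous
  exact h2.comp h1

theorem injective_sobolev_coeffs (σ : ℝ) : Function.Injective (Sobolev.coeffs (σ := σ)) :=
  Subtype.val_injective

theorem measurableEmbedding_sobolev_coeffs (σ : ℝ) :
    MeasurableEmbedding (Sobolev.coeffs (σ := σ)) :=
  (continuous_sobolev_coeffs σ).measurableEmbedding (injective_sobolev_coeffs σ)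

/-- The element of `H^σ` with the given Fourier coefficients. -/
def Sobolev.mk {σ : ℝ} (a : ℤ → ℂ) (h : a ∈ sobolevSubmodule σ) : Sobolev σ := ⟨a, h⟩

open Classical in
/-- An element of `L²` as an element of `H^σ`, or `0` if it does not belong to `H^σ`. -/
def toSobolev (σ : ℝ) (u : L2) : Sobolev σ :=
  if h : coeffs u ∈ sobolevSubmodule σ then Sobolev.mk (coeffs u) h else 0

theorem toSobolev_coeffs {σ : ℝ} {u : L2} (h : coeffs u ∈ sobolevSubmodule σ) :
    (toSobolev σ u).coeffs = coeffs u := by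
  rw [toSobolev, dif_pos h]
  rfl

theorem mem_image_coeffs_iff {σ : ℝ} {u : L2} (h : coeffs u ∈ sobolevSubmodule σ)
    (E : Set (Sobolev σ)) : coeffs u ∈ Sobolev.coeffs '' E ↔ toSobolev σ u ∈ E := by
  rw [← toSobolev_coeffs h, (injective_sobolev_coeffs σ).mem_set_image]

theorem coeffs_mem_range_iff {σ : ℝ} {u : L2} :
    coeffs u ∈ Set.range (Sobolev.coeffs (σ := σ)) ↔ coeffs u ∈ sobolevSubmodule σ := by
  constructor
  · rintro ⟨v, hv⟩
    rw [← hv]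
    exact v.2
  · exact fun h => ⟨toSobolev σ u, toSobolev_coeffs h⟩

theorem measurableSet_mem_sobolev (σ : ℝ) :
    MeasurableSet {u : L2 | coeffs u ∈ sobolevSubmodule σ} := by
  have := continuous_coeffs.measurable (measurableEmbedding_sobolev_coeffs σ).measurableSet_range
  convert this using 1
  ext u
  exact coeffs_mem_range_iff.symm

theorem measurable_toSobolev (σ : ℝ) : Measurable (toSobolev σ) := by
  intro E hE
  have h1 : MeasurableSet (coeffs ⁻¹' (Sobolev.coeffs '' E)) :=
    continuous_coeffs.measurable ((measurableEmbedding_sobolev_coeffs σ).measurableSet_image.mpr hE)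
  have hS := measurableSet_mem_sobolev σ
  have e : toSobolev σ ⁻¹' E = ({u | coeffs u ∈ sobolevSubmodule σ} ∩
      coeffs ⁻¹' (Sobolev.coeffs '' E)) ∪
      ({u | coeffs u ∈ sobolevSubmodule σ}ᶜ ∩ {_u | (0 : Sobolev σ) ∈ E}) := by
    ext u
    by_cases h : coeffs u ∈ sobolevSubmodule σ
    · simp only [Set.mem_preimage, Set.mem_union, Set.mem_inter_iff, Set.mem_ofPred_eq, h,
        true_and, Set.mem_compl_iff, not_true, false_and, or_false]
      exact (mem_image_coeffs_iff h E).symm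
    · simp [h, toSobolev]
  rw [e]
  exact (hS.inter h1).union (hS.compl.inter (MeasurableSet.const _))

/-- Replaces the comap by an image measure, along which integrals transform. -/
theorem onSobolev_eq_map {σ : ℝ} {ν : Measure L2} (h : ∀ᵐ u ∂ν, coeffs u ∈ sobolevSubmodule σ) :
    onSobolev σ ν = ν.map (toSobolev σ) := by
  ext E hE
  rw [onSobolev, (measurableEmbedding_sobolev_coeffs σ).comap_apply,
    Measure.map_apply continuous_coeffs.measurable
      ((measurableEmbedding_sobolev_coeffs σ).measurableSet_image.mpr hE),
    Measure.map_apply (measurable_toSobolev σ) hE]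
  refine measure_congr ?_
  filter_upwards [h] with u hu
  exact propext (mem_image_coeffs_iff hu E)

/-- The random series belongs to `H^σ`. -/
def SobolevSummable (σ : ℝ) (g : ℤ → ℂ) : Prop :=
  Summable fun n => bracket n ^ (2 * σ) * ‖coeffSeq g n‖ ^ 2

theorem sobolevSummable_update {σ : ℝ} {g : ℤ → ℂ} (k : ℤ) (z : ℂ) :
    SobolevSummable σ (Function.update g k z) ↔ SobolevSummable σ g :=
  summable_congr_off k fun n hn => by rw [coeffSeq_update_of_ne g hn]

theorem SobolevSummable.mem {σ : ℝ} {g : ℤ → ℂ} (h : SobolevSummable σ g) :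
    coeffSeq g ∈ sobolevSubmodule σ := by
  refine memℓp_gen ?_
  refine Summable.congr h fun n => ?_
  have hb := bracket_pos n
  rw [norm_mul, Complex.norm_real, Real.norm_of_nonneg (Real.rpow_nonneg hb.le _)]
  norm_num
  rw [mul_pow, ← Real.rpow_natCast (bracket n ^ σ), ← Real.rpow_mul hb.le, mul_comm σ]
  norm_num

theorem coeffs_randomSeries_mem {σ : ℝ} {g : ℤ → ℂ} (hs : SquareSummable g)
    (h : SobolevSummable σ g) : coeffs (randomSeries g) ∈ sobolevSubmodule σ := by
  rw [coeffs_randomSeries hs]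
  exact h.mem

theorem continuous_toSobolev_randomSeries {σ : ℝ} {g : ℤ → ℂ} (hs : SquareSummable g)
    (h : SobolevSummable σ g) :
    Continuous fun z => toSobolev σ (randomSeries (Function.update g 0 z)) := by
  have hmem : ∀ z, coeffs (randomSeries (Function.update g 0 z)) ∈ sobolevSubmodule σ := fun z =>
    coeffs_randomSeries_mem ((squareSummable_update 0 z).mpr hs)
      ((sobolevSummable_update 0 z).mpr h)
  rw [(isometry_toEll2 σ).isUniformInducing.isInducing.continuous_iff]
  have e : (Sobolev.toEll2 σ ∘ fun z => toSobolev σ (randomSeries (Function.update g 0 z))) =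
      fun z => Sobolev.toEll2 σ (toSobolev σ (randomSeries (Function.update g 0 0))) +
        z • lp.single 2 (0 : ℤ) (1 : ℂ) := by
    ext z n
    have hz : ∀ z, Sobolev.toEll2 σ (toSobolev σ (randomSeries (Function.update g 0 z))) n =
        ((bracket n ^ σ : ℝ) : ℂ) * coeffs (randomSeries (Function.update g 0 z)) n := fun z => by
      rw [← toSobolev_coeffs (hmem z)]
      rfl
    rw [Function.comp_apply, hz, lp.coeFn_add, Pi.add_apply, hz, randomSeries_update_zero hs z,
      coeffs_add, coeffs_smul, coeffs_fourierLp, lp.coeFn_smul]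
    by_cases hn : n = 0
    · subst hn
      simp [bracket_zero, mul_add]
    · simp [hn]
  rw [e]
  fun_prop

/-! ### The mass -/

/-- The mass of the random series without the modes in `s`. -/
def offMass (s : Finset ℤ) (g : ℤ → ℂ) : ℝ≥0∞ :=
  ∑' n, if n ∈ s then 0 else ENNReal.ofReal (‖coeffSeq g n‖ ^ 2)

theorem measurable_offMass (s : Finset ℤ) : Measurable (offMass s) := by
  refine Measurable.tsum fun n => ?_
  have := measurable_coeffSeq_apply n
  split_ifs <;> fun_prop

theorem offMass_update_of_mem {s : Finset ℤ} {k : ℤ} (hk : k ∈ s) (g : ℤ → ℂ) (z : ℂ) :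
    offMass s (Function.update g k z) = offMass s g := by
  refine tsum_congr fun n => ?_
  by_cases hn : n = k
  · subst hn
    simp [hk]
  · rw [coeffSeq_update_of_ne g hn]

theorem offMass_eq_add {s : Finset ℤ} {j : ℤ} (hj : j ∉ s) (g : ℤ → ℂ) :
    offMass s g = ENNReal.ofReal (‖coeffSeq g j‖ ^ 2) + offMass (insert j s) g := by
  rw [offMass, ENNReal.tsum_eq_add_tsum_ite j, if_neg hj, offMass]
  congr 1
  refine tsum_congr fun n => ?_
  by_cases hn : n = j <;> simp [hn]

theorem squareSummable_iff (g : ℤ → ℂ) : SquareSummable g ↔ offMass ∅ g ≠ ∞ := by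
  simp only [offMass, Finset.notMem_empty, if_false]
  constructor
  · exact fun h => Summable.tsum_ofReal_ne_top h
  · intro h
    refine (ENNReal.summable_toReal h).congr fun n => ?_
    rw [ENNReal.toReal_ofReal (by positivity)]

theorem offMass_ne_top {g : ℤ → ℂ} (hg : SquareSummable g) (s : Finset ℤ) : offMass s g ≠ ∞ := by
  refine ne_top_of_le_ne_top ((squareSummable_iff g).mp hg) (ENNReal.tsum_le_tsum fun n => ?_)
  by_cases hn : n ∈ s <;> simp [hn]

theorem norm_sq_randomSeries_eq {g : ℤ → ℂ} (hg : SquareSummable g) :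
    ‖randomSeries g‖ ^ 2 = (offMass ∅ g).toReal := by
  rw [norm_sq_randomSeries hg, offMass]
  simp only [Finset.notMem_empty, if_false]
  rw [ENNReal.tsum_toReal_eq fun n => ENNReal.ofReal_ne_top]
  exact tsum_congr fun n => (ENNReal.toReal_ofReal (by positivity)).symm

theorem squareSummable_of_summable {g : ℤ → ℂ}
    (h : Summable fun n : ℤ => (g n / (bracket n : ℂ)) • (fourierLp 2 n : L2)) :
    SquareSummable g := by
  obtain ⟨u, hu⟩ := h
  have hc : coeffs u = coeffSeq g := by
    ext k
    have h1 : HasSum (fun n : ℤ => coeffs ((g n / (bracket n : ℂ)) • (fourierLp 2 n : L2)) k)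
        (coeffs u k) := by
      simp_rw [coeffs_eq_repr, HilbertBasis.repr_apply_apply]
      exact hu.mapL (innerSL ℂ (fourierBasis k : L2))
    refine h1.unique ?_
    have e : (fun n : ℤ => coeffs ((g n / (bracket n : ℂ)) • (fourierLp 2 n : L2)) k) =
        fun n : ℤ => if n = k then coeffSeq g k else 0 := by
      ext n
      rw [coeffs_smul, coeffs_fourierLp]
      by_cases hn : n = k
      · subst hn
        simp [coeffSeq]
      · simp [hn, Ne.symm hn]
    rw [e]
    exact hasSum_ite_eq k _
  rw [SquareSummable, ← hc]
  exact (hasSum_sq_fourierCoeff u).summable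

theorem measurableSet_squareSummable : MeasurableSet {g | SquareSummable g} := by
  simp_rw [squareSummable_iff]
  exact (measurable_offMass ∅ (measurableSet_singleton ∞)).compl

/-- Where the coefficients are not square summable the series has the default value 0, so the map is
a limit of partial sums on a measurable set and constant off it. -/
theorem measurable_randomSeries : Measurable randomSeries := by
  classical
  have e : randomSeries = fun g => if SquareSummable g then
      limUnder atTop (fun N => partialSeries N g) else 0 := by
    ext1 g
    split_ifs with h
    · exact h.tendsto_partialSeries.limUnder_eq.symm
    · exact tsum_eq_zero_of_not_summable fun h' => h (squareSummable_of_summable h')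
  rw [e]
  exact Measurable.ite measurableSet_squareSummable
    (StronglyMeasurable.limUnder fun N => (measurable_partialSeries N).stronglyMeasurable).measurable
    measurable_const

/-- The mass of the random series without the mode `k`. -/
def massOff (k : ℤ) (g : ℤ → ℂ) : ℝ := (offMass {k} g).toReal

theorem measurable_massOff (k : ℤ) : Measurable (massOff k) :=
  (measurable_offMass {k}).ennreal_toReal

theorem massOff_nonneg (k : ℤ) (g : ℤ → ℂ) : 0 ≤ massOff k g := ENNReal.toReal_nonneg

theorem norm_sq_randomSeries_update {g : ℤ → ℂ} (hg : SquareSummable g) (k : ℤ) (z : ℂ) :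
    ‖randomSeries (Function.update g k z)‖ ^ 2 = massOff k g + ‖z‖ ^ 2 / bracket k ^ 2 := by
  rw [norm_sq_randomSeries_eq ((squareSummable_update k z).mpr hg),
    offMass_eq_add (Finset.notMem_empty k), insert_empty_eq,
    offMass_update_of_mem (Finset.mem_singleton_self k),
    ENNReal.toReal_add ENNReal.ofReal_ne_top (offMass_ne_top hg _),
    ENNReal.toReal_ofReal (by positivity), norm_coeffSeq_sq, Function.update_self, massOff]
  ring

/-- Resampling another mode, k+1, shows it: given the rest, the mass is an affine function of an
exponentially distributed variable, which has no atoms. -/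
theorem gaussianFamily_massOff_eq (k : ℤ) (m : ℝ) : gaussianFamily {g | massOff k g = m} = 0 := by
  have hk : k + 1 ∉ ({k} : Finset ℤ) := by simp
  have hms : MeasurableSet {g | massOff k g = m} := measurable_massOff k (measurableSet_singleton m)
  rw [← lintegral_indicator_one hms, gaussianFamily_resamples (k + 1)
    (Set.indicator {g | massOff k g = m} 1) (measurable_one.indicator hms)]
  rw [lintegral_eq_zero_iff' ]
  · filter_upwards [ae_squareSummable] with g hg
    have hb : 0 < bracket (k + 1) := bracket_pos _
    set c := (offMass (insert (k + 1) {k}) g).toReal with hc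
    have e : ∀ z, Set.indicator {g | massOff k g = m} (1 : (ℤ → ℂ) → ℝ≥0∞)
        (Function.update g (k + 1) z) =
        Set.indicator {bracket (k + 1) ^ 2 * (m - c)} 1 (‖z‖ ^ 2) := by
      intro z
      have h1 : massOff k (Function.update g (k + 1) z) = ‖z‖ ^ 2 / bracket (k + 1) ^ 2 + c := by
        rw [massOff, offMass_eq_add hk, offMass_update_of_mem (Finset.mem_insert_self _ _),
          ENNReal.toReal_add ENNReal.ofReal_ne_top (offMass_ne_top hg _),
          ENNReal.toReal_ofReal (by positivity), norm_coeffSeq_sq, Function.update_self]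
        ring
      have h2 : massOff k (Function.update g (k + 1) z) = m ↔
          ‖z‖ ^ 2 = bracket (k + 1) ^ 2 * (m - c) := by
        rw [h1, ← eq_sub_iff_add_eq, div_eq_iff (by positivity), mul_comm]
      simp only [Set.indicator_apply, Set.mem_ofPred_eq, h2, Pi.one_apply,
        Set.mem_singleton_iff]
    simp_rw [e]
    rw [lintegral_complexGaussian_radial _
      (measurable_one.indicator (measurableSet_singleton _))]
    rw [Pi.zero_apply, lintegral_eq_zero_iff' ]
    · refine ae_restrict_of_ae ?_
      have : ∀ᵐ t : ℝ, t ≠ bracket (k + 1) ^ 2 * (m - c) := by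
        simp [ae_iff]
      filter_upwards [this] with t ht
      simp [ht]
    · refine Measurable.aemeasurable (Measurable.mul (by fun_prop) ?_)
      exact measurable_one.indicator (measurableSet_singleton _)
  · exact (measurable_lintegral_update (k + 1) (measurable_one.indicator hms)).aemeasurable

/-! ### Small mass has positive probability -/

theorem complexGaussian_norm_lt_pos {r : ℝ} (hr : 0 < r) :
    0 < complexGaussian {z | ‖z‖ ^ 2 < r} := by
  have hms : MeasurableSet {z : ℂ | ‖z‖ ^ 2 < r} := measurableSet_lt (by fun_prop) measurable_const
  have e : complexGaussian {z | ‖z‖ ^ 2 < r} =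
      ∫⁻ z, Set.indicator (Set.Iio r) 1 (‖z‖ ^ 2) ∂complexGaussian := by
    rw [← lintegral_indicator_one hms]
    rfl
  rw [e, lintegral_complexGaussian_radial _ (measurable_one.indicator measurableSet_Iio)]
  calc (0 : ℝ≥0∞) < ∫⁻ _ in Set.Ioo 0 r, ENNReal.ofReal (Real.exp (-r)) := by
        rw [lintegral_const, Measure.restrict_apply_univ, Real.volume_Ioo]
        simp [hr, Real.exp_pos]
    _ ≤ ∫⁻ t in Set.Ioo 0 r, ENNReal.ofReal (Real.exp (-t)) * Set.indicator (Set.Iio r) 1 t := by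
        refine setLIntegral_mono' measurableSet_Ioo fun t ht => ?_
        rw [Set.indicator_of_mem (Set.mem_Iio.mpr ht.2)]
        simp only [Pi.one_apply, mul_one]
        exact ENNReal.ofReal_le_ofReal (Real.exp_le_exp.mpr (by linarith [ht.2]))
    _ ≤ _ := lintegral_mono_set Set.Ioo_subset_Ioi_self

/-- The mode j is independent of the others and, with positive probability, its mass is below δ' -
δ. -/
theorem gaussianFamily_offMass_lt_pos_of_insert {s : Finset ℤ} {j : ℤ} (hj : j ∉ s) {δ δ' : ℝ≥0}
    (hδ : δ < δ') (h : 0 < gaussianFamily {g | offMass (insert j s) g < δ}) :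
    0 < gaussianFamily {g | offMass s g < δ'} := by
  have hb : 0 < bracket j := bracket_pos j
  have hms : MeasurableSet {g | offMass s g < δ'} :=
    measurableSet_lt (measurable_offMass s) measurable_const
  have hms' : MeasurableSet {g | offMass (insert j s) g < δ} :=
    measurableSet_lt (measurable_offMass _) measurable_const
  set r : ℝ := bracket j ^ 2 * (δ' - δ) with hr
  have hr0 : 0 < r := mul_pos (by positivity) (sub_pos.mpr (by exact_mod_cast hδ))
  rw [← lintegral_indicator_one hms, gaussianFamily_resamples j
    (Set.indicator {g | offMass s g < δ'} 1) (measurable_one.indicator hms)]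
  calc (0 : ℝ≥0∞) < complexGaussian {z | ‖z‖ ^ 2 < r} *
        gaussianFamily {g | offMass (insert j s) g < δ} :=
        ENNReal.mul_pos (complexGaussian_norm_lt_pos hr0).ne' h.ne'
    _ = ∫⁻ g, complexGaussian {z | ‖z‖ ^ 2 < r} *
        Set.indicator {g | offMass (insert j s) g < δ} 1 g ∂gaussianFamily := by
        rw [lintegral_const_mul _ (measurable_one.indicator hms'), lintegral_indicator_one hms']
    _ ≤ _ := by
        refine lintegral_mono fun g => ?_
        by_cases hg : offMass (insert j s) g < δ
        · rw [Set.indicator_of_mem (show g ∈ {g | offMass (insert j s) g < δ} from hg),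
            Pi.one_apply, mul_one, ← lintegral_indicator_one
              (measurableSet_lt (by fun_prop) measurable_const)]
          refine lintegral_mono fun z => ?_
          by_cases hz : ‖z‖ ^ 2 < r
          swap
          · rw [Set.indicator_of_notMem (show z ∉ {z : ℂ | ‖z‖ ^ 2 < r} from hz)]
            exact zero_le
          suffices hlt : offMass s (Function.update g j z) < δ' by
            rw [Set.indicator_of_mem
              (show Function.update g j z ∈ {g | offMass s g < δ'} from hlt)]
            exact Set.indicator_le_self _ _ z
          rw [offMass_eq_add hj, offMass_update_of_mem (Finset.mem_insert_self _ _),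
            norm_coeffSeq_sq, Function.update_self]
          have h1 : (bracket j ^ 2)⁻¹ * ‖z‖ ^ 2 < δ' - δ := by
            rw [inv_mul_lt_iff₀ (by positivity)]
            exact hz
          have h2 : ENNReal.ofReal ((bracket j ^ 2)⁻¹ * ‖z‖ ^ 2) ≤
              ENNReal.ofReal ((δ' : ℝ) - δ) := ENNReal.ofReal_le_ofReal h1.le
          have h3 : ENNReal.ofReal ((δ' : ℝ) - δ) + δ = δ' := by
            rw [ENNReal.ofReal_sub _ δ.coe_nonneg, ENNReal.ofReal_coe_nnreal, ENNReal.ofReal_coe_nnreal]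
            exact tsub_add_cancel_of_le (by exact_mod_cast hδ.le)
          calc _ < ENNReal.ofReal ((δ' : ℝ) - δ) + δ :=
                ENNReal.add_lt_add_of_le_of_lt (ne_top_of_le_ne_top ENNReal.ofReal_ne_top h2) h2 hg
            _ = δ' := h3
        · rw [Set.indicator_of_notMem (show g ∉ {g | offMass (insert j s) g < δ} from hg)]
          simp

theorem gaussianFamily_offMass_lt_pos_of_finset (s : Finset ℤ) {δ δ' : ℝ≥0} (hδ : δ < δ')
    (h : 0 < gaussianFamily {g | offMass s g < δ}) :
    0 < gaussianFamily {g | offMass ∅ g < δ'} := by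
  induction s using Finset.induction_on generalizing δ with
  | empty =>
    refine h.trans_le (measure_mono fun g hg => ?_)
    exact lt_trans (show offMass ∅ g < δ from hg) (by exact_mod_cast hδ)
  | insert j s hj ih =>
    obtain ⟨η, h1, h2⟩ := exists_between hδ
    exact ih h2 (gaussianFamily_offMass_lt_pos_of_insert hj h1 h)

theorem tendsto_offMass_modes {g : ℤ → ℂ} (hg : SquareSummable g) :
    Tendsto (fun N => offMass (modes N) g) atTop (𝓝 0) := by
  have h : ∑' n, ENNReal.ofReal (‖coeffSeq g n‖ ^ 2) ≠ ∞ := Summable.tsum_ofReal_ne_top hg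
  have e : (fun N => offMass (modes N) g) = fun N =>
      ∑' n : {n // n ∉ modes N}, ENNReal.ofReal (‖coeffSeq g n‖ ^ 2) := by
    ext1 N
    rw [offMass]
    refine Eq.trans ?_ (tsum_subtype {n | n ∉ modes N}
      fun n => ENNReal.ofReal (‖coeffSeq g n‖ ^ 2)).symm
    refine tsum_congr fun n => ?_
    by_cases hn : n ∈ modes N <;> simp [hn]
  rw [e]
  exact (ENNReal.tendsto_tsum_compl_atTop_zero h).comp tendsto_modes

/-- The mass of the frequencies beyond N tends to 0 almost surely, so for some N it is small with
positive probability; the finitely many remaining modes are restored one at a time. -/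
theorem gaussianFamily_offMass_lt_pos {δ : ℝ≥0} (hδ : 0 < δ) :
    0 < gaussianFamily {g | offMass ∅ g < δ} := by
  obtain ⟨η, h1, h2⟩ := exists_between hδ
  by_contra h0
  have hz : ∀ N : ℕ, gaussianFamily {g | offMass (modes N) g < η} = 0 := by
    intro N
    by_contra hN
    exact h0 (gaussianFamily_offMass_lt_pos_of_finset (modes N) h2 (pos_iff_ne_zero.mpr hN))
  have hU := measure_iUnion_null hz
  have hae : ∀ᵐ g ∂gaussianFamily, g ∈ ⋃ N : ℕ, {g | offMass (modes N) g < η} := by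
    filter_upwards [ae_squareSummable] with g hg
    obtain ⟨N, hN⟩ := ((tendsto_offMass_modes hg).eventually_lt_const
      (show (0 : ℝ≥0∞) < η by exact_mod_cast h1)).exists
    exact Set.mem_iUnion.mpr ⟨N, hN⟩
  have huniv : gaussianFamily (⋃ N : ℕ, {g | offMass (modes N) g < η}) = 1 := by
    rw [measure_eq_measure_of_null_sdiff (Set.subset_univ _), measure_univ]
    rw [← Set.compl_eq_univ_sdiff]
    exact hae
  rw [hU] at huniv
  exact zero_ne_one huniv

theorem gaussianFamily_massOff_lt_pos (k : ℤ) {m : ℝ} (hm : 0 < m) :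
    0 < gaussianFamily {g | massOff k g < m} := by
  refine (gaussianFamily_offMass_lt_pos (δ := m.toNNReal) (Real.toNNReal_pos.mpr hm)).trans_le
    (measure_mono fun g hg => ?_)
  have h1 : offMass {k} g ≤ offMass ∅ g := by
    rw [offMass_eq_add (Finset.notMem_empty k), insert_empty_eq]
    exact le_add_self
  have h2 : offMass {k} g < ENNReal.ofReal m := h1.trans_lt hg
  exact (ENNReal.lt_ofReal_iff_toReal_lt h2.ne_top).mp h2

/-! ### Disintegration along the mass -/

/-- The uniform distribution on `(-π, π)`. -/
def angleMeasure : Measure ℝ := ENNReal.ofReal (2 * π)⁻¹ • volume.restrict (Set.Ioo (-π) π)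

/-- The uniform distribution on `(-1, 1)`. -/
def widthMeasure : Measure ℝ := ENNReal.ofReal 2⁻¹ • volume.restrict (Set.Ioo (-1) 1)

instance isProbabilityMeasure_angleMeasure : IsProbabilityMeasure angleMeasure := by
  constructor
  rw [angleMeasure, Measure.smul_apply, Measure.restrict_apply_univ, Real.volume_Ioo, smul_eq_mul,
    ← ENNReal.ofReal_mul (by positivity), ← ENNReal.ofReal_one]
  congr 1
  have := Real.pi_pos
  field_simp
  ring

instance isProbabilityMeasure_widthMeasure : IsProbabilityMeasure widthMeasure := by
  constructor
  rw [widthMeasure, Measure.smul_apply, Measure.restrict_apply_univ, Real.volume_Ioo, smul_eq_mul,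
    ← ENNReal.ofReal_mul (by positivity), ← ENNReal.ofReal_one]
  norm_num

theorem ae_widthMeasure : ∀ᵐ r ∂widthMeasure, r ∈ Set.Ioo (-1 : ℝ) 1 :=
  Measure.ae_smul_measure (ae_restrict_mem measurableSet_Ioo) _

theorem lintegral_complexGaussian_angle (F : ℂ → ℝ≥0∞) (hF : Measurable F) :
    ∫⁻ z, F z ∂complexGaussian = ∫⁻ t in Set.Ioi (0 : ℝ), ENNReal.ofReal (Real.exp (-t)) *
      ∫⁻ θ, F (polarPoint t θ) ∂angleMeasure := by
  rw [lintegral_complexGaussian_polar F hF]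
  refine lintegral_congr fun t => ?_
  congr 1
  rw [angleMeasure, lintegral_smul_measure, smul_eq_mul, lintegral_const_mul]
  exact hF.comp (measurable_polarPoint.comp (measurable_const.prodMk measurable_id))

theorem lintegral_comp_affine {a : ℝ} (ha : 0 < a) (b : ℝ) (G : ℝ → ℝ≥0∞) :
    ∫⁻ t, G t = ENNReal.ofReal a * ∫⁻ r, G (a * r + b) := by
  have e1 : ∫⁻ r, G (a * r + b) = ∫⁻ r, (fun x => G (x + b)) (a * r) := rfl
  have hemb : MeasurableEmbedding fun r : ℝ => a * r :=
    (Homeomorph.mulLeft₀ a ha.ne').measurableEmbedding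
  have e2 := hemb.lintegral_map (μ := volume) (fun x => G (x + b))
  rw [e1, ← e2, ← lintegral_add_right_eq_self G b]
  conv_lhs => rw [← Real.smul_map_volume_mul_left ha.ne', abs_of_pos ha]
  rw [lintegral_smul_measure, smul_eq_mul]

/-- The substitution t = c(m + εr - M) maps the shell to the fixed interval (-1, 1) and brings out
the factor 2ε. The parameter ε then occurs in the integrand only, as the radius m + εr. -/
theorem lintegral_shell_change {c ε : ℝ} (hc : 0 < c) (hε : 0 < ε) (M m : ℝ) (φ : ℝ → ℝ≥0∞) :
    ∫⁻ t in Set.Ioi (0 : ℝ), ENNReal.ofReal (Real.exp (-t)) *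
        (if M + t / c ∈ Set.Ioo (m - ε) (m + ε) then φ t else 0) =
      ENNReal.ofReal (2 * ε) * ∫⁻ r, (if M < m + ε * r then
        ENNReal.ofReal (c * Real.exp (-(c * (m + ε * r - M)))) * φ (c * (m + ε * r - M)) else 0)
          ∂widthMeasure := by
  rw [widthMeasure, lintegral_smul_measure, smul_eq_mul, ← lintegral_indicator measurableSet_Ioi,
    ← lintegral_indicator measurableSet_Ioo,
    lintegral_comp_affine (mul_pos hc hε) (c * (m - M)), ← mul_assoc,
    ← ENNReal.ofReal_mul (by positivity), show c * ε = (2 * ε * 2⁻¹) * c by ring,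
    ENNReal.ofReal_mul (by positivity), mul_assoc]
  congr 1
  rw [← lintegral_const_mul' _ _ ENNReal.ofReal_ne_top]
  refine lintegral_congr fun r => ?_
  have e : 2 * ε * 2⁻¹ * c * r + c * (m - M) = c * (m + ε * r - M) := by ring
  rw [e]
  have h1 : M + c * (m + ε * r - M) / c = m + ε * r := by
    field_simp
    ring
  have h2 : m + ε * r ∈ Set.Ioo (m - ε) (m + ε) ↔ r ∈ Set.Ioo (-1 : ℝ) 1 := by
    simp only [Set.mem_Ioo]
    constructor
    · rintro ⟨h3, h4⟩
      constructor <;> nlinarith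
    · rintro ⟨h3, h4⟩
      constructor <;> nlinarith
  have h3 : c * (m + ε * r - M) ∈ Set.Ioi (0 : ℝ) ↔ M < m + ε * r := by
    rw [Set.mem_Ioi, mul_pos_iff_of_pos_left hc, sub_pos]
  simp only [Set.indicator_apply, h1, h2, h3]
  split_ifs <;> simp [ENNReal.ofReal_mul hc.le, mul_assoc]

/-- The point of the mass sphere of radius `s` over `g`, with the mode `k` at the angle `θ`. -/
def spherePoint (k : ℤ) (s : ℝ) (g : ℤ → ℂ) (θ : ℝ) : ℤ → ℂ :=
  Function.update g k (polarPoint (bracket k ^ 2 * (s - massOff k g)) θ)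

/-- The density that the mode `k` contributes to the mass sphere. -/
@[irreducible]
def sphereDensity (k : ℤ) (s : ℝ) (g : ℤ → ℂ) : ℝ≥0∞ :=
  if massOff k g < s then
    ENNReal.ofReal (bracket k ^ 2 * Real.exp (-(bracket k ^ 2 * (s - massOff k g))))
  else 0

theorem measurable_spherePoint (k : ℤ) :
    Measurable fun p : ℝ × (ℤ → ℂ) × ℝ => spherePoint k p.1 p.2.1 p.2.2 := by
  have h1 := measurable_massOff k
  have h2 : Measurable fun p : ℝ × (ℤ → ℂ) × ℝ => (p.2.1,
      polarPoint (bracket k ^ 2 * (p.1 - massOff k p.2.1)) p.2.2) := by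
    refine Measurable.prodMk (by fun_prop) ?_
    exact measurable_polarPoint.comp (Measurable.prodMk (by fun_prop) (by fun_prop))
  exact (measurable_update_pair k).comp h2

theorem measurable_sphereDensity (k : ℤ) :
    Measurable fun p : ℝ × (ℤ → ℂ) => sphereDensity k p.1 p.2 := by
  have h1 := measurable_massOff k
  unfold sphereDensity
  exact Measurable.ite (measurableSet_lt (by fun_prop) (by fun_prop)) (by fun_prop)
    measurable_const

theorem sphereDensity_le (k : ℤ) (s : ℝ) (g : ℤ → ℂ) :
    sphereDensity k s g ≤ ENNReal.ofReal (bracket k ^ 2) := by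
  unfold sphereDensity
  split_ifs with h
  · refine ENNReal.ofReal_le_ofReal (mul_le_of_le_one_right (by positivity) ?_)
    rw [Real.exp_le_one_iff, neg_nonpos]
    exact mul_nonneg (by positivity) (by linarith)
  · exact zero_le

/-- The mode k is resampled in the coordinates squared modulus and angle. Given the other modes,
membership in the shell is a condition on the squared modulus alone. -/
theorem lintegral_shell (k : ℤ) {H : (ℤ → ℂ) → ℝ≥0∞} (hH : Measurable H) (m : ℝ) {ε : ℝ}
    (hε : 0 < ε) :
    ∫⁻ g in {g | ‖randomSeries g‖ ^ 2 ∈ Set.Ioo (m - ε) (m + ε)}, H g ∂gaussianFamily =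
      ENNReal.ofReal (2 * ε) * ∫⁻ g, ∫⁻ r, ∫⁻ θ, sphereDensity k (m + ε * r) g *
        H (spherePoint k (m + ε * r) g θ) ∂angleMeasure ∂widthMeasure ∂gaussianFamily := by
  have hR := measurable_randomSeries
  have hms : MeasurableSet {g | ‖randomSeries g‖ ^ 2 ∈ Set.Ioo (m - ε) (m + ε)} :=
    (hR.norm.pow_const 2) measurableSet_Ioo
  have hc : 0 < bracket k ^ 2 := by have := bracket_pos k; positivity
  rw [← lintegral_indicator hms, gaussianFamily_resamples k _ (hH.indicator hms),
    ← lintegral_const_mul' _ _ ENNReal.ofReal_ne_top]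
  refine lintegral_congr_ae ?_
  filter_upwards [ae_squareSummable] with g hg
  rw [lintegral_complexGaussian_angle (fun z => Set.indicator
    {g | ‖randomSeries g‖ ^ 2 ∈ Set.Ioo (m - ε) (m + ε)} H (Function.update g k z))
    ((hH.indicator hms).comp ((measurable_update_pair k).comp (measurable_prodMk_left (x := g))))]
  have e : ∀ t ∈ Set.Ioi (0 : ℝ), ENNReal.ofReal (Real.exp (-t)) * ∫⁻ θ,
      Set.indicator {g | ‖randomSeries g‖ ^ 2 ∈ Set.Ioo (m - ε) (m + ε)} H
        (Function.update g k (polarPoint t θ)) ∂angleMeasure =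
      ENNReal.ofReal (Real.exp (-t)) *
        (if massOff k g + t / bracket k ^ 2 ∈ Set.Ioo (m - ε) (m + ε) then
          ∫⁻ θ, H (Function.update g k (polarPoint t θ)) ∂angleMeasure else 0) := by
    intro t ht
    congr 1
    have h1 : ∀ θ, ‖randomSeries (Function.update g k (polarPoint t θ))‖ ^ 2 =
        massOff k g + t / bracket k ^ 2 := fun θ => by
      rw [norm_sq_randomSeries_update hg, norm_polarPoint, Real.sq_sqrt (le_of_lt ht)]
    simp only [Set.indicator_apply, Set.mem_ofPred_eq, h1]
    split_ifs <;> simp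
  rw [setLIntegral_congr_fun measurableSet_Ioi e, lintegral_shell_change hc hε]
  congr 1
  refine lintegral_congr fun r => ?_
  simp only [sphereDensity, spherePoint]
  split_ifs with h
  · rw [lintegral_const_mul' _ _ ENNReal.ofReal_ne_top]
  · simp

/-- The Gaussian measure on the mass sphere of radius `m`, parametrized by all modes but `k` and
by the angle of the mode `k`. -/
def sphereMeasure (k : ℤ) (m : ℝ) : Measure (ℤ → ℂ) :=
  ((gaussianFamily.withDensity (sphereDensity k m)).prod angleMeasure).map
    fun p => spherePoint k m p.1 p.2

theorem measurable_sphereDensity_right (k : ℤ) (m : ℝ) : Measurable (sphereDensity k m) :=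
  (measurable_sphereDensity k).comp (measurable_prodMk_left (x := m))

theorem measurable_spherePoint_right (k : ℤ) (m : ℝ) :
    Measurable fun p : (ℤ → ℂ) × ℝ => spherePoint k m p.1 p.2 :=
  (measurable_spherePoint k).comp (measurable_prodMk_left (x := m))

theorem isFiniteMeasure_withDensity_sphereDensity (k : ℤ) (m : ℝ) :
    IsFiniteMeasure (gaussianFamily.withDensity (sphereDensity k m)) := by
  refine isFiniteMeasure_withDensity ?_
  refine ne_top_of_le_ne_top ?_ (lintegral_mono fun g => sphereDensity_le k m g)
  rw [lintegral_const, measure_univ, mul_one]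
  exact ENNReal.ofReal_ne_top

instance isFiniteMeasure_sphereMeasure (k : ℤ) (m : ℝ) : IsFiniteMeasure (sphereMeasure k m) := by
  have := isFiniteMeasure_withDensity_sphereDensity k m
  unfold sphereMeasure
  infer_instance

theorem lintegral_sphereMeasure (k : ℤ) (m : ℝ) {H : (ℤ → ℂ) → ℝ≥0∞} (hH : Measurable H) :
    ∫⁻ g, H g ∂(sphereMeasure k m) =
      ∫⁻ g, ∫⁻ θ, sphereDensity k m g * H (spherePoint k m g θ) ∂angleMeasure ∂gaussianFamily := by
  have := isFiniteMeasure_withDensity_sphereDensity k m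
  have h1 := measurable_spherePoint_right k m
  have h2 : Measurable fun p : (ℤ → ℂ) × ℝ => H (spherePoint k m p.1 p.2) := hH.comp h1
  have h3 : Measurable fun g => ∫⁻ θ, H (spherePoint k m g θ) ∂angleMeasure :=
    h2.lintegral_prod_right'
  rw [sphereMeasure, lintegral_map hH h1, lintegral_prod _ h2.aemeasurable,
    lintegral_withDensity_eq_lintegral_mul _ (measurable_sphereDensity_right k m) h3]
  refine lintegral_congr fun g => ?_
  rw [Pi.mul_apply, lintegral_const_mul' _ _
    (ne_top_of_le_ne_top ENNReal.ofReal_ne_top (sphereDensity_le k m g))]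

/-- Dominated convergence over the other modes, the radial variable r and the angle. Continuity is
required only in the mode k, for almost every choice of the others; the bound is required up to
radius 2m because ε < m may be assumed. -/
theorem tendsto_lintegral_shell (k : ℤ) {H : (ℤ → ℂ) → ℝ≥0∞} (hH : Measurable H) {m : ℝ}
    (hm : 0 < m)
    (hcont : ∀ᵐ g ∂gaussianFamily, Continuous fun z => H (Function.update g k z))
    {D : (ℤ → ℂ) → ℝ≥0∞} (hD : Measurable D) (hDfin : ∫⁻ g, D g ∂gaussianFamily ≠ ∞)
    (hbound : ∀ᵐ g ∂gaussianFamily, ∀ s θ, s ≤ 2 * m → massOff k g < s →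
      H (spherePoint k s g θ) ≤ D g) :
    Tendsto (fun ε : ℝ => (ENNReal.ofReal (2 * ε))⁻¹ *
      ∫⁻ g in {g | ‖randomSeries g‖ ^ 2 ∈ Set.Ioo (m - ε) (m + ε)}, H g ∂gaussianFamily) (𝓝[>] 0)
      (𝓝 (∫⁻ g, H g ∂(sphereMeasure k m))) := by
  set P : Measure ((ℤ → ℂ) × ℝ × ℝ) := gaussianFamily.prod (widthMeasure.prod angleMeasure)
  set Φ : ℝ → (ℤ → ℂ) × ℝ × ℝ → ℝ≥0∞ := fun ε p =>
    sphereDensity k (m + ε * p.2.1) p.1 * H (spherePoint k (m + ε * p.2.1) p.1 p.2.2) with hΦ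
  have hΦm : ∀ ε, Measurable (Φ ε) := by
    intro ε
    refine Measurable.mul ?_ ?_
    · have h1 : Measurable fun p : (ℤ → ℂ) × ℝ × ℝ => (m + ε * p.2.1, p.1) := by fun_prop
      exact (measurable_sphereDensity k).comp h1
    · have h1 : Measurable fun p : (ℤ → ℂ) × ℝ × ℝ => (m + ε * p.2.1, p.1, p.2.2) := by fun_prop
      exact hH.comp ((measurable_spherePoint k).comp h1)
  have hprod : ∀ ε, ∫⁻ p, Φ ε p ∂P = ∫⁻ g, ∫⁻ r, ∫⁻ θ, sphereDensity k (m + ε * r) g *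
        H (spherePoint k (m + ε * r) g θ) ∂angleMeasure ∂widthMeasure ∂gaussianFamily := by
    intro ε
    rw [lintegral_prod _ (hΦm ε).aemeasurable]
    refine lintegral_congr fun g => ?_
    rw [lintegral_prod]
    exact ((hΦm ε).comp (measurable_prodMk_left (x := g))).aemeasurable
  have h0 : ∫⁻ p, Φ 0 p ∂P = ∫⁻ g, H g ∂(sphereMeasure k m) := by
    rw [hprod, lintegral_sphereMeasure k m hH]
    simp
  rw [← h0]
  have hlim : Tendsto (fun ε => ∫⁻ p, Φ ε p ∂P) (𝓝[>] 0) (𝓝 (∫⁻ p, Φ 0 p ∂P)) := by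
    have hfst : ∀ {q : (ℤ → ℂ) → Prop}, (∀ᵐ g ∂gaussianFamily, q g) → ∀ᵐ p ∂P, q p.1 :=
      fun h => Measure.quasiMeasurePreserving_fst.ae h
    have hr : ∀ᵐ p ∂P, p.2.1 ∈ Set.Ioo (-1 : ℝ) 1 :=
      Measure.quasiMeasurePreserving_snd.ae (Measure.quasiMeasurePreserving_fst.ae ae_widthMeasure)
    refine tendsto_lintegral_filter_of_dominated_convergence
      (fun p => ENNReal.ofReal (bracket k ^ 2) * D p.1) (Eventually.of_forall hΦm) ?_ ?_ ?_
    · filter_upwards [Ioo_mem_nhdsGT hm] with ε hε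
      filter_upwards [hfst hbound, hr] with p hp hp2
      simp only [hΦ]
      by_cases hs : massOff k p.1 < m + ε * p.2.1
      · gcongr
        · exact sphereDensity_le _ _ _
        · refine hp _ _ ?_ hs
          have : ε * p.2.1 ≤ ε * 1 := mul_le_mul_of_nonneg_left hp2.2.le hε.1.le
          linarith [hε.2]
      · rw [sphereDensity, if_neg hs, zero_mul]
        exact zero_le
    · rw [lintegral_const_mul' _ _ ENNReal.ofReal_ne_top]
      refine ENNReal.mul_ne_top ENNReal.ofReal_ne_top ?_
      rw [lintegral_prod (fun p : (ℤ → ℂ) × ℝ × ℝ => D p.1)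
        (hD.comp measurable_fst).aemeasurable]
      simpa using hDfin
    -- The cutoff in the density is discontinuous only where the other modes already have mass m, a
    -- null set.
    · have hne : ∀ᵐ g ∂gaussianFamily, massOff k g ≠ m := by
        rw [ae_iff]
        simpa using gaussianFamily_massOff_eq k m
      filter_upwards [hfst hcont, hfst hne] with p hp hpm
      have hs : Tendsto (fun ε : ℝ => m + ε * p.2.1) (𝓝[>] 0) (𝓝 m) := by
        have : Continuous fun ε : ℝ => m + ε * p.2.1 := by fun_prop
        simpa using (this.tendsto 0).mono_left nhdsWithin_le_nhds
      rcases lt_or_gt_of_ne hpm with hlt | hgt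
      · have hev : ∀ᶠ ε in 𝓝[>] (0 : ℝ), massOff k p.1 < m + ε * p.2.1 :=
          hs.eventually_const_lt hlt
        have hc1 : Continuous fun ε : ℝ => ENNReal.ofReal (bracket k ^ 2 *
            Real.exp (-(bracket k ^ 2 * (m + ε * p.2.1 - massOff k p.1)))) :=
          ENNReal.continuous_ofReal.comp (by fun_prop)
        have hc2 : Continuous fun ε : ℝ => H (spherePoint k (m + ε * p.2.1) p.1 p.2.2) := by
          refine hp.comp ?_
          unfold polarPoint
          fun_prop
        have hb := bracket_pos k
        have := (ENNReal.Tendsto.mul (hc1.tendsto 0)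
          (Or.inl (ENNReal.ofReal_pos.mpr (by positivity)).ne') (hc2.tendsto 0)
          (Or.inr ENNReal.ofReal_ne_top)).mono_left (nhdsWithin_le_nhds (s := Set.Ioi 0))
        have e0 : Φ 0 p = ENNReal.ofReal (bracket k ^ 2 *
            Real.exp (-(bracket k ^ 2 * (m + 0 * p.2.1 - massOff k p.1)))) *
            H (spherePoint k (m + 0 * p.2.1) p.1 p.2.2) := by
          simp only [hΦ, sphereDensity]
          rw [if_pos (by simpa using hlt)]
        rw [e0]
        refine this.congr' ?_
        filter_upwards [hev] with ε hε
        simp only [hΦ, sphereDensity]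
        rw [if_pos hε]
      · have hev : ∀ᶠ ε in 𝓝[>] (0 : ℝ), m + ε * p.2.1 < massOff k p.1 :=
          hs.eventually_lt_const hgt
        have e0 : Φ 0 p = 0 := by
          simp only [hΦ, sphereDensity]
          rw [if_neg (by simpa using hgt.le), zero_mul]
        rw [e0]
        refine tendsto_const_nhds.congr' ?_
        filter_upwards [hev] with ε hε
        simp only [hΦ, sphereDensity]
        rw [if_neg (not_lt.mpr hε.le), zero_mul]
  refine hlim.congr' ?_
  filter_upwards [self_mem_nhdsWithin] with ε hε
  have hε' : (0 : ℝ) < ε := hε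
  rw [lintegral_shell k hH m hε', ← hprod, ← mul_assoc, ENNReal.inv_mul_cancel, one_mul]
  · exact (ENNReal.ofReal_pos.mpr (by positivity)).ne'
  · exact ENNReal.ofReal_ne_top

/-! ### The fixed mass measure -/

theorem continuous_randomSeries_update {g : ℤ → ℂ} (hg : SquareSummable g) (k : ℤ) :
    Continuous fun z => randomSeries (Function.update g k z) := by
  have e : (fun z => randomSeries (Function.update g k z)) = fun z =>
      randomSeries (Function.update g k 0) + (z / (bracket k : ℂ)) • fourierLp 2 k :=
    funext fun z => randomSeries_update hg k z
  rw [e]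
  fun_prop

/-- The set of those `g` for which the mass of the random series is in `(m - ε, m + ε)`. -/
def shellSet (m ε : ℝ) : Set (ℤ → ℂ) := {g | ‖randomSeries g‖ ^ 2 ∈ Set.Ioo (m - ε) (m + ε)}

theorem measurableSet_massShell (m ε : ℝ) : MeasurableSet (massShell m ε) :=
  (measurable_norm.pow_const 2) measurableSet_Ioo

theorem lintegral_shellMeasure (m ε : ℝ) {G : L2 → ℝ≥0∞} (hG : Measurable G) :
    ∫⁻ u, G u ∂(shellMeasure m ε) =
      (gaussianFamily (shellSet m ε))⁻¹ * ∫⁻ g in shellSet m ε, G (randomSeries g)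
        ∂gaussianFamily := by
  have hS := measurableSet_massShell m ε
  rw [shellMeasure, ProbabilityTheory.cond, lintegral_smul_measure, smul_eq_mul, gaussianMeasure,
    Measure.map_apply measurable_randomSeries hS, Measure.restrict_map measurable_randomSeries hS,
    lintegral_map hG measurable_randomSeries]
  rfl

theorem sphereMeasure_univ_pos (k : ℤ) {m : ℝ} (hm : 0 < m) : 0 < sphereMeasure k m Set.univ := by
  rw [← lintegral_one, lintegral_sphereMeasure k m measurable_const]
  simp only [mul_one, lintegral_const, measure_univ]
  rw [lintegral_pos_iff_support (measurable_sphereDensity_right k m)]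
  refine (gaussianFamily_massOff_lt_pos k hm).trans_le (measure_mono fun g hg => ?_)
  have hb := bracket_pos k
  rw [Function.mem_support, sphereDensity, if_pos (show massOff k g < m from hg)]
  exact (ENNReal.ofReal_pos.mpr (by positivity)).ne'

theorem tendsto_shellSet (k : ℤ) {m : ℝ} (hm : 0 < m) :
    Tendsto (fun ε : ℝ => (ENNReal.ofReal (2 * ε))⁻¹ * gaussianFamily (shellSet m ε)) (𝓝[>] 0)
      (𝓝 (sphereMeasure k m Set.univ)) := by
  have h := tendsto_lintegral_shell k (H := fun _ => 1) measurable_const hm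
    (Eventually.of_forall fun _ => continuous_const) (D := fun _ => 1) measurable_const (by simp)
    (Eventually.of_forall fun _ _ _ _ _ => le_rfl)
  simp only [lintegral_const, one_mul, Measure.restrict_apply_univ] at h
  exact h

/-- Both sides are the probability density of the mass at m. -/
theorem sphereMeasure_univ_eq (k : ℤ) {m : ℝ} (hm : 0 < m) :
    sphereMeasure k m Set.univ = sphereMeasure 0 m Set.univ :=
  tendsto_nhds_unique (tendsto_shellSet k hm) (tendsto_shellSet 0 hm)

theorem eventually_shellSet_pos {m : ℝ} (hm : 0 < m) :
    ∀ᶠ ε : ℝ in 𝓝[>] 0, gaussianFamily (shellSet m ε) ≠ 0 := by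
  filter_upwards [(tendsto_shellSet 0 hm).eventually_const_lt (sphereMeasure_univ_pos 0 hm)]
    with ε hε h0
  rw [h0, mul_zero] at hε
  exact lt_irrefl _ hε

theorem tendsto_lintegral_shellMeasure (k : ℤ) {G : L2 → ℝ≥0∞} (hG : Measurable G) {m : ℝ}
    (hm : 0 < m)
    (hcont : ∀ᵐ g ∂gaussianFamily, Continuous fun z => G (randomSeries (Function.update g k z)))
    {D : (ℤ → ℂ) → ℝ≥0∞} (hD : Measurable D) (hDfin : ∫⁻ g, D g ∂gaussianFamily ≠ ∞)
    (hbound : ∀ᵐ g ∂gaussianFamily, ∀ s θ, s ≤ 2 * m → massOff k g < s →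
      G (randomSeries (spherePoint k s g θ)) ≤ D g) :
    Tendsto (fun ε : ℝ => ∫⁻ u, G u ∂(shellMeasure m ε)) (𝓝[>] 0)
      (𝓝 ((sphereMeasure k m Set.univ)⁻¹ * ∫⁻ g, G (randomSeries g) ∂(sphereMeasure k m))) := by
  have h1 := tendsto_lintegral_shell k (H := fun g => G (randomSeries g))
    (hG.comp measurable_randomSeries) hm hcont hD hDfin hbound
  have hfin : ∀ᶠ ε : ℝ in 𝓝[>] 0, (ENNReal.ofReal (2 * ε))⁻¹ ≠ 0 ∧
      (ENNReal.ofReal (2 * ε))⁻¹ ≠ ∞ := by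
    filter_upwards [self_mem_nhdsWithin] with ε hε
    have hε' : (0 : ℝ) < ε := hε
    exact ⟨ENNReal.inv_ne_zero.mpr ENNReal.ofReal_ne_top,
      ENNReal.inv_ne_top.mpr (ENNReal.ofReal_pos.mpr (by positivity)).ne'⟩
  have hne := (sphereMeasure_univ_pos k hm).ne'
  have h2 := ENNReal.Tendsto.mul (tendsto_shellSet k hm).inv
    (Or.inl (ENNReal.inv_ne_zero.mpr (measure_ne_top _ _))) h1
    (Or.inr (ENNReal.inv_ne_top.mpr hne))
  refine h2.congr' ?_
  filter_upwards [hfin, eventually_shellSet_pos hm] with ε hε hS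
  rw [lintegral_shellMeasure m ε hG, ENNReal.mul_inv (Or.inl hε.1) (Or.inl hε.2), mul_mul_mul_comm,
    ENNReal.inv_mul_cancel hε.1 hε.2, one_mul]
  rfl

/-- For bounded continuous functions on L² both sides arise, after normalization, as the limit of
the same shell averages, in which k does not occur. So k may be adapted to the integrand. -/
theorem map_randomSeries_sphereMeasure (k : ℤ) {m : ℝ} (hm : 0 < m) :
    (sphereMeasure k m).map randomSeries = (sphereMeasure 0 m).map randomSeries := by
  refine ext_of_forall_lintegral_eq_of_IsFiniteMeasure fun F => ?_
  have hF : Measurable fun u : L2 => (F u : ℝ≥0∞) :=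
    F.continuous.measurable.coe_nnreal_ennreal
  have hlim : ∀ j : ℤ, Tendsto (fun ε : ℝ => ∫⁻ u, (F u : ℝ≥0∞) ∂(shellMeasure m ε)) (𝓝[>] 0)
      (𝓝 ((sphereMeasure j m Set.univ)⁻¹ *
        ∫⁻ g, (F (randomSeries g) : ℝ≥0∞) ∂(sphereMeasure j m))) := by
    intro j
    refine tendsto_lintegral_shellMeasure j hF hm ?_
      (D := fun _ => (nndist F 0 : ℝ≥0∞)) measurable_const (by simp) ?_
    · filter_upwards [ae_squareSummable] with g hg
      exact ENNReal.continuous_coe.comp (F.continuous.comp (continuous_randomSeries_update hg j))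
    · exact Eventually.of_forall fun g s θ _ _ => ENNReal.coe_le_coe.mpr
        (BoundedContinuousFunction.NNReal.upper_bound F _)
  have h := tendsto_nhds_unique (hlim k) (hlim 0)
  rw [sphereMeasure_univ_eq k hm, ENNReal.mul_right_inj
    (ENNReal.inv_ne_zero.mpr (measure_ne_top _ _))
    (ENNReal.inv_ne_top.mpr (sphereMeasure_univ_pos 0 hm).ne')] at h
  rwa [lintegral_map hF measurable_randomSeries, lintegral_map hF measurable_randomSeries]

/-- The normalized Gaussian measure on the mass sphere. -/
def fixedMassLaw (m : ℝ) : Measure L2 :=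
  (sphereMeasure 0 m Set.univ)⁻¹ • (sphereMeasure 0 m).map randomSeries

theorem lintegral_fixedMassLaw (m : ℝ) {G : L2 → ℝ≥0∞} (hG : Measurable G) :
    ∫⁻ u, G u ∂(fixedMassLaw m) =
      (sphereMeasure 0 m Set.univ)⁻¹ * ∫⁻ g, G (randomSeries g) ∂(sphereMeasure 0 m) := by
  rw [fixedMassLaw, lintegral_smul_measure, smul_eq_mul, lintegral_map hG measurable_randomSeries]

theorem isProbabilityMeasure_fixedMassLaw {m : ℝ} (hm : 0 < m) :
    IsProbabilityMeasure (fixedMassLaw m) := by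
  constructor
  rw [fixedMassLaw, Measure.smul_apply, Measure.map_apply measurable_randomSeries .univ,
    Set.preimage_univ, smul_eq_mul,
    ENNReal.inv_mul_cancel (sphereMeasure_univ_pos 0 hm).ne' (measure_ne_top _ _)]

theorem measurableSet_cylinder (N : ℕ) {A : Set (Finset.Icc (-(N : ℤ)) N → ℂ)}
    (hA : MeasurableSet A) : MeasurableSet (cylinder N A) := by
  have h : Measurable fun (u : L2) (n : Finset.Icc (-(N : ℤ)) N) => coeffs u n :=
    measurable_pi_iff.mpr fun n => (measurable_pi_apply (n : ℤ)).comp continuous_coeffs.measurable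
  exact h hA

/-- The indicator of a cylinder is not continuous on L², but with k = N+1 it does not depend on the
mode k at all, and continuity in that mode is all that is needed. -/
theorem isFixedMassLimit_fixedMassLaw {m : ℝ} (hm : 0 < m) :
    IsFixedMassLimit m (fixedMassLaw m) := by
  intro N A hA
  have hC := measurableSet_cylinder N hA
  set k : ℤ := N + 1 with hk
  have h := tendsto_lintegral_shellMeasure k (G := Set.indicator (cylinder N A) 1)
    (measurable_one.indicator hC) hm ?_ (D := fun _ => 1) measurable_const (by simp) ?_
  · have e : ∫⁻ g, Set.indicator (cylinder N A) (1 : L2 → ℝ≥0∞) (randomSeries g)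
        ∂(sphereMeasure k m) = ∫⁻ g, Set.indicator (cylinder N A) (1 : L2 → ℝ≥0∞) (randomSeries g)
        ∂(sphereMeasure 0 m) := by
      rw [← lintegral_map (measurable_one.indicator hC) measurable_randomSeries,
        ← lintegral_map (measurable_one.indicator hC) measurable_randomSeries,
        map_randomSeries_sphereMeasure k hm]
    rw [e, sphereMeasure_univ_eq k hm, ← lintegral_fixedMassLaw m (measurable_one.indicator hC)] at h
    simpa only [lintegral_indicator_one hC] using h
  · filter_upwards [ae_squareSummable] with g hg
    have hconst : ∀ z, (randomSeries (Function.update g k z) ∈ cylinder N A) ↔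
        randomSeries (Function.update g k 0) ∈ cylinder N A := by
      intro z
      have : (fun n : Finset.Icc (-(N : ℤ)) N => coeffs (randomSeries (Function.update g k z)) n) =
          fun n : Finset.Icc (-(N : ℤ)) N => coeffs (randomSeries (Function.update g k 0)) n := by
        ext n
        have hn : (n : ℤ) ≠ k := by
          have := (Finset.mem_Icc.mp n.2).2
          omega
        rw [coeffs_randomSeries ((squareSummable_update k z).mpr hg),
          coeffs_randomSeries ((squareSummable_update k 0).mpr hg), coeffSeq_update_of_ne g hn,
          coeffSeq_update_of_ne g hn]
      simp only [cylinder, Set.mem_ofPred_eq, this]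
    have e : (fun z => Set.indicator (cylinder N A) (1 : L2 → ℝ≥0∞)
        (randomSeries (Function.update g k z))) = fun _ =>
        Set.indicator (cylinder N A) 1 (randomSeries (Function.update g k 0)) := by
      classical
      ext z
      simp only [Set.indicator_apply, hconst]
      rfl
    rw [e]
    exact continuous_const
  · exact Eventually.of_forall fun _ _ _ _ _ => Set.indicator_le_self _ _ _

theorem IsFixedMassLimit.measure_cylinder_eq {m : ℝ} {ν ν' : Measure L2}
    (h : IsFixedMassLimit m ν) (h' : IsFixedMassLimit m ν') (N : ℕ)
    {A : Set (Finset.Icc (-(N : ℤ)) N → ℂ)} (hA : MeasurableSet A) :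
    ν (cylinder N A) = ν' (cylinder N A) :=
  tendsto_nhds_unique (h N A hA) (h' N A hA)

/-- The whole space is a cylinder, so ν is finite as well. The finite-dimensional marginals agree,
hence so do the laws of the coefficient sequences, and these determine the measures. -/
theorem IsFixedMassLimit.unique {m : ℝ} {ν ν' : Measure L2} [IsFiniteMeasure ν']
    (h : IsFixedMassLimit m ν) (h' : IsFixedMassLimit m ν') : ν = ν' := by
  have huniv : ν Set.univ = ν' Set.univ := h.measure_cylinder_eq h' 0 MeasurableSet.univ
  have : IsFiniteMeasure ν := ⟨by rw [huniv]; exact measure_lt_top _ _⟩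
  have hc := continuous_coeffs.measurable
  have hmap : ν.map coeffs = ν'.map coeffs := by
    refine IsProjectiveLimit.unique (P := fun I => (ν'.map coeffs).map I.restrict) ?_ fun I => rfl
    intro I
    obtain ⟨N, hN⟩ := (tendsto_modes.eventually_ge_atTop I).exists
    ext B hB
    rw [Measure.map_apply (by fun_prop) hB, Measure.map_apply (by fun_prop) hB,
      Measure.map_apply hc ((Finset.measurable_restrict I) hB),
      Measure.map_apply hc ((Finset.measurable_restrict I) hB)]
    have hr := Finset.measurable_restrict₂ (X := fun _ : ℤ => ℂ) hN
    exact h.measure_cylinder_eq h' N (hr hB)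
  rw [← measurableEmbedding_coeffs.comap_map ν, hmap, measurableEmbedding_coeffs.comap_map]

theorem fixedMassMeasure_eq {m : ℝ} (hm : 0 < m) : fixedMassMeasure m = fixedMassLaw m := by
  have := isProbabilityMeasure_fixedMassLaw hm
  have hex : ∃ ν : Measure L2, IsFixedMassLimit m ν := ⟨_, isFixedMassLimit_fixedMassLaw hm⟩
  rw [fixedMassMeasure, dif_pos hex]
  exact hex.choose_spec.unique (isFixedMassLimit_fixedMassLaw hm)

/-! ### Convergence of the energies -/

/-- The squared distance of the components to their limits. -/
def componentError (N : ℕ) (g : ℤ → ℂ) : ℝ :=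
  ∑ i, (component i N g - componentLimit i g) ^ 2

theorem measurable_componentError (N : ℕ) : Measurable (componentError N) := by
  unfold componentError
  have h1 := fun i => measurable_component i N
  have h2 := measurable_componentLimit
  fun_prop

theorem exists_lintegral_componentError_le :
    ∃ C : ℝ, ∀ N : ℕ, ∫⁻ g, ENNReal.ofReal (componentError N g) ∂gaussianFamily ≤
      ENNReal.ofReal (C * ((N : ℝ) + 1) ^ (-(1 / 2) : ℝ)) := by
  obtain ⟨C, hC, h⟩ := exists_lintegral_component_sub_limit_le
  refine ⟨5 * C, fun N => ?_⟩
  have h1 := fun i => measurable_component i N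
  have h2 := measurable_componentLimit
  simp_rw [componentError, ENNReal.ofReal_sum_of_nonneg fun i _ => sq_nonneg _]
  rw [lintegral_finsetSum _ fun i _ => by fun_prop]
  refine (Finset.sum_le_sum fun i _ => h i N).trans ?_
  have hp : 0 ≤ C * ((N : ℝ) + 1) ^ (-(1 / 2) : ℝ) := by positivity
  rw [Finset.sum_const, Finset.card_univ, Fintype.card_fin, nsmul_eq_mul,
    ← ENNReal.ofReal_natCast, ← ENNReal.ofReal_mul (by positivity)]
  exact ENNReal.ofReal_le_ofReal (by push_cast; linarith)

theorem tendsto_lintegral_componentError :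
    Tendsto (fun N => ∫⁻ g, ENNReal.ofReal (componentError N g) ∂gaussianFamily) atTop (𝓝 0) := by
  obtain ⟨C, h⟩ := exists_lintegral_componentError_le
  refine tendsto_of_tendsto_of_tendsto_of_le_of_le tendsto_const_nhds ?_ (fun _ => zero_le) h
  have h1 : Tendsto (fun N : ℕ => ((N : ℝ) + 1) ^ (-(1 / 2) : ℝ)) atTop (𝓝 0) :=
    (tendsto_rpow_neg_atTop (by norm_num : (0 : ℝ) < 1 / 2)).comp
      (tendsto_natCast_atTop_atTop.atTop_add tendsto_const_nhds)
  have h2 := ENNReal.tendsto_ofReal (h1.const_mul C)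
  simpa using h2

theorem zeroPoly_sq_le (i : Fin 5) (z : ℂ) : zeroPoly i z ^ 2 ≤ 9 * (1 + ‖z‖ ^ 2) ^ 2 := by
  have hz : ‖z‖ ^ 2 = z.re ^ 2 + z.im ^ 2 := by
    rw [Complex.sq_norm, Complex.normSq_apply]
    ring
  have h0 := sq_nonneg z.re
  have h1 := sq_nonneg z.im
  have h2 := sq_nonneg (‖z‖ ^ 2)
  have h3 := sq_nonneg ‖z‖
  unfold zeroPoly
  fin_cases i <;> simp only [Fin.reduceFinMk, Fin.zero_eta, Fin.mk_one, Matrix.cons_val]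
  · nlinarith [sq_nonneg (z.re - z.im), sq_nonneg (1 + z.re), sq_nonneg (1 + z.im)]
  · nlinarith
  · nlinarith
  · nlinarith
  · nlinarith

theorem IsRegular.energy_sub_sq_le {g : ℤ → ℂ} (hg : IsRegular g) (N : ℕ) (z : ℂ) :
    (energyTerm N (randomSeries (Function.update g 0 z)) -
      energyLimit (randomSeries (Function.update g 0 z))) ^ 2 ≤
      45 * (1 + ‖z‖ ^ 2) ^ 2 * componentError N g := by
  rw [energyTerm_randomSeries ((squareSummable_update 0 z).mpr hg.squareSummable),
    energyLimit_randomSeries hg.squareSummable hg.componentsConverge]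
  refine (quarticForm_sub_quarticLimit_sq_le N g z).trans ?_
  rw [componentError, Finset.mul_sum, Finset.mul_sum]
  refine Finset.sum_le_sum fun i _ => ?_
  have := mul_le_mul_of_nonneg_right (zeroPoly_sq_le i z)
    (sq_nonneg (component i N g - componentLimit i g))
  linarith

/-- The squared distance of `f_N` to `f`. -/
def energyError (N : ℕ) (u : L2) : ℝ≥0∞ := ENNReal.ofReal ((energyTerm N u - energyLimit u) ^ 2)

theorem measurable_energyError (N : ℕ) : Measurable (energyError N) := by
  have h1 := measurable_energyTerm N
  have h2 := measurable_energyLimit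
  unfold energyError
  fun_prop

theorem energyTerm_zero (u : L2) : energyTerm 0 u = 0 := by
  rw [energyTerm_eq, quarticForm]
  simp [modes]

theorem eLpNorm_energy_eq (N : ℕ) (ν : Measure L2) :
    eLpNorm (fun u => energyTerm N u - energyLimit u) 2 ν =
      (∫⁻ u, energyError N u ∂ν) ^ (1 / 2 : ℝ) := by
  rw [eLpNorm_eq_lintegral_rpow_enorm_toReal (by norm_num) (by norm_num)]
  norm_num
  congr 1
  refine lintegral_congr fun u => ?_
  rw [energyError, ← ofReal_norm, ← ENNReal.ofReal_pow (norm_nonneg _), Real.norm_eq_abs, sq_abs]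

theorem energyConverges_of_le {ν : Measure L2} {K : ℝ≥0∞} (hK : K ≠ ∞)
    (h : ∀ N, ∫⁻ u, energyError N u ∂ν ≤
      K * ∫⁻ g, ENNReal.ofReal (componentError N g) ∂gaussianFamily) : EnergyConverges ν := by
  constructor
  · refine ⟨measurable_energyLimit.aestronglyMeasurable, ?_⟩
    -- As f_0 = 0, the error bound at N = 0 is the square integrability of f.
    have h1 := eLpNorm_energy_eq 0 ν
    simp only [energyTerm_zero, zero_sub] at h1
    have h2 : eLpNorm (fun u => -energyLimit u) 2 ν = eLpNorm energyLimit 2 ν :=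
      eLpNorm_neg energyLimit 2 ν
    rw [h2] at h1
    rw [h1]
    refine ENNReal.rpow_lt_top_of_nonneg (by norm_num) (ne_top_of_le_ne_top ?_ (h 0))
    obtain ⟨C, hC⟩ := exists_lintegral_componentError_le
    exact ENNReal.mul_ne_top hK (ne_top_of_le_ne_top ENNReal.ofReal_ne_top (hC 0))
  · simp_rw [eLpNorm_energy_eq]
    have h1 := ENNReal.Tendsto.const_mul tendsto_lintegral_componentError (Or.inr hK)
    rw [mul_zero] at h1
    have h2 := tendsto_of_tendsto_of_tendsto_of_le_of_le tendsto_const_nhds h1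
      (fun _ => zero_le) h
    have h3 := h2.ennrpow_const (1 / 2 : ℝ)
    rwa [ENNReal.zero_rpow_of_pos (by norm_num)] at h3

theorem energyError_le {g : ℤ → ℂ} (hg : IsRegular g) (N : ℕ) (z : ℂ) :
    energyError N (randomSeries (Function.update g 0 z)) ≤
      ENNReal.ofReal (45 * (1 + ‖z‖ ^ 2) ^ 2) * ENNReal.ofReal (componentError N g) := by
  rw [← ENNReal.ofReal_mul (by positivity)]
  exact ENNReal.ofReal_le_ofReal (hg.energy_sub_sq_le N z)

theorem energyConverges_gaussianMeasure : EnergyConverges gaussianMeasure := by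
  refine energyConverges_of_le (K := ∫⁻ z, ENNReal.ofReal (45 * (1 + ‖z‖ ^ 2) ^ 2)
    ∂complexGaussian) ?_ fun N => ?_
  · have hpt : ∀ z : ℂ, ENNReal.ofReal (45 * (1 + ‖z‖ ^ 2) ^ 2) ≤
        ENNReal.ofReal 90 + ENNReal.ofReal 90 * ENNReal.ofReal (‖z‖ ^ (2 * 2)) := by
      intro z
      rw [← ENNReal.ofReal_mul (by norm_num), ← ENNReal.ofReal_add (by norm_num) (by positivity)]
      refine ENNReal.ofReal_le_ofReal ?_
      have : ‖z‖ ^ (2 * 2) = (‖z‖ ^ 2) ^ 2 := by ring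
      rw [this]
      nlinarith [sq_nonneg (1 - ‖z‖ ^ 2)]
    refine ne_top_of_le_ne_top ?_ (lintegral_mono hpt)
    rw [lintegral_add_left measurable_const, lintegral_const, lintegral_const_mul _ (by fun_prop)]
    refine ENNReal.add_ne_top.mpr ⟨by simp, ENNReal.mul_ne_top ENNReal.ofReal_ne_top ?_⟩
    exact ne_top_of_le_ne_top ENNReal.ofReal_ne_top (lintegral_norm_pow_le 2)
  · have hm := measurable_energyError N
    have he := measurable_componentError N
    rw [gaussianMeasure, lintegral_map hm measurable_randomSeries,
      gaussianFamily_resamples 0 (fun g => energyError N (randomSeries g))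
        (hm.comp measurable_randomSeries), ← lintegral_const_mul _ (by fun_prop)]
    refine lintegral_mono_ae ?_
    filter_upwards [ae_isRegular] with g hg
    rw [← lintegral_mul_const _ (by fun_prop)]
    exact lintegral_mono fun z => energyError_le hg N z

theorem norm_sq_polarPoint_zero_mode {s : ℝ} {g : ℤ → ℂ} (h : massOff 0 g < s) (θ : ℝ) :
    ‖polarPoint (bracket 0 ^ 2 * (s - massOff 0 g)) θ‖ ^ 2 = s - massOff 0 g := by
  rw [norm_polarPoint, bracket_zero, one_pow, one_mul, Real.sq_sqrt (by linarith)]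

/-- The zero mode enters the error bound only through a polynomial, which is bounded on the sphere,
and the density of the sphere measure is at most 1 for k = 0. What remains is a Gaussian integral
over the other modes, the same as for μ. -/
theorem energyConverges_fixedMassLaw {m : ℝ} (hm : 0 < m) : EnergyConverges (fixedMassLaw m) := by
  refine energyConverges_of_le (K := (sphereMeasure 0 m Set.univ)⁻¹ *
    ENNReal.ofReal (45 * (1 + m) ^ 2)) ?_ fun N => ?_
  · exact ENNReal.mul_ne_top (ENNReal.inv_ne_top.mpr (sphereMeasure_univ_pos 0 hm).ne')
      ENNReal.ofReal_ne_top
  · have he := measurable_energyError N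
    rw [lintegral_fixedMassLaw m he, mul_assoc]
    gcongr
    rw [lintegral_sphereMeasure 0 m (H := fun g => energyError N (randomSeries g))
      (he.comp measurable_randomSeries),
      ← lintegral_const_mul' _ _ ENNReal.ofReal_ne_top]
    refine lintegral_mono_ae ?_
    filter_upwards [ae_isRegular] with g hg
    refine (lintegral_mono (g := fun _ => ENNReal.ofReal (45 * (1 + m) ^ 2) *
      ENNReal.ofReal (componentError N g)) fun θ => ?_).trans (le_of_eq (by simp))
    by_cases hs : massOff 0 g < m
    · have h1 := sphereDensity_le 0 m g
      rw [bracket_zero, one_pow, ENNReal.ofReal_one] at h1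
      refine (mul_le_of_le_one_left' h1).trans ((energyError_le hg N _).trans ?_)
      rw [norm_sq_polarPoint_zero_mode hs]
      have h2 := massOff_nonneg 0 g
      refine mul_le_mul' (ENNReal.ofReal_le_ofReal ?_) le_rfl
      have h3 : (1 + (m - massOff 0 g)) ^ 2 ≤ (1 + m) ^ 2 :=
        pow_le_pow_left₀ (by linarith) (by linarith) 2
      linarith
    · rw [sphereDensity, if_neg hs, zero_mul]
      exact zero_le

/-! ### The weighted measures -/

theorem weight_ne_top (u : L2) : weight u ≠ ∞ :=
  ne_top_of_le_ne_top ENNReal.ofReal_ne_top (weight_le u)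

theorem lowMass_le_massOff {g : ℤ → ℂ} (hg : SquareSummable g) (N : ℕ) :
    lowMass N g ≤ massOff 0 g := by
  have h : ENNReal.ofReal (lowMass N g) ≤ offMass {0} g := by
    rw [lowMass, ENNReal.ofReal_sum_of_nonneg fun n _ => by positivity]
    refine le_trans (Finset.sum_le_sum fun n hn => ?_) (ENNReal.sum_le_tsum (shell 0 N))
    rw [if_neg (by simpa using ne_zero_of_mem_shell hn), norm_coeffSeq_sq]
  exact (ENNReal.ofReal_le_iff_le_toReal (offMass_ne_top hg _)).mp h

theorem weight_spherePoint_le {m : ℝ} (hm' : m ≤ massThreshold) {g : ℤ → ℂ}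
    (hg : IsRegular g) {s : ℝ} (hs : s ≤ 2 * m) (h : massOff 0 g < s) (θ : ℝ) :
    weight (randomSeries (spherePoint 0 s g θ)) ≤ envelopeLimit m g := by
  refine (weight_le _).trans ?_
  rw [spherePoint, energyLimit_randomSeries hg.squareSummable hg.componentsConverge]
  refine exp_quarticLimit_le hm' hg.componentsConverge ?_ fun N => ?_
  · rw [norm_sq_polarPoint_zero_mode h]
    linarith [massOff_nonneg 0 g]
  · linarith [lowMass_le_massOff hg.squareSummable N]

/-- The limit theorem with k = 0, the mode in which the weight is continuous; the limiting envelope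
times the bound of W dominates. -/
theorem tendsto_lintegral_weight_mul {m : ℝ} (hm : 0 < m) (hm' : m ≤ massThreshold)
    {W : L2 → ℝ≥0∞} (hW : Measurable W) {B : ℝ≥0∞} (hB : B ≠ ∞) (hWB : ∀ u, W u ≤ B)
    (hcont : ∀ᵐ g ∂gaussianFamily, Continuous fun z => W (randomSeries (Function.update g 0 z))) :
    Tendsto (fun ε : ℝ => ∫⁻ u, weight u * W u ∂(shellMeasure m ε)) (𝓝[>] 0)
      (𝓝 (∫⁻ u, weight u * W u ∂(fixedMassLaw m))) := by
  have hmul : Measurable fun u => weight u * W u := measurable_weight.mul hW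
  rw [lintegral_fixedMassLaw m hmul]
  refine tendsto_lintegral_shellMeasure 0 hmul hm ?_
    (D := fun g => envelopeLimit m g * B) ((measurable_envelopeLimit m).mul_const B) ?_ ?_
  · filter_upwards [ae_isRegular, hcont] with g hg hWg
    refine continuous_iff_continuousAt.mpr fun z => ?_
    exact ENNReal.Tendsto.mul (hg.continuous_weight.tendsto z)
      (Or.inr (ne_top_of_le_ne_top hB (hWB _))) (hWg.tendsto z) (Or.inr (weight_ne_top _))
  · rw [lintegral_mul_const' _ _ hB]
    exact ENNReal.mul_ne_top (lintegral_envelopeLimit_ne_top hm hm') hB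
  · filter_upwards [ae_isRegular] with g hg s θ hs h
    exact mul_le_mul' (weight_spherePoint_le hm' hg hs h θ) (hWB _)

/-- The sphere measure is absolutely continuous in the modes other than zero only. So an almost sure
property carries over if it holds for all values of the zero mode simultaneously. -/
theorem ae_sphereMeasure {m : ℝ} {q : (ℤ → ℂ) → Prop} (hq : MeasurableSet {g | q g})
    (h : ∀ᵐ g ∂gaussianFamily, ∀ z, q (Function.update g 0 z)) :
    ∀ᵐ g ∂(sphereMeasure 0 m), q g := by
  have := isFiniteMeasure_withDensity_sphereDensity 0 m
  rw [sphereMeasure, ae_map_iff (measurable_spherePoint_right 0 m).aemeasurable hq]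
  have h1 := (withDensity_absolutelyContinuous gaussianFamily (sphereDensity 0 m)).ae_le h
  have h2 : ∀ᵐ p ∂((gaussianFamily.withDensity (sphereDensity 0 m)).prod angleMeasure),
      ∀ z, q (Function.update p.1 0 z) := Measure.quasiMeasurePreserving_fst.ae h1
  filter_upwards [h2] with p hp using hp _

theorem lintegral_weight_fixedMassLaw_ne_top {m : ℝ} (hm : 0 < m) (hm' : m ≤ massThreshold) :
    ∫⁻ u, weight u ∂(fixedMassLaw m) ≠ ∞ := by
  rw [lintegral_fixedMassLaw m measurable_weight]
  refine ENNReal.mul_ne_top (ENNReal.inv_ne_top.mpr (sphereMeasure_univ_pos 0 hm).ne') ?_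
  rw [lintegral_sphereMeasure 0 m (H := fun g => weight (randomSeries g))
    (measurable_weight.comp measurable_randomSeries)]
  refine ne_top_of_le_ne_top (lintegral_envelopeLimit_ne_top hm hm') (lintegral_mono_ae ?_)
  filter_upwards [ae_isRegular] with g hg
  refine (lintegral_mono (g := fun _ => envelopeLimit m g) fun θ => ?_).trans
    (le_of_eq (by simp))
  by_cases hs : massOff 0 g < m
  · have h1 := sphereDensity_le 0 m g
    rw [bracket_zero, one_pow, ENNReal.ofReal_one] at h1
    exact (mul_le_of_le_one_left' h1).trans
      (weight_spherePoint_le hm' hg (by linarith) hs θ)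
  · rw [sphereDensity, if_neg hs, zero_mul]
    exact zero_le

theorem lintegral_weight_fixedMassLaw_ne_zero {m : ℝ} (hm : 0 < m) :
    ∫⁻ u, weight u ∂(fixedMassLaw m) ≠ 0 := by
  have hw : Measurable fun g => weight (randomSeries g) :=
    measurable_weight.comp measurable_randomSeries
  rw [lintegral_fixedMassLaw m measurable_weight]
  refine mul_ne_zero (ENNReal.inv_ne_zero.mpr (measure_ne_top _ _)) fun h0 => ?_
  rw [lintegral_eq_zero_iff hw] at h0
  have hpos : ∀ᵐ g ∂(sphereMeasure 0 m), weight (randomSeries g) ≠ 0 := by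
    refine ae_sphereMeasure (hw (measurableSet_singleton 0)).compl ?_
    filter_upwards [ae_isRegular] with g hg z
    exact (hg.weight_pos z).ne'
  have hfalse : ∀ᵐ _ ∂(sphereMeasure 0 m), False := by
    filter_upwards [h0, hpos] with g h1 h2 using h2 h1
  have huniv := (sphereMeasure_univ_pos 0 hm).ne'
  rw [ae_iff] at hfalse
  simp only [not_false_eq_true, Set.ofPred_true] at hfalse
  exact huniv hfalse

theorem isProbabilityMeasure_reweight {ν : Measure L2} (h0 : ∫⁻ u, weight u ∂ν ≠ 0)
    (h1 : ∫⁻ u, weight u ∂ν ≠ ∞) : IsProbabilityMeasure (reweight ν) := by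
  constructor
  rw [reweight, Measure.smul_apply, withDensity_apply _ .univ, Measure.restrict_univ, smul_eq_mul,
    ENNReal.inv_mul_cancel h0 h1]

theorem lintegral_reweight (ν : Measure L2) {W : L2 → ℝ≥0∞} (hW : Measurable W) :
    ∫⁻ u, W u ∂(reweight ν) = (∫⁻ u, weight u ∂ν)⁻¹ * ∫⁻ u, weight u * W u ∂ν := by
  rw [reweight, lintegral_smul_measure, smul_eq_mul,
    lintegral_withDensity_eq_lintegral_mul _ measurable_weight hW]
  rfl

theorem ae_reweight {ν : Measure L2} {q : L2 → Prop} (h : ∀ᵐ u ∂ν, q u) :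
    ∀ᵐ u ∂(reweight ν), q u :=
  Measure.ae_smul_measure ((withDensity_absolutelyContinuous ν weight).ae_le h) _

theorem ae_mem_sobolev {σ : ℝ} (hσ : σ < 1 / 2) :
    ∀ᵐ g ∂gaussianFamily, SquareSummable g ∧ SobolevSummable σ g := by
  filter_upwards [ae_squareSummable, ae_summable_bracket_mul hσ] with g h1 h2 using ⟨h1, h2⟩

theorem ae_shellMeasure_mem_sobolev {σ : ℝ} (hσ : σ < 1 / 2) (m ε : ℝ) :
    ∀ᵐ u ∂(shellMeasure m ε), coeffs u ∈ sobolevSubmodule σ := by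
  refine ProbabilityTheory.cond_absolutelyContinuous.ae_le ?_
  rw [gaussianMeasure]
  refine (ae_map_iff measurable_randomSeries.aemeasurable (measurableSet_mem_sobolev σ)).mpr ?_
  filter_upwards [ae_mem_sobolev hσ] with g hg using coeffs_randomSeries_mem hg.1 hg.2

theorem ae_fixedMassLaw_mem_sobolev {σ : ℝ} (hσ : σ < 1 / 2) (m : ℝ) :
    ∀ᵐ u ∂(fixedMassLaw m), coeffs u ∈ sobolevSubmodule σ := by
  refine Measure.ae_smul_measure ?_ _
  refine (ae_map_iff measurable_randomSeries.aemeasurable (measurableSet_mem_sobolev σ)).mpr ?_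
  refine ae_sphereMeasure (measurable_randomSeries (measurableSet_mem_sobolev σ)) ?_
  filter_upwards [ae_mem_sobolev hσ] with g hg z
  exact coeffs_randomSeries_mem ((squareSummable_update 0 z).mpr hg.1)
    ((sobolevSummable_update 0 z).mpr hg.2)

theorem tendsto_lintegral_weight {m : ℝ} (hm : 0 < m) (hm' : m ≤ massThreshold) :
    Tendsto (fun ε : ℝ => ∫⁻ u, weight u ∂(shellMeasure m ε)) (𝓝[>] 0)
      (𝓝 (∫⁻ u, weight u ∂(fixedMassLaw m))) := by
  have h := tendsto_lintegral_weight_mul hm hm' (W := fun _ => 1) measurable_const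
    ENNReal.one_ne_top (fun _ => le_rfl) (Eventually.of_forall fun _ => continuous_const)
  simpa only [mul_one] using h

theorem eventually_lintegral_weight {m : ℝ} (hm : 0 < m) (hm' : m ≤ massThreshold) :
    ∀ᶠ ε : ℝ in 𝓝[>] 0, ∫⁻ u, weight u ∂(shellMeasure m ε) ≠ 0 ∧
      ∫⁻ u, weight u ∂(shellMeasure m ε) ≠ ∞ :=
  ((tendsto_lintegral_weight hm hm').eventually_ne
    (lintegral_weight_fixedMassLaw_ne_zero hm)).and
  ((tendsto_lintegral_weight hm hm').eventually_ne
    (lintegral_weight_fixedMassLaw_ne_top hm hm'))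

theorem isProbabilityMeasure_onSobolev {σ : ℝ} {ν : Measure L2} [IsProbabilityMeasure ν]
    (h : ∀ᵐ u ∂ν, coeffs u ∈ sobolevSubmodule σ) : IsProbabilityMeasure (onSobolev σ ν) := by
  rw [onSobolev_eq_map h]
  exact Measure.isProbabilityMeasure_map (measurable_toSobolev σ).aemeasurable

/-- The function `F + ‖F‖`, pulled back to `L²`. -/
def shifted {σ : ℝ} (F : Sobolev σ →ᵇ ℝ) (u : L2) : ℝ≥0∞ :=
  ENNReal.ofReal (F (toSobolev σ u) + ‖F‖)

theorem measurable_shifted {σ : ℝ} (F : Sobolev σ →ᵇ ℝ) : Measurable (shifted F) := by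
  have h := F.continuous.measurable.comp (measurable_toSobolev σ)
  exact (h.add_const ‖F‖).ennreal_ofReal

theorem shifted_le {σ : ℝ} (F : Sobolev σ →ᵇ ℝ) (u : L2) :
    shifted F u ≤ ENNReal.ofReal (2 * ‖F‖) := by
  refine ENNReal.ofReal_le_ofReal ?_
  have := (abs_le.mp (F.norm_coe_le_norm (toSobolev σ u))).2
  linarith

theorem integral_onSobolev {σ : ℝ} {ν : Measure L2} [IsProbabilityMeasure ν]
    (h : ∀ᵐ u ∂ν, coeffs u ∈ sobolevSubmodule σ) (F : Sobolev σ →ᵇ ℝ) :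
    ∫ u, F u ∂(onSobolev σ ν) = (∫⁻ u, shifted F u ∂ν).toReal - ‖F‖ := by
  have hm := measurable_toSobolev σ
  have hF : Measurable fun u => F (toSobolev σ u) := F.continuous.measurable.comp hm
  have hintegral : Integrable (fun u => F (toSobolev σ u)) ν :=
    Integrable.of_bound hF.aestronglyMeasurable ‖F‖
      (Eventually.of_forall fun u => F.norm_coe_le_norm _)
  have e : (∫⁻ u, shifted F u ∂ν).toReal = ∫ u, (F (toSobolev σ u) + ‖F‖) ∂ν := by
    refine (integral_eq_lintegral_of_nonneg_ae (Eventually.of_forall fun u => ?_)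
      (hF.add_const _).aestronglyMeasurable).symm
    have := (abs_le.mp (F.norm_coe_le_norm (toSobolev σ u))).1
    simp only [Pi.zero_apply]
    linarith
  rw [onSobolev_eq_map h, integral_map hm.aemeasurable F.continuous.aestronglyMeasurable, e,
    integral_add hintegral (integrable_const _)]
  simp

/-- Numerator and normalizing constant converge separately, the latter to a finite and nonzero
limit. Adding ‖F‖ makes the test function nonnegative, and the constant drops out again because the
measures are probability measures. -/
theorem tendsto_integral_onSobolev {m : ℝ} (hm : 0 < m) (hm' : m ≤ massThreshold) {σ : ℝ}
    (hσ : σ < 1 / 2) (F : Sobolev σ →ᵇ ℝ) :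
    Tendsto (fun ε : ℝ => ∫ u, F u ∂(onSobolev σ (rhoShell m ε))) (𝓝[>] 0)
      (𝓝 (∫ u, F u ∂(onSobolev σ (reweight (fixedMassLaw m))))) := by
  have h0 := lintegral_weight_fixedMassLaw_ne_zero hm
  have h1 := lintegral_weight_fixedMassLaw_ne_top hm hm'
  have hF := measurable_shifted F
  have hlim := tendsto_lintegral_weight_mul hm hm' hF ENNReal.ofReal_ne_top (shifted_le F) (by
    filter_upwards [ae_mem_sobolev hσ] with g hg
    have := F.continuous.comp (continuous_toSobolev_randomSeries hg.1 hg.2)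
    exact ENNReal.continuous_ofReal.comp (this.add continuous_const))
  have hprob := isProbabilityMeasure_reweight h0 h1
  have hquot : Tendsto (fun ε : ℝ => ∫⁻ u, shifted F u ∂(rhoShell m ε)) (𝓝[>] 0)
      (𝓝 (∫⁻ u, shifted F u ∂(reweight (fixedMassLaw m)))) := by
    simp_rw [rhoShell, lintegral_reweight _ hF]
    exact ENNReal.Tendsto.mul (tendsto_lintegral_weight hm hm').inv
      (Or.inl (ENNReal.inv_ne_zero.mpr h1)) hlim (Or.inr (ENNReal.inv_ne_top.mpr h0))
  have hfin : ∫⁻ u, shifted F u ∂(reweight (fixedMassLaw m)) ≠ ∞ := by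
    refine ne_top_of_le_ne_top ?_ (lintegral_mono (shifted_le F))
    rw [lintegral_const, measure_univ, mul_one]
    exact ENNReal.ofReal_ne_top
  rw [integral_onSobolev (ae_reweight (ae_fixedMassLaw_mem_sobolev hσ m)) F]
  refine (((ENNReal.tendsto_toReal hfin).comp hquot).sub_const ‖F‖).congr' ?_
  filter_upwards [eventually_lintegral_weight hm hm'] with ε hε
  have : IsProbabilityMeasure (reweight (shellMeasure m ε)) :=
    isProbabilityMeasure_reweight hε.1 hε.2
  exact (integral_onSobolev (ae_reweight (ae_shellMeasure_mem_sobolev hσ m ε)) F).symm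

end DNLS

end

/-! ### The theorem -/

theorem theorem1215 :
    ∃ m' : ℝ, 0 < m' ∧ ∀ m : ℝ, 0 < m → m < m' →
      -- the objects are well defined: `μ_m` is the limit of `μ_m^ε`, and `f` is the limit of `f_N`
      DNLS.IsFixedMassLimit m (DNLS.fixedMassMeasure m) ∧
      DNLS.EnergyConverges DNLS.gaussianMeasure ∧
      DNLS.EnergyConverges (DNLS.fixedMassMeasure m) ∧
      ∀ σ : ℝ, σ < 1 / 2 →
        -- `ρ_m^ε` and `ρ_m` are probability measures on `H^σ`
        (∀ᶠ ε : ℝ in 𝓝[>] 0, IsProbabilityMeasure (DNLS.onSobolev σ (DNLS.rhoShell m ε))) ∧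
        IsProbabilityMeasure (DNLS.onSobolev σ (DNLS.rho m)) ∧
        -- weak convergence
        ∀ F : DNLS.Sobolev σ →ᵇ ℝ,
          Tendsto (fun ε : ℝ => ∫ u, F u ∂(DNLS.onSobolev σ (DNLS.rhoShell m ε))) (𝓝[>] 0)
            (𝓝 (∫ u, F u ∂(DNLS.onSobolev σ (DNLS.rho m)))) := by
  refine ⟨DNLS.massThreshold, DNLS.massThreshold_pos, fun m hm hm' => ?_⟩
  rw [DNLS.rho, DNLS.fixedMassMeasure_eq hm]
  refine ⟨DNLS.isFixedMassLimit_fixedMassLaw hm, DNLS.energyConverges_gaussianMeasure,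
    DNLS.energyConverges_fixedMassLaw hm, fun σ hσ => ⟨?_, ?_,
      DNLS.tendsto_integral_onSobolev hm hm'.le hσ⟩⟩
  · filter_upwards [DNLS.eventually_lintegral_weight hm hm'.le] with ε hε
    have : IsProbabilityMeasure (DNLS.rhoShell m ε) :=
      DNLS.isProbabilityMeasure_reweight hε.1 hε.2
    exact DNLS.isProbabilityMeasure_onSobolev
      (DNLS.ae_reweight (DNLS.ae_shellMeasure_mem_sobolev hσ m ε))
  · have := DNLS.isProbabilityMeasure_reweight
      (DNLS.lintegral_weight_fixedMassLaw_ne_zero hm)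
      (DNLS.lintegral_weight_fixedMassLaw_ne_top hm hm'.le)
    exact DNLS.isProbabilityMeasure_onSobolev
      (DNLS.ae_reweight (DNLS.ae_fixedMassLaw_mem_sobolev hσ m))
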